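/- Let $(M,g,\omega)$ be an almost-Kähler Einstein $4$-manifold, not necessarily compact: $M$ is a smooth $4$-manifold, $\omega$ is a symplectic form, $J$ is an almost-complex structure such that $g(v,w)=\omega(v,Jw)$ is a Riemannian metric, and the Ricci tensor of $g$ is a constant multiple of $g$. Let $s$ be the (constant) scalar curvature of $g$, and let $s^\star=\tfrac12 R^{abcd}\omega_{ab}\omega_{cd}$ be the star-scalar curvature, where $R$ is the Riemann curvature tensor. Let $c_1=c_1(M,J)$ be the first Chern class of the complex vector bundle $(TM,J)$. Let $\Sigma$ be a compact, possibly disconnected, Riemann surface with complex structure $J_\Sigma$, and let $\psi:\Sigma\to M$ be a $J$-holomorphic curve, i.e. a smooth, locally non-constant map with $J\circ\psi_*=\psi_*\circ J_\Sigma$. Write $[\Sigma]$ for the image in $H_2(M,\mathbb Z)$ of the fundamental cycle of $\Sigma$, so that $[\omega]\cdot[\Sigma]=\int_\Sigma\psi^*\omega$. Then $$ s\,[\omega]\cdot[\Sigma]\;\le\; 8\pi\, c_1\cdot[\Sigma]\;\le\;\int_\Sigma \psi^*(s^\star\omega). $$ In particular, if $s^\star\le 0$ on $M$, then $c_1\cdot[\Sigma]\le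 0$. -/

import Mathlib

open scoped Manifold ContDiff Topology
open Bundle

noncomputable section

/-! ### Local coordinates and tensor components -/

/-- The `i`-th coordinate vector of `ℝⁿ`. -/
def coordVec {n : ℕ} (i : Fin n) : EuclideanSpace ℝ (Fin n) := EuclideanSpace.single i 1

/-- The partial derivative `∂ᵢ f (y)` of a real function on `ℝⁿ`. -/
def partialDeriv {n : ℕ} (i : Fin n) (f : EuclideanSpace ℝ (Fin n) → ℝ)
    (y : EuclideanSpace ℝ (Fin n)) : ℝ :=
  fderiv ℝ f y (coordVec i)

section Charts

variable {n : ℕ} {M : Type*} [TopologicalSpace M] [ChartedSpace (EuclideanSpace ℝ (Fin n)) M]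

/-- The coordinate vector field `∂ᵢ = (dφ)⁻¹(eᵢ)` of the preferred chart `φ` at `p`
(meaningful on the source of that chart). -/
def coordField (p : M) (i : Fin n) (q : M) : TangentSpace (𝓡 n) q :=
  (mvfderiv (𝓡 n) (extChartAt (𝓡 n) p) q).inverse (coordVec i)

/-- The coordinate covector `dxⁱ` at `q` of the preferred chart at `p`. -/
def coordCovec (p : M) (i : Fin n) (q : M) : TangentSpace (𝓡 n) q →L[ℝ] ℝ :=
  (EuclideanSpace.proj i : EuclideanSpace ℝ (Fin n) →L[ℝ] ℝ) ∘L
    mvfderiv (𝓡 n) (extChartAt (𝓡 n) p) q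

/-- The components `β_{ij}(y) = β(∂ᵢ, ∂ⱼ)` of a field of bilinear forms in the chart at `p`. -/
def bilinComp (β : ∀ q : M, TangentSpace (𝓡 n) q →L[ℝ] TangentSpace (𝓡 n) q →L[ℝ] ℝ)
    (p : M) (i j : Fin n) (y : EuclideanSpace ℝ (Fin n)) : ℝ :=
  β ((extChartAt (𝓡 n) p).symm y)
    (coordField p i ((extChartAt (𝓡 n) p).symm y)) (coordField p j ((extChartAt (𝓡 n) p).symm y))

/-- `dω = 0`, written in every preferred chart:
`∂ᵢ ω_{jk} + ∂ⱼ ω_{ki} + ∂ₖ ω_{ij} = 0`. -/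
def IsClosedTwoForm (Om : ∀ q : M, TangentSpace (𝓡 n) q →L[ℝ] TangentSpace (𝓡 n) q →L[ℝ] ℝ) :
    Prop :=
  ∀ p : M, ∀ y ∈ (extChartAt (𝓡 n) p).target, ∀ i j k : Fin n,
    partialDeriv i (bilinComp Om p j k) y + partialDeriv j (bilinComp Om p k i) y
      + partialDeriv k (bilinComp Om p i j) y = 0

end Charts

/-- Given connection coefficients `Γ y i j k = Γ^k_{ij}(y)` (that is `∇_{∂ᵢ} ∂ⱼ = Γ^k_{ij} ∂ₖ`),
`curvComp Γ y i j k l` is the `∂_l`-component of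
`R(∂ᵢ, ∂ⱼ) ∂ₖ = ∇_{∂ᵢ} ∇_{∂ⱼ} ∂ₖ - ∇_{∂ⱼ} ∇_{∂ᵢ} ∂ₖ`. -/
def curvComp {n : ℕ} (Γ : EuclideanSpace ℝ (Fin n) → Fin n → Fin n → Fin n → ℝ)
    (y : EuclideanSpace ℝ (Fin n)) (i j k l : Fin n) : ℝ :=
  partialDeriv i (fun z => Γ z j k l) y - partialDeriv j (fun z => Γ z i k l) y
    + ∑ m, (Γ y j k m * Γ y i m l - Γ y i k m * Γ y j m l)

/-! ### Riemannian curvature -/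

section Riemannian

variable {n : ℕ} {M : Type*} [TopologicalSpace M] [ChartedSpace (EuclideanSpace ℝ (Fin n)) M]
  [IsManifold (𝓡 n) ∞ M]

/-- A smooth Riemannian metric on an `n`-manifold. -/
abbrev SmoothMetric (n : ℕ) (M : Type*) [TopologicalSpace M]
    [ChartedSpace (EuclideanSpace ℝ (Fin n)) M] [IsManifold (𝓡 n) ∞ M] :=
  ContMDiffRiemannianMetric (𝓡 n) ∞ (EuclideanSpace ℝ (Fin n))
    (fun p : M => TangentSpace (𝓡 n) p)

/-- The matrix `(g_{ij}(y))` in the chart at `p`. -/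
def metricMatrix (g : SmoothMetric n M) (p : M) (y : EuclideanSpace ℝ (Fin n)) :
    Matrix (Fin n) (Fin n) ℝ :=
  Matrix.of fun i j => bilinComp g.inner p i j y

/-- The Christoffel symbols
`Γ^k_{ij} = ½ g^{kl} (∂ᵢ g_{jl} + ∂ⱼ g_{il} - ∂_l g_{ij})` of the Levi-Civita connection in the
chart at `p`. -/
def christoffel (g : SmoothMetric n M) (p : M) (y : EuclideanSpace ℝ (Fin n))
    (i j k : Fin n) : ℝ :=
  (1 / 2) * ∑ l, (metricMatrix g p y)⁻¹ k l *
    (partialDeriv i (bilinComp g.inner p j l) y + partialDeriv j (bilinComp g.inner p i l) y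
      - partialDeriv l (bilinComp g.inner p i j) y)

/-- The component `R_{ijk}{}^l` at `p` of the Riemann tensor: `R(∂ᵢ, ∂ⱼ) ∂ₖ = R_{ijk}{}^l ∂_l`. -/
def riemannUp (g : SmoothMetric n M) (p : M) (i j k l : Fin n) : ℝ :=
  curvComp (christoffel g p) (extChartAt (𝓡 n) p p) i j k l

/-- The component `g_{ij}` of the metric at `p`. -/
def metricAt (g : SmoothMetric n M) (p : M) : Matrix (Fin n) (Fin n) ℝ :=
  metricMatrix g p (extChartAt (𝓡 n) p p)

/-- `R_{abcd} = g(R(∂_a, ∂_b) ∂_d, ∂_c)` at `p`; it is `g_{ac} g_{bd} - g_{ad} g_{bc}` on the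
unit sphere. -/
def riemannDown (g : SmoothMetric n M) (p : M) (a b c d : Fin n) : ℝ :=
  ∑ l, metricAt g p c l * riemannUp g p a b d l

/-- The Ricci tensor at `p`: `r_{jk} = R_{ijk}{}^i`, the trace of `x ↦ R(x, ∂ⱼ) ∂ₖ`. -/
def ricci (g : SmoothMetric n M) (p : M) (j k : Fin n) : ℝ :=
  ∑ i, riemannUp g p i j k i

/-- The scalar curvature `s = g^{jk} r_{jk}`. -/
def scalarCurvature (g : SmoothMetric n M) (p : M) : ℝ :=
  ∑ j, ∑ k, (metricAt g p)⁻¹ j k * ricci g p j k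

/-- Einstein metrics: the Ricci curvature is a constant multiple of the metric. -/
def IsEinstein (g : SmoothMetric n M) : Prop :=
  ∃ lam : ℝ, ∀ (p : M) (j k : Fin n), ricci g p j k = lam * metricAt g p j k

end Riemannian

/-! ### Almost-Kähler manifolds -/

/-- An almost-Kähler structure `(g, ω, J)`, with `Om` standing for `ω`: `ω` is a symplectic form, `J` an almost-complex
structure and `g(v, w) = ω(v, J w)` is a Riemannian metric. (Non-degeneracy of `ω` follows from
the last identity.) -/
structure AlmostKahler (n : ℕ) (M : Type*) [TopologicalSpace M]
    [ChartedSpace (EuclideanSpace ℝ (Fin n)) M] [IsManifold (𝓡 n) ∞ M] where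
  g : SmoothMetric n M
  Om : ∀ p : M, TangentSpace (𝓡 n) p →L[ℝ] TangentSpace (𝓡 n) p →L[ℝ] ℝ
  J : ∀ p : M, TangentSpace (𝓡 n) p →L[ℝ] TangentSpace (𝓡 n) p
  Om_alt : ∀ (p : M) (v : TangentSpace (𝓡 n) p), Om p v v = 0
  Om_smooth : ContMDiff (𝓡 n) ((𝓡 n).prod 𝓘(ℝ, EuclideanSpace ℝ (Fin n) →L[ℝ]
      EuclideanSpace ℝ (Fin n) →L[ℝ] ℝ)) ∞
    (fun p => TotalSpace.mk' (EuclideanSpace ℝ (Fin n) →L[ℝ] EuclideanSpace ℝ (Fin n) →L[ℝ] ℝ)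
      (E := fun p : M => TangentSpace (𝓡 n) p →L[ℝ] TangentSpace (𝓡 n) p →L[ℝ] ℝ) p (Om p))
  Om_closed : IsClosedTwoForm Om
  J_sq : ∀ (p : M) (v : TangentSpace (𝓡 n) p), J p (J p v) = -v
  J_smooth : ContMDiff (𝓡 n) ((𝓡 n).prod 𝓘(ℝ, EuclideanSpace ℝ (Fin n) →L[ℝ]
      EuclideanSpace ℝ (Fin n))) ∞
    (fun p => TotalSpace.mk' (EuclideanSpace ℝ (Fin n) →L[ℝ] EuclideanSpace ℝ (Fin n))
      (E := fun p : M => TangentSpace (𝓡 n) p →L[ℝ] TangentSpace (𝓡 n) p) p (J p))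
  compat : ∀ (p : M) (v w : TangentSpace (𝓡 n) p), g.inner p v w = Om p v (J p w)

section AlmostKahler

variable {n : ℕ} {M : Type*} [TopologicalSpace M] [ChartedSpace (EuclideanSpace ℝ (Fin n)) M]
  [IsManifold (𝓡 n) ∞ M]

/-- The components `ω^{ab} = g^{ac} g^{bd} ω_{cd}` at `p`. -/
def AlmostKahler.formUp (K : AlmostKahler n M) (p : M) (a b : Fin n) : ℝ :=
  ∑ c, ∑ d, (metricAt K.g p)⁻¹ a c * (metricAt K.g p)⁻¹ b d *
    bilinComp K.Om p c d (extChartAt (𝓡 n) p p)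

/-- The star-scalar curvature `s⋆ = ½ R_{abcd} ω^{ab} ω^{cd}`. -/
def AlmostKahler.starScalar (K : AlmostKahler n M) (p : M) : ℝ :=
  (1 / 2) * ∑ a, ∑ b, ∑ c, ∑ d, riemannDown K.g p a b c d * K.formUp p a b * K.formUp p c d

/-! ### The first Chern class, by Chern-Weil theory -/

/-- `D` is a smooth complex connection on the complex vector bundle `(TM, J)`: a smooth covariant
derivative with `D(J Y) = J (D Y)`. -/
structure IsComplexConnection
    (J : ∀ p : M, TangentSpace (𝓡 n) p →L[ℝ] TangentSpace (𝓡 n) p)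
    (D : CovariantDerivative (𝓡 n) (EuclideanSpace ℝ (Fin n))
      (fun p : M => TangentSpace (𝓡 n) p)) : Prop where
  smooth : CovariantDerivative.ContMDiffCovariantDerivative D ∞
  complex_linear : ∀ (Y : ∀ p : M, TangentSpace (𝓡 n) p) (p : M) (v : TangentSpace (𝓡 n) p),
    MDifferentiableAt (𝓡 n) ((𝓡 n).prod 𝓘(ℝ, EuclideanSpace ℝ (Fin n)))
      (fun q => TotalSpace.mk' (EuclideanSpace ℝ (Fin n))
        (E := fun q : M => TangentSpace (𝓡 n) q) q (Y q)) p →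
    D (fun q => J q (Y q)) p v = J p (D Y p v)

/-- The connection coefficients `Γ^k_{ij}` of `D` in the chart at `p`: the `∂ₖ`-components of
`D_{∂ᵢ} ∂ⱼ`. -/
def connCoeff (D : CovariantDerivative (𝓡 n) (EuclideanSpace ℝ (Fin n))
      (fun p : M => TangentSpace (𝓡 n) p))
    (p : M) (y : EuclideanSpace ℝ (Fin n)) (i j k : Fin n) : ℝ :=
  coordCovec p k ((extChartAt (𝓡 n) p).symm y)
    (D (coordField p j) ((extChartAt (𝓡 n) p).symm y)
      (coordField p i ((extChartAt (𝓡 n) p).symm y)))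

/-- The `(i, j)` component at `p` of the first Chern form `(i / 2π) tr_ℂ F` of a complex connection
`D` on `(TM, J)`, `F` being the curvature of `D`; more precisely of the real part of that form.
Since `tr_ℝ (J A) = - 2 Im (tr_ℂ A)` for a complex-linear `A`, this real part is
`(1 / 4π) tr_ℝ (J ∘ F(∂ᵢ, ∂ⱼ))`. -/
def chernComp (J : ∀ p : M, TangentSpace (𝓡 n) p →L[ℝ] TangentSpace (𝓡 n) p)
    (D : CovariantDerivative (𝓡 n) (EuclideanSpace ℝ (Fin n))
      (fun p : M => TangentSpace (𝓡 n) p))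
    (p : M) (i j : Fin n) : ℝ :=
  (1 / (4 * Real.pi)) * ∑ k, ∑ l,
    coordCovec p k p (J p (coordField p l p)) *
      curvComp (connCoeff D p) (extChartAt (𝓡 n) p p) i j k l

/-- The first Chern form of `(TM, J, D)`, equal to `∑ chernComp i j dxⁱ ⊗ dxʲ` at each point. -/
def chernForm (J : ∀ p : M, TangentSpace (𝓡 n) p →L[ℝ] TangentSpace (𝓡 n) p)
    (D : CovariantDerivative (𝓡 n) (EuclideanSpace ℝ (Fin n))
      (fun p : M => TangentSpace (𝓡 n) p))
    (p : M) : TangentSpace (𝓡 n) p →L[ℝ] TangentSpace (𝓡 n) p →L[ℝ] ℝ :=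
  ∑ i, ∑ j, chernComp J D p i j • (coordCovec p i p).smulRight (coordCovec p j p)

end AlmostKahler

/-! ### Integration over a compact Riemann surface -/

/-- The smooth real manifold underlying a Riemann surface. -/
instance realSurface {S : Type*} [TopologicalSpace S] [ChartedSpace ℂ S]
    [h : IsManifold 𝓘(ℂ, ℂ) ω S] : IsManifold 𝓘(ℝ, ℂ) ∞ S := by
  apply isManifold_of_contDiffOn
  intro e e' he he'
  have h1 := (contDiffGroupoid ω 𝓘(ℂ, ℂ)).compatible he he'
  have h2 := (contDiffGroupoid_le (I := 𝓘(ℂ, ℂ)) (m := ∞) (n := ω) le_top) h1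
  have h3 : (contDiffPregroupoid ∞ 𝓘(ℂ, ℂ)).property (e.symm ≫ₕ e') (e.symm ≫ₕ e').source :=
    (mem_groupoid_of_pregroupoid.mp h2).1
  have h4 : ContDiffOn ℂ ∞ (𝓘(ℂ, ℂ) ∘ (e.symm ≫ₕ e') ∘ 𝓘(ℂ, ℂ).symm)
    (𝓘(ℂ, ℂ).symm ⁻¹' (e.symm ≫ₕ e').source ∩ Set.range 𝓘(ℂ, ℂ)) := h3
  exact h4.restrict_scalars ℝ

section Surface

variable {S : Type*} [TopologicalSpace S] [T2Space S] [CompactSpace S] [ChartedSpace ℂ S]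
  [IsManifold 𝓘(ℂ, ℂ) ω S]

/-- There is a smooth partition of unity subordinate to the preferred charts. -/
theorem exists_chartPartition :
    ∃ f : SmoothPartitionOfUnity S 𝓘(ℝ, ℂ) S Set.univ,
      f.IsSubordinate (fun x => (chartAt ℂ x).source) :=
  SmoothPartitionOfUnity.exists_isSubordinate_chartAt_source 𝓘(ℝ, ℂ) S

/-- A smooth partition of unity subordinate to the preferred charts. -/
def chartPartition (S : Type*) [TopologicalSpace S] [T2Space S] [CompactSpace S]
    [ChartedSpace ℂ S] [IsManifold 𝓘(ℂ, ℂ) ω S] :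
    SmoothPartitionOfUnity S 𝓘(ℝ, ℂ) S Set.univ :=
  Classical.choose (exists_chartPartition (S := S))

/-- The pull-back `f^*β` of a field of bilinear forms, `(f^*β)(u, v) = β(df u, df v)`. -/
def pullbackForm {E E' H H' M N : Type*} [NormedAddCommGroup E] [NormedSpace ℝ E]
    [NormedAddCommGroup E'] [NormedSpace ℝ E'] [TopologicalSpace H] [TopologicalSpace H']
    (I : ModelWithCorners ℝ E H) (I' : ModelWithCorners ℝ E' H')
    [TopologicalSpace M] [ChartedSpace H M] [TopologicalSpace N] [ChartedSpace H' N]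
    (f : M → N) (β : ∀ q : N, TangentSpace I' q →L[ℝ] TangentSpace I' q →L[ℝ] ℝ)
    (x : M) : TangentSpace I x →L[ℝ] TangentSpace I x →L[ℝ] ℝ :=
  (ContinuousLinearMap.precomp ℝ (mfderiv I I' f x)).comp ((β (f x)).comp (mfderiv I I' f x))

/-- The integral `∫_S η` of a `2`-form on a compact Riemann surface with its complex orientation:
`∑ₓ ∫ ρₓ η(∂/∂a, ∂/∂b) da db` in the holomorphic coordinate `a + i b` around `x`, for a partition of
unity `(ρₓ)`. -/
def surfaceIntegral
    (η : ∀ x : S, TangentSpace 𝓘(ℝ, ℂ) x →L[ℝ] TangentSpace 𝓘(ℝ, ℂ) x →L[ℝ] ℝ) : ℝ :=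
  ∑ᶠ x : S, ∫ z in (extChartAt 𝓘(ℝ, ℂ) x).target,
    chartPartition S x ((extChartAt 𝓘(ℝ, ℂ) x).symm z) *
      pullbackForm 𝓘(ℝ, ℂ) 𝓘(ℝ, ℂ) (extChartAt 𝓘(ℝ, ℂ) x).symm η z
        ((NormedSpace.fromTangentSpace z).symm 1) ((NormedSpace.fromTangentSpace z).symm Complex.I)

end Surface

/-! ### `J`-holomorphic curves -/

section Curves

variable {n : ℕ} {M : Type*} [TopologicalSpace M] [ChartedSpace (EuclideanSpace ℝ (Fin n)) M]
  [IsManifold (𝓡 n) ∞ M]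
  {S : Type*} [TopologicalSpace S] [ChartedSpace ℂ S]

/-- The complex structure `J_S` of a Riemann surface: multiplication by `i` in a holomorphic
coordinate. -/
def surfaceJ (x : S) (v : TangentSpace 𝓘(ℝ, ℂ) x) : TangentSpace 𝓘(ℝ, ℂ) x :=
  (mvfderiv 𝓘(ℝ, ℂ) (extChartAt 𝓘(ℝ, ℂ) x) x).inverse
    (Complex.I * mvfderiv 𝓘(ℝ, ℂ) (extChartAt 𝓘(ℝ, ℂ) x) x v)

/-- `ψ : S → M` is a `J`-holomorphic curve: a smooth, locally non-constant map with
`J ∘ dψ = dψ ∘ J_S` for the complex structure `J_S`. -/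
structure IsJHolomorphicCurve
    (J : ∀ p : M, TangentSpace (𝓡 n) p →L[ℝ] TangentSpace (𝓡 n) p) (ψ : S → M) : Prop where
  smooth : ContMDiff 𝓘(ℝ, ℂ) (𝓡 n) ∞ ψ
  locally_nonconstant : ∀ U : Set S, IsOpen U → U.Nonempty → ¬ ∃ q : M, ∀ x ∈ U, ψ x = q
  complex_linear : ∀ (x : S) (v : TangentSpace 𝓘(ℝ, ℂ) x),
    J (ψ x) (mfderiv 𝓘(ℝ, ℂ) (𝓡 n) ψ x v) = mfderiv 𝓘(ℝ, ℂ) (𝓡 n) ψ x (surfaceJ x v)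

variable [T2Space S] [CompactSpace S] [IsManifold 𝓘(ℂ, ℂ) ω S]

/-- The integral `∫_S ψ^*β` of a `2`-form `β` on `M`. When `β` is closed, it is the pairing
`[β] · [S]` of its de Rham class with `ψ_*[S]`. -/
def integralOver (ψ : S → M)
    (β : ∀ p : M, TangentSpace (𝓡 n) p →L[ℝ] TangentSpace (𝓡 n) p →L[ℝ] ℝ) : ℝ :=
  surfaceIntegral (pullbackForm 𝓘(ℝ, ℂ) (𝓡 n) ψ β)

/-- `c = c₁(M, J) · [S]`. The class `c₁(M, J)` is that of the first Chern form of any complex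
connection on `(TM, J)`; it is part of the assertion that such connections exist and that `c` does
not depend on the choice. -/
def IsFirstChernNumber (J : ∀ p : M, TangentSpace (𝓡 n) p →L[ℝ] TangentSpace (𝓡 n) p)
    (ψ : S → M) (c : ℝ) : Prop :=
  (∃ D, IsComplexConnection J D) ∧
    ∀ D, IsComplexConnection J D → integralOver ψ (chernForm J D) = c

end Curves

end

open scoped Manifold ContDiff Topology
open Bundle

noncomputable section

set_option maxSynthPendingDepth 3
set_option synthInstance.maxHeartbeats 100000
set_option linter.unusedSectionVars false

/-! ### Pointwise algebra of almost-Kähler curvature -/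

/-! The theorem is a pointwise estimate for one particular Chern form, integrated along the curve.
Let ∇ be the Levi-Civita connection. The connection D = ∇ - ½ J(∇J) satisfies DJ = 0, so its Chern
form can be used to compute c₁. Its curvature F and that R of ∇ are related by tr(J F(u,v)) = tr(J
R(u,v)) - ½ tr(J ∇_uJ ∇_vJ) (`endTrace_J_localCurv`).

Three facts evaluate this at v = Ju. First, closedness of ω gives ∇_{Ju}J = -J∇_uJ (`Q_J_left`), so
the correction becomes -½|∇_uJ|², where |∇_uJ|² = -tr(∇_uJ ∇_uJ). Second, in dimension four an
Einstein metric satisfies 2 tr(J R(u,Ju)) = s⋆|u|² (`trace_J_R_eq`). Hence 8π c₁(u,Ju) = s⋆|u|² -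
|∇_uJ|² (`chernForm_hermitianConnection`), and the upper bound is the sign of the last term. Third,
the contracted Ricci identity for ∇²J gives s⋆ = s + ½|∇J|² (`star_eq_scalar_add`), while |∇_uJ|² ≤
½|∇J|²|u|² because u and Ju contribute equally to |∇J|² (`normSq_le`). So s|u|² ≤ 8π c₁(u,Ju), which
is the lower bound.

On a J-holomorphic curve the coordinate fields satisfy ψ_*∂_b = Jψ_*∂_a, so every pulled-back 2-form
is evaluated on a pair (u,Ju), and ω(u,Ju) = |u|². Integration against a nonnegative partition of
unity then gives both inequalities.

It remains to see that any other complex connection gives the same number. The Chern forms of two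
complex connections differ by a constant times the exterior derivative of the 1-form v ↦ tr(J(D_v -
D'_v)) (`endTrace_localCurv_sub`, `chernForm_sub`), and the integral of its pull-back vanishes by
Stokes' theorem on the compact surface (`sum_integral_planeCurl_eq_zero`).

The curvature algebra is done for abstract jets on a vector space. The jets come from almost-Kähler
structures on open subsets of a normed space, and these are the expressions of the manifold
structure in its preferred charts. -/

/-- The algebraic data that an almost-Kähler structure induces at a point: the metric `G`, the
almost-complex structure `J`, the curvature `R`, and the covariant derivatives `Q = ∇J`,
`S = ∇²J`. -/
structure AlmostKahlerJet (V : Type*) [AddCommGroup V] [Module ℝ V] where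
  G : V →ₗ[ℝ] V →ₗ[ℝ] ℝ
  J : V →ₗ[ℝ] V
  R : V →ₗ[ℝ] V →ₗ[ℝ] V →ₗ[ℝ] V
  Q : V →ₗ[ℝ] V →ₗ[ℝ] V
  S : V →ₗ[ℝ] V →ₗ[ℝ] V →ₗ[ℝ] V
  G_symm : ∀ u v, G u v = G v u
  G_pos : ∀ u, u ≠ 0 → 0 < G u u
  J_sq : ∀ u, J (J u) = -u
  J_orth : ∀ u v, G (J u) (J v) = G u v
  R_anti : ∀ u v w, R u v w = -R v u w
  R_skew : ∀ u v w z, G (R u v w) z = -G (R u v z) w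
  R_cyc : ∀ u v w, R u v w + R v w u + R w u v = 0
  Q_skew : ∀ u v w, G (Q u v) w = -G (Q u w) v
  Q_J : ∀ u v, Q u (J v) = -J (Q u v)
  Q_cyc : ∀ u v w, G (Q u v) w + G (Q v w) u + G (Q w u) v = 0
  S_comm : ∀ u v w, S u v w - S v u w = R u v (J w) - J (R u v w)
  S_skew : ∀ u v w z, G (S u v w) z = -G (S u v z) w
  S_cyc : ∀ x u v w, G (S x u v) w + G (S x v w) u + G (S x w u) v = 0
  S_J : ∀ u v w, S u v (J w) + J (S u v w) = -(Q u (Q v w) + Q v (Q u w))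

namespace AlmostKahlerJet

variable {V : Type*} [AddCommGroup V] [Module ℝ V] (P : AlmostKahlerJet V)

/-- An orthonormal frame `e₀, J e₀, e₂, J e₂`. -/
structure IsUnitaryFrame (e : Fin 4 → V) : Prop where
  orthonormal : ∀ i j, P.G (e i) (e j) = if i = j then 1 else 0
  J0 : P.J (e 0) = e 1
  J2 : P.J (e 2) = e 3

/-- The squared norm `-tr (Q_u Q_u)` of `∇_u J`. -/
def normSq (u : V) : ℝ := -LinearMap.trace ℝ V (P.Q u ∘ₗ P.Q u)

theorem J_skew (u v : V) : P.G (P.J u) v = -P.G u (P.J v) := by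
  have h := P.J_orth u (P.J v)
  rw [P.J_sq, map_neg] at h
  linarith

theorem G_J_self (u : V) : P.G u (P.J u) = 0 := by
  have h := P.J_skew u u
  rw [P.G_symm] at h
  linarith

/-- The usual octahedron argument: the four Bianchi sums obtained by rotating the arguments,
combined through the two antisymmetries, leave a multiple of the difference of the two sides. -/
theorem R_pair (u v w z : V) : P.G (P.R u v w) z = P.G (P.R w z u) v := by
  have b := fun u v w z => congrArg (fun x => P.G x z) (P.R_cyc u v w)
  simp only [map_add, LinearMap.add_apply, map_zero, LinearMap.zero_apply] at b
  have a := fun u v w z => congrArg (fun x => P.G x z) (P.R_anti u v w)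
  simp only [map_neg, LinearMap.neg_apply] at a
  have s := P.R_skew
  linarith [b u v w z, b v w z u, b w z u v, b z u v w, a u v w z, a v w u z, a w u v z, a u v z w,
    a v w z u, a w u z v, a z u v w, a z v w u, a w z u v, a z u w v, a u v z w, a v z u w,
    s u v w z, s v w u z, s w u v z, s v w z u, s w z v u, s z v w u, s w z u v, s z u w v,
    s u w z v, s z u v w, s u v z w, s v z u w, a w u v z, a u w v z, a u w z v, s u w v z,
    a v z u w, a z v u w, s z v u w, a z u v w, a u z v w, s u z v w, a w z u v, a z w u v,
    s z w u v, a u z w v, s u z w v]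

/-- The quasi-Kähler property. Closedness is evaluated at (X, Y, JZ), (X, JY, Z), (JX, Y, Z) and
(JX, JY, JZ); since J anticommutes with each Q_x, all terms but the two wanted ones cancel. -/
theorem Q_J_left (u v : V) : P.Q (P.J u) v = -P.J (P.Q u v) := by
  have q1 : ∀ x y z, P.G (P.Q x (P.J y)) z = P.G (P.Q x y) (P.J z) := fun x y z => by
    rw [P.Q_J, map_neg, LinearMap.neg_apply, P.J_skew, neg_neg]
  have key : ∀ x y z, P.G (P.Q (P.J x) y) z = P.G (P.Q x y) (P.J z) := by
    intro X Y Z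
    have h1 := P.Q_cyc X Y (P.J Z)
    have h2 := P.Q_cyc X (P.J Y) Z
    have h3 := P.Q_cyc (P.J X) Y Z
    have h4 := P.Q_cyc (P.J X) (P.J Y) (P.J Z)
    have k : ∀ x y z, P.G (P.Q x (P.J y)) (P.J z) = - P.G (P.Q x y) z := fun x y z => by
      rw [q1, P.J_sq, map_neg]
    rw [k, k, k] at h4
    rw [q1] at h2 h1
    linarith [q1 X Y Z, q1 Z X Y, q1 Y Z X]
  have hz : ∀ x : V, (∀ z, P.G x z = 0) → x = 0 := fun x hx => by
    by_contra h
    exact (P.G_pos x h).ne' (hx x)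
  have : P.Q (P.J u) v + P.J (P.Q u v) = 0 := by
    apply hz
    intro z
    rw [map_add, LinearMap.add_apply, key, P.J_skew]
    ring
  exact eq_neg_of_add_eq_zero_left this

/-! ### Contractions over a unitary frame -/

namespace IsUnitaryFrame

variable {P} {e : Fin 4 → V} (he : P.IsUnitaryFrame e)
include he

theorem J1 : P.J (e 1) = -e 0 := by rw [← he.J0, P.J_sq]

theorem J3 : P.J (e 3) = -e 2 := by rw [← he.J2, P.J_sq]

/-- J permutes the frame up to sign, so reindexing by J moves it to the other slot at the price of a
sign. -/
theorem sum_J_left (f : V →ₗ[ℝ] V →ₗ[ℝ] ℝ) :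
    ∑ i, f (P.J (e i)) (e i) = -∑ i, f (e i) (P.J (e i)) := by
  simp only [Fin.sum_univ_four, he.J0, he.J1, he.J2, he.J3, map_neg, LinearMap.neg_apply]
  ring

theorem linearIndependent : LinearIndependent ℝ e := by
  rw [Fintype.linearIndependent_iff]
  intro g hg i
  have := congrArg (fun x => P.G x (e i)) hg
  simpa [he.orthonormal] using this

variable (hd : Module.finrank ℝ V = 4)
include hd

theorem expand (x : V) : x = ∑ i, P.G x (e i) • e i := by
  let b := basisOfLinearIndependentOfCardEqFinrank he.linearIndependent (by simp [hd])
  have hb : ∀ i, b i = e i := fun i => by simp [b]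
  have hx := b.sum_repr x
  simp only [hb] at hx
  have : ∀ i, P.G x (e i) = b.repr x i := by
    intro i
    have h := congrArg (fun x => P.G x (e i)) hx
    simpa [he.orthonormal] using h.symm
  simp only [this]
  exact hx.symm

theorem trace_eq (L : V →ₗ[ℝ] V) : LinearMap.trace ℝ V L = ∑ i, P.G (L (e i)) (e i) := by
  let b := basisOfLinearIndependentOfCardEqFinrank he.linearIndependent (by simp [hd])
  have hb : ∀ i, b i = e i := fun i => by simp [b]
  rw [LinearMap.trace_eq_matrix_trace ℝ b, Matrix.trace]
  refine Finset.sum_congr rfl fun i _ => ?_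
  rw [Matrix.diag_apply, LinearMap.toMatrix_apply, hb]
  have hx := b.sum_repr (L (e i))
  simp only [hb] at hx
  have h := congrArg (fun x => P.G x (e i)) hx
  simpa [he.orthonormal] using h

theorem inner_eq (x y : V) : P.G x y = ∑ i, P.G x (e i) * P.G y (e i) := by
  conv_lhs => rw [he.expand hd y]
  simp [mul_comm]

theorem normSq_eq (u : V) : P.normSq u = ∑ i, P.G (P.Q u (e i)) (P.Q u (e i)) := by
  rw [normSq, he.trace_eq hd, ← Finset.sum_neg_distrib]
  refine Finset.sum_congr rfl fun i _ => ?_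
  rw [LinearMap.comp_apply, P.Q_skew, neg_neg]

theorem normSq_nonneg (u : V) : 0 ≤ P.normSq u := by
  rw [he.normSq_eq hd]
  refine Finset.sum_nonneg fun i _ => ?_
  by_cases h : P.Q u (e i) = 0
  · simp [h]
  · exact (P.G_pos _ h).le

theorem normSq_J (u : V) : P.normSq (P.J u) = P.normSq u := by
  rw [he.normSq_eq hd, he.normSq_eq hd]
  refine Finset.sum_congr rfl fun i _ => ?_
  rw [P.Q_J_left]
  simp [P.J_orth]

/-- `∑ⱼ ⟨S(u, eⱼ) a, J eⱼ⟩ = -½ ⟨Q_u, Q_a⟩`. -/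
theorem sum_S_J (u a : V) : ∑ j, P.G (P.S u (e j) a) (P.J (e j)) =
    (1 / 2) * LinearMap.trace ℝ V (P.Q u ∘ₗ P.Q a) := by
  -- Moving J across the frame and using skewness identifies the third term of `S_cyc` with the
  -- first.
  have h1 : ∑ j, P.G (P.S u (P.J (e j)) (e j)) a = ∑ j, P.G (P.S u (e j) a) (P.J (e j)) := by
    have := he.sum_J_left (LinearMap.mk₂ ℝ (fun x y => P.G (P.S u x y) a) (by simp) (by simp)
      (by simp) (by simp))
    simp only [LinearMap.mk₂_apply] at this
    rw [this, ← Finset.sum_neg_distrib]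
    exact Finset.sum_congr rfl fun i _ => by rw [P.S_skew, neg_neg]
  have h2 : ∑ j, (P.G (P.S u (e j) a) (P.J (e j)) + P.G (P.S u a (P.J (e j))) (e j)
      + P.G (P.S u (P.J (e j)) (e j)) a) = 0 :=
    Finset.sum_eq_zero fun i _ => P.S_cyc u (e i) a (P.J (e i))
  rw [Finset.sum_add_distrib, Finset.sum_add_distrib, h1] at h2
  -- The middle term of `S_cyc`: by `S_J` the anticommutator of S(u,a) with J is -(Q_u Q_a + Q_a
  -- Q_u), and the two products have equal trace.
  have h3 : ∑ j, P.G (P.S u a (P.J (e j))) (e j) = -LinearMap.trace ℝ V (P.Q u ∘ₗ P.Q a) := by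
    have c := LinearMap.trace_mul_comm ℝ (P.Q u) (P.Q a)
    simp only [Module.End.mul_eq_comp] at c
    have h4 : ∀ j, 2 * P.G (P.S u a (P.J (e j))) (e j) =
        -(P.G (P.Q u (P.Q a (e j))) (e j) + P.G (P.Q a (P.Q u (e j))) (e j)) := by
      intro j
      have := congrArg (fun x => P.G x (e j)) (P.S_J u a (e j))
      simp only [map_add, map_neg, LinearMap.add_apply, LinearMap.neg_apply] at this
      rw [P.J_skew, P.S_skew u a (e j), neg_neg] at this
      linarith
    have h5 := Finset.sum_congr rfl fun j (_ : j ∈ Finset.univ) => h4 j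
    rw [← Finset.mul_sum, Finset.sum_neg_distrib, Finset.sum_add_distrib] at h5
    have t1 := he.trace_eq hd (P.Q u ∘ₗ P.Q a)
    have t2 := he.trace_eq hd (P.Q a ∘ₗ P.Q u)
    simp only [LinearMap.comp_apply] at t1 t2
    linarith
  linarith

omit hd in
-- This says that ω is coclosed. By `Q_J` and `Q_J_left`, Q(Jx)(Jx) = -Q(x)(x), so the frame vectors
-- cancel in pairs.
theorem sum_Q_self : ∑ u, P.Q (e u) (e u) = 0 := by
  have := P.Q_J_left (e 0) (e 0)
  have h2 := P.Q_J_left (e 2) (e 2)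
  have k := P.Q_J (e 1) (e 0)
  have k2 := P.Q_J (e 3) (e 2)
  rw [he.J0] at this k
  rw [he.J2] at h2 k2
  simp only [Fin.sum_univ_four, k, k2, this, h2, map_neg, P.J_sq]
  simp

theorem sum_normSq : ∑ u, P.normSq (e u) =
    ∑ i, ∑ u, ∑ k, P.G (P.Q (e i) (e u)) (e k) * P.G (P.Q (e i) (e u)) (e k) := by
  refine Finset.sum_congr rfl fun i _ => ?_
  rw [he.normSq_eq hd]
  exact Finset.sum_congr rfl fun u _ => he.inner_eq hd _ _

/-- With q_{iuk} the components of Q, closedness and skewness give q_{uik} = q_{iuk} + q_{kiu}.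
After multiplication by q_{iuk} and summation, the last product is minus the original sum with its
indices renamed; so the sum equals |∇J|² minus itself. -/
theorem sum_Q_swap : ∑ u, ∑ i, P.G (P.Q (e i) (e u)) (P.Q (e u) (e i)) =
    (1 / 2) * ∑ u, P.normSq (e u) := by
  set q : Fin 4 → Fin 4 → Fin 4 → ℝ := fun i u k => P.G (P.Q (e i) (e u)) (e k) with hq
  have sk : ∀ i u k, q i u k = -q i k u := fun i u k => P.Q_skew _ _ _
  have cy : ∀ i u k, q u i k = -q i k u - q k u i := fun i u k => by
    have := P.Q_cyc (e u) (e i) (e k)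
    simp only [hq]; linarith
  have h1 : ∑ u, ∑ i, P.G (P.Q (e i) (e u)) (P.Q (e u) (e i)) =
      ∑ i, ∑ u, ∑ k, q i u k * q u i k := by
    rw [Finset.sum_comm]
    exact Finset.sum_congr rfl fun i _ => Finset.sum_congr rfl fun u _ => he.inner_eq hd _ _
  have h2 : ∑ i, ∑ u, ∑ k, q i u k * q u i k =
      ∑ i, ∑ u, ∑ k, q i u k * q i u k - ∑ i, ∑ u, ∑ k, q i u k * q u i k := by
    have : ∑ i, ∑ u, ∑ k, q i u k * q u i k = ∑ i, ∑ u, ∑ k, q i k u * q k i u := by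
      exact Finset.sum_congr rfl fun i _ => Finset.sum_comm
    conv_rhs => rw [this]
    simp only [← Finset.sum_sub_distrib]
    refine Finset.sum_congr rfl fun i _ => Finset.sum_congr rfl fun u _ =>
      Finset.sum_congr rfl fun k _ => ?_
    rw [cy i u k, sk i k u, sk k u i]
    ring
  rw [he.sum_normSq hd, h1]
  linarith

/-- Passing J through S by `S_J` reduces this to `sum_S_J`, `sum_Q_swap` and `sum_Q_self`, which
contribute ½|∇J|², -½|∇J|² and 0. -/
theorem sum_S_self : ∑ u, ∑ i, P.G (P.S (e u) (e i) (e i)) (P.J (e u)) = 0 := by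
  have h1 : ∀ u i, P.G (P.S (e u) (e i) (e i)) (P.J (e u)) =
      -P.G (P.S (e u) (e i) (e u)) (P.J (e i)) - P.G (P.Q (e i) (e u)) (P.Q (e u) (e i))
        - P.G (P.Q (e u) (e u)) (P.Q (e i) (e i)) := by
    intro u i
    have := congrArg (fun x => P.G x (e i)) (P.S_J (e u) (e i) (e u))
    simp only [map_add, map_neg, LinearMap.add_apply, LinearMap.neg_apply] at this
    rw [P.J_skew, P.S_skew (e u) (e i) (P.J (e u)), P.Q_skew (e u) (P.Q (e i) (e u)),
      P.Q_skew (e i) (P.Q (e u) (e u)), P.G_symm (P.Q (e u) (e i)),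
      P.G_symm (P.Q (e i) (e i))] at this
    linarith
  simp only [h1, Finset.sum_sub_distrib, Finset.sum_neg_distrib]
  have h2 : ∑ u, ∑ i, P.G (P.Q (e u) (e u)) (P.Q (e i) (e i)) = 0 := by
    have : ∀ u, ∑ i, P.G (P.Q (e u) (e u)) (P.Q (e i) (e i)) = 0 := fun u => by
      rw [← map_sum, he.sum_Q_self, map_zero]
    simp [this]
  have h3 : ∀ u, ∑ i, P.G (P.S (e u) (e i) (e u)) (P.J (e i)) = -(1 / 2) * P.normSq (e u) := by
    intro u
    rw [he.sum_S_J hd, normSq]; ring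
  rw [h2, he.sum_Q_swap hd]
  simp only [h3, ← Finset.mul_sum]
  ring

/-- The star-scalar curvature in a unitary frame. -/
theorem star_sub_scalar {lam : ℝ}
    (hE : ∀ v w, LinearMap.trace ℝ V (LinearMap.flip (P.R.flip v) w) = lam * P.G v w) :
    (1 / 2) * ∑ i, LinearMap.trace ℝ V (P.J ∘ₗ P.R (e i) (P.J (e i))) =
      4 * lam + (1 / 2) * ∑ u, P.normSq (e u) := by
  -- One side of the contracted Ricci identity: the first sum is given by `sum_S_J`, the second
  -- vanishes by `sum_S_self`. The other side, expanded next, consists of s⋆ and s.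
  have h1 : ∑ u, ∑ j, (P.G (P.S (e u) (e j) (e u)) (P.J (e j))
      - P.G (P.S (e j) (e u) (e u)) (P.J (e j))) = -(1 / 2) * ∑ u, P.normSq (e u) := by
    simp only [Finset.sum_sub_distrib]
    rw [Finset.sum_comm (f := fun u j => P.G (P.S (e j) (e u) (e u)) (P.J (e j))),
      he.sum_S_self hd, Finset.mul_sum, sub_zero]
    exact Finset.sum_congr rfl fun u _ => by rw [he.sum_S_J hd, normSq]; ring
  have h2 : ∀ u j, P.G (P.S (e u) (e j) (e u)) (P.J (e j))
      - P.G (P.S (e j) (e u) (e u)) (P.J (e j)) =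
      P.G (P.R (e u) (e j) (P.J (e u))) (P.J (e j)) + P.G (P.R (e u) (e j) (e j)) (e u) := by
    intro u j
    have := congrArg (fun x => P.G x (P.J (e j))) (P.S_comm (e u) (e j) (e u))
    simp only [map_sub, LinearMap.sub_apply, P.J_orth] at this
    rw [P.R_skew _ _ (e u) (e j)] at this
    linarith
  simp only [h2, Finset.sum_add_distrib] at h1
  have h3 : ∑ u, ∑ j, P.G (P.R (e u) (e j) (e j)) (e u) = 4 * lam := by
    rw [Finset.sum_comm]
    have : ∀ j, ∑ u, P.G (P.R (e u) (e j) (e j)) (e u) = lam := by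
      intro j
      have := hE (e j) (e j)
      rw [he.trace_eq hd, he.orthonormal] at this
      simpa using this
    simp [this]
  -- The Bianchi identity splits the summand in two. Moving J across the frame turns one part into
  -- minus the whole left side, so twice that side is the sum of ⟨R(e, Je)e', Je'⟩.
  have h4 : ∑ u, ∑ j, P.G (P.R (e u) (e j) (P.J (e u))) (P.J (e j)) =
      -(1 / 2) * ∑ i, LinearMap.trace ℝ V (P.J ∘ₗ P.R (e i) (P.J (e i))) := by
    have t : ∀ i, LinearMap.trace ℝ V (P.J ∘ₗ P.R (e i) (P.J (e i))) =
        -∑ j, P.G (P.R (e i) (P.J (e i)) (e j)) (P.J (e j)) := by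
      intro i
      rw [he.trace_eq hd, ← Finset.sum_neg_distrib]
      exact Finset.sum_congr rfl fun j _ => by rw [LinearMap.comp_apply, P.J_skew]
    simp only [t, Finset.sum_neg_distrib]
    have a : ∀ u v w z, P.G (P.R u v w) z = - P.G (P.R v u w) z := fun u v w z => by
      rw [P.R_anti, map_neg, LinearMap.neg_apply]
    have c : ∀ u j, P.G (P.R (e u) (e j) (P.J (e u))) (P.J (e j)) =
        P.G (P.R (P.J (e u)) (e j) (e u)) (P.J (e j)) +
        P.G (P.R (e u) (P.J (e u)) (e j)) (P.J (e j)) := by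
      intro u j
      have := congrArg (fun x => P.G x (P.J (e j))) (P.R_cyc (e u) (e j) (P.J (e u)))
      simp only [map_add, map_zero, LinearMap.add_apply, LinearMap.zero_apply] at this
      linarith [a (e j) (P.J (e u)) (e u) (P.J (e j)), a (P.J (e u)) (e u) (e j) (P.J (e j))]
    have d : ∀ j, ∑ u, P.G (P.R (P.J (e u)) (e j) (e u)) (P.J (e j)) =
        -∑ u, P.G (P.R (e u) (e j) (P.J (e u))) (P.J (e j)) := by
      intro j
      exact he.sum_J_left (LinearMap.mk₂ ℝ (fun x y => P.G (P.R x (e j) y) (P.J (e j))) (by simp)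
        (by simp) (by simp) (by simp))
    have s := Finset.sum_congr rfl fun u (_ : u ∈ Finset.univ) =>
      Finset.sum_congr rfl fun j (_ : j ∈ Finset.univ) => c u j
    simp only [Finset.sum_add_distrib] at s
    rw [Finset.sum_comm (f := fun u j => P.G (P.R (P.J (e u)) (e j) (e u)) (P.J (e j)))] at s
    simp only [d, Finset.sum_neg_distrib] at s
    rw [Finset.sum_comm (f := fun j u => P.G (P.R (e u) (e j) (P.J (e u))) (P.J (e j)))] at s
    linarith
  linarith

/-- For an Einstein metric the `J`-invariant part of the star-Ricci form is a multiple of the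
Kähler form. -/
theorem trace_J_R {lam : ℝ}
    (hE : ∀ v w, LinearMap.trace ℝ V (LinearMap.flip (P.R.flip v) w) = lam * P.G v w) :
    4 * LinearMap.trace ℝ V (P.J ∘ₗ P.R (e 0) (P.J (e 0))) =
      ∑ i, LinearMap.trace ℝ V (P.J ∘ₗ P.R (e i) (P.J (e i))) := by
  have a : ∀ u v w z, P.G (P.R u v w) z = - P.G (P.R v u w) z := fun u v w z => by
    rw [P.R_anti, map_neg, LinearMap.neg_apply]
  have t : ∀ u v, LinearMap.trace ℝ V (P.J ∘ₗ P.R u v) =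
      -2 * (P.G (P.R u v (e 0)) (e 1) + P.G (P.R u v (e 2)) (e 3)) := by
    intro u v
    rw [he.trace_eq hd]
    simp only [Fin.sum_univ_four, LinearMap.comp_apply, P.J_skew, he.J0, he.J1, he.J2, he.J3,
      map_neg]
    linarith [P.R_skew u v (e 0) (e 1), P.R_skew u v (e 2) (e 3)]
  -- The four diagonal Ricci components agree. The combination r₀ + r₁ - r₂ - r₃ = 0 says that the
  -- complementary planes e₀∧e₁ and e₂∧e₃ have equal sectional curvature; with pair symmetry this
  -- equates the traces of J R(e₀,e₁) and J R(e₂,e₃). This is where dimension four enters.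
  have r : ∀ j, ∑ u, P.G (P.R (e u) (e j) (e j)) (e u) = lam := by
    intro j
    have := hE (e j) (e j)
    rw [he.trace_eq hd, he.orthonormal] at this
    simpa using this
  have r0 := r 0
  have r1 := r 1
  have r2 := r 2
  have r3 := r 3
  have z : ∀ u v, P.G (P.R u u v) v = 0 := fun u v => by linarith [a u u v v]
  simp only [Fin.sum_univ_four, z] at r0 r1 r2 r3
  have s : ∀ u v, P.G (P.R u v v) u = P.G (P.R v u u) v := fun u v => by
    rw [a, P.R_skew, neg_neg]
  simp only [Fin.sum_univ_four, he.J0, he.J1, he.J2, he.J3, t, map_neg,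
    LinearMap.neg_apply]
  linarith [a (e 1) (e 0) (e 0) (e 1), a (e 1) (e 0) (e 2) (e 3), a (e 3) (e 2) (e 0) (e 1),
    a (e 3) (e 2) (e 2) (e 3), P.R_pair (e 0) (e 1) (e 2) (e 3), s (e 0) (e 1), s (e 0) (e 2), s (e 0) (e 3),
    s (e 1) (e 2), s (e 1) (e 3), s (e 2) (e 3), a (e 0) (e 1) (e 0) (e 1),
    P.R_skew (e 1) (e 0) (e 0) (e 1), a (e 2) (e 3) (e 2) (e 3), a (e 1) (e 0) (e 0) (e 1),
    a (e 3) (e 2) (e 2) (e 3)]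

end IsUnitaryFrame

/-! ### Existence of unitary frames -/

theorem exists_orthogonal [FiniteDimensional ℝ V] (hd : Module.finrank ℝ V = 4) (u : V) :
    ∃ w, w ≠ 0 ∧ P.G w u = 0 ∧ P.G w (P.J u) = 0 := by
  let f : V →ₗ[ℝ] ℝ × ℝ := (P.G.flip u).prod (P.G.flip (P.J u))
  have h : LinearMap.ker f ≠ ⊥ := by
    apply LinearMap.ker_ne_bot_of_finrank_lt
    simp [hd]
  obtain ⟨w, hw, hw0⟩ := (Submodule.ne_bot_iff _).1 h
  have : P.G w u = 0 ∧ P.G w (P.J u) = 0 := by simpa [f] using hw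
  exact ⟨w, hw0, this⟩

theorem exists_unit (u : V) (hu : u ≠ 0) :
    ∃ c : ℝ, 0 < c ∧ c ^ 2 * P.G u u = 1 := by
  have h := P.G_pos u hu
  refine ⟨(Real.sqrt (P.G u u))⁻¹, by positivity, ?_⟩
  rw [inv_pow, Real.sq_sqrt h.le, inv_mul_cancel₀ h.ne']

/-- The scaling of the first vector is recorded because the later uses evaluate quadratic
expressions at an arbitrary u and return to u by homogeneity. -/
theorem exists_unitaryFrame [FiniteDimensional ℝ V] (hd : Module.finrank ℝ V = 4) (u : V) (hu : u ≠ 0) :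
    ∃ e : Fin 4 → V, P.IsUnitaryFrame e ∧ ∃ c : ℝ, 0 < c ∧ c ^ 2 * P.G u u = 1 ∧ e 0 = c • u := by
  obtain ⟨c, hc, hcu⟩ := P.exists_unit u hu
  obtain ⟨w, hw, h1, h2⟩ := P.exists_orthogonal hd u
  obtain ⟨d, hd, hdw⟩ := P.exists_unit w hw
  have h3 : P.G u (P.J w) = 0 := by rw [P.G_symm, P.J_skew, h2, neg_zero]
  have h4 : P.G (P.J u) w = 0 := by rw [P.G_symm, h2]
  have h5 : P.G u w = 0 := by rw [P.G_symm, h1]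
  have h6 : P.G (P.J w) u = 0 := by rw [P.G_symm, h3]
  have sk : ∀ x, P.G (P.J x) x = 0 := fun x => by rw [P.G_symm, P.G_J_self]
  have hcu' : c * (c * P.G u u) = 1 := by rw [← hcu]; ring
  have hdw' : d * (d * P.G w w) = 1 := by rw [← hdw]; ring
  refine ⟨![c • u, P.J (c • u), d • w, P.J (d • w)], ⟨?_, rfl, rfl⟩, c, hc, hcu, rfl⟩
  intro i j
  fin_cases i <;> fin_cases j <;>
    simp [P.J_orth, P.G_J_self, sk, h1, h2, h3, h4, h5, h6, hcu', hdw']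

/-! ### Contractions in an arbitrary basis -/

/-- The Gram matrix of a basis. -/
def gram (b : Module.Basis (Fin 4) ℝ V) : Matrix (Fin 4) (Fin 4) ℝ :=
  Matrix.of fun i j => P.G (b i) (b j)

/-- The squared norm of `∇J`, as a contraction in a basis. -/
def totalNormSq (b : Module.Basis (Fin 4) ℝ V) : ℝ :=
  ∑ i, ∑ j, (P.gram b)⁻¹ i j * -LinearMap.trace ℝ V (P.Q (b i) ∘ₗ P.Q (b j))

/-- The components `ω^{ab}` of the Kähler form `ω(u, v) = G (J u) v` in a basis. -/
def formUp (b : Module.Basis (Fin 4) ℝ V) (i j : Fin 4) : ℝ :=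
  ∑ k, ∑ l, (P.gram b)⁻¹ i k * (P.gram b)⁻¹ j l * P.G (P.J (b k)) (b l)

/-- The star-scalar curvature in a basis. -/
def star (b : Module.Basis (Fin 4) ℝ V) : ℝ :=
  (1 / 2) * ∑ i, ∑ j, ∑ k, ∑ l, P.G (b k) (P.R (b i) (b j) (b l)) *
    P.formUp b i j * P.formUp b k l

-- For the matrix A of frame coordinates, orthonormality reads AᵀgA = 1. Since one-sided inverses of
-- square matrices are two-sided, AAᵀ is the inverse Gram matrix.
variable {P} in
theorem IsUnitaryFrame.sum_repr {e : Fin 4 → V} (he : P.IsUnitaryFrame e)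
    (b : Module.Basis (Fin 4) ℝ V) (i j : Fin 4) :
    ∑ k, b.repr (e k) i * b.repr (e k) j = (P.gram b)⁻¹ i j := by
  let A : Matrix (Fin 4) (Fin 4) ℝ := Matrix.of fun i k => b.repr (e k) i
  have h : A.transpose * P.gram b * A = 1 := by
    ext k l
    have h1 : P.G (e k) (e l) = (A.transpose * P.gram b * A) k l := by
      conv_lhs => rw [← b.sum_repr (e k), ← b.sum_repr (e l)]
      simp only [map_sum, map_smul, LinearMap.sum_apply, LinearMap.smul_apply, smul_eq_mul,
        Matrix.mul_apply, Finset.sum_mul, Finset.mul_sum, A, gram, Matrix.of_apply,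
        Matrix.transpose_apply]
      exact Finset.sum_congr rfl fun i _ => Finset.sum_congr rfl fun j _ => by ring
    rw [← h1, he.orthonormal, Matrix.one_apply]
  have h2 : A * A.transpose * P.gram b = 1 := by
    rw [Matrix.mul_assoc]
    exact mul_eq_one_comm.1 h
  rw [Matrix.inv_eq_left_inv h2, Matrix.mul_apply]
  rfl

-- The bridge from index formulas with an inverse metric to sums over a unitary frame.
variable {P} in
theorem IsUnitaryFrame.contract {e : Fin 4 → V} (he : P.IsUnitaryFrame e)
    (b : Module.Basis (Fin 4) ℝ V) (f : V →ₗ[ℝ] V →ₗ[ℝ] ℝ) :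
    ∑ i, ∑ j, (P.gram b)⁻¹ i j * f (b i) (b j) = ∑ k, f (e k) (e k) := by
  have h : ∀ k, f (e k) (e k) = ∑ i, ∑ j, b.repr (e k) i * b.repr (e k) j * f (b i) (b j) := by
    intro k
    conv_lhs => rw [← b.sum_repr (e k)]
    simp only [map_sum, map_smul, LinearMap.sum_apply, LinearMap.smul_apply, smul_eq_mul,
      Finset.mul_sum]
    rw [Finset.sum_comm]
    exact Finset.sum_congr rfl fun i _ => Finset.sum_congr rfl fun j _ => by ring
  simp only [h, ← he.sum_repr b, Finset.sum_mul]
  rw [Finset.sum_comm]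
  conv_rhs => rw [Finset.sum_comm]
  rw [Finset.sum_comm]
  refine Finset.sum_congr rfl fun i _ => ?_
  conv_rhs => rw [Finset.sum_comm]

/-- The two inverse Gram matrices are contracted one at a time: one turns the covector G(Jx, ·) into
the vector Jx, the other is a trace over the frame. -/
theorem sum_formUp_mul [FiniteDimensional ℝ V] (hd : Module.finrank ℝ V = 4)
    {e : Fin 4 → V} (he : P.IsUnitaryFrame e)
    (b : Module.Basis (Fin 4) ℝ V) (f : V →ₗ[ℝ] V →ₗ[ℝ] ℝ) :
    ∑ i, ∑ j, P.formUp b i j * f (b i) (b j) = ∑ k, f (e k) (P.J (e k)) := by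
  have h1 : ∀ x y, ∑ j, ∑ l, (P.gram b)⁻¹ j l * (P.G (P.J x) (b l) * f y (b j)) =
      f y (P.J x) := by
    intro x y
    have := he.contract b (LinearMap.mk₂ ℝ (fun v w => P.G (P.J x) w * f y v)
      (by intros; simp; ring) (by intros; simp; ring) (by intros; simp; ring)
      (by intros; simp; ring))
    simp only [LinearMap.mk₂_apply] at this
    rw [this]
    conv_rhs => rw [he.expand hd (P.J x)]
    simp
  have h2 := he.contract b (LinearMap.mk₂ ℝ (fun y x => f y (P.J x))
      (by intros; simp) (by intros; simp) (by intros; simp)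
      (by intros; simp))
  simp only [LinearMap.mk₂_apply] at h2
  rw [← h2]
  refine Finset.sum_congr rfl fun i _ => ?_
  simp only [← h1, formUp, Finset.sum_mul, Finset.mul_sum]
  rw [Finset.sum_comm]
  refine Finset.sum_congr rfl fun k _ => Finset.sum_congr rfl fun j _ =>
    Finset.sum_congr rfl fun l _ => by ring

/-- `sum_formUp_mul` is applied to each pair of indices; the inner contraction is tr(J R(x,y)). -/
theorem star_eq [FiniteDimensional ℝ V] (hd : Module.finrank ℝ V = 4)
    {e : Fin 4 → V} (he : P.IsUnitaryFrame e) (b : Module.Basis (Fin 4) ℝ V) :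
    P.star b = (1 / 2) * ∑ i, LinearMap.trace ℝ V (P.J ∘ₗ P.R (e i) (P.J (e i))) := by
  have h1 : ∀ x y, ∑ k, ∑ l, P.formUp b k l * P.G (b k) (P.R x y (b l)) =
      LinearMap.trace ℝ V (P.J ∘ₗ P.R x y) := by
    intro x y
    have := P.sum_formUp_mul hd he b (LinearMap.mk₂ ℝ (fun v w => P.G v (P.R x y w))
      (by intros; simp) (by intros; simp) (by intros; simp) (by intros; simp))
    simp only [LinearMap.mk₂_apply] at this
    rw [this, he.trace_eq hd]
    refine Finset.sum_congr rfl fun i _ => ?_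
    rw [LinearMap.comp_apply, P.J_skew, P.R_skew, neg_neg, P.G_symm]
  have h2 := P.sum_formUp_mul hd he b (LinearMap.mk₂ ℝ
    (fun x y => LinearMap.trace ℝ V (P.J ∘ₗ P.R x y))
      (by intros; simp [LinearMap.comp_add]) (by intros; simp [LinearMap.comp_smul])
      (by intros; simp [LinearMap.comp_add]) (by intros; simp [LinearMap.comp_smul]))
  simp only [LinearMap.mk₂_apply] at h2
  rw [star, ← h2]
  congr 1
  refine Finset.sum_congr rfl fun i _ => Finset.sum_congr rfl fun j _ => ?_
  simp only [← h1, Finset.mul_sum]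
  exact Finset.sum_congr rfl fun k _ => Finset.sum_congr rfl fun l _ => by ring

theorem totalNormSq_eq {e : Fin 4 → V} (he : P.IsUnitaryFrame e)
    (b : Module.Basis (Fin 4) ℝ V) : P.totalNormSq b = ∑ k, P.normSq (e k) := by
  have := he.contract b (LinearMap.mk₂ ℝ (fun x y => -LinearMap.trace ℝ V (P.Q x ∘ₗ P.Q y))
      (by intros; simp [LinearMap.add_comp]; ring) (by intros; simp [LinearMap.smul_comp])
      (by intros; simp [LinearMap.comp_add]; ring) (by intros; simp [LinearMap.comp_smul]))
  simp only [LinearMap.mk₂_apply] at this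
  exact this

/-! ### Pointwise consequences of the Einstein equation -/

section Einstein

variable [FiniteDimensional ℝ V] (hd : Module.finrank ℝ V = 4) {lam : ℝ}
  (hE : ∀ v w, LinearMap.trace ℝ V (LinearMap.flip (P.R.flip v) w) = lam * P.G v w)
  (b : Module.Basis (Fin 4) ℝ V)
include hd hE

theorem star_eq_scalar_add : P.star b = 4 * lam + (1 / 2) * P.totalNormSq b := by
  have : Nontrivial V := Module.nontrivial_of_finrank_pos (R := ℝ) (by omega)
  obtain ⟨u, hu⟩ := exists_ne (0 : V)
  obtain ⟨e, he, -⟩ := P.exists_unitaryFrame hd u hu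
  rw [P.star_eq hd he b, P.totalNormSq_eq he b, he.star_sub_scalar hd hE]

/-- Both sides are quadratic in u, so it suffices to take the first vector of a unitary frame, where
`trace_J_R` and `star_eq` apply. -/
theorem trace_J_R_eq (u : V) :
    2 * LinearMap.trace ℝ V (P.J ∘ₗ P.R u (P.J u)) = P.star b * P.G u u := by
  by_cases hu : u = 0
  · simp [hu]
  obtain ⟨e, he, c, hc, hcu, h0⟩ := P.exists_unitaryFrame hd u hu
  have h := he.trace_J_R hd hE
  have h2 := P.star_eq hd he b
  rw [← mul_right_inj' (pow_pos hc 2).ne']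
  have h3 : c ^ 2 * LinearMap.trace ℝ V (P.J ∘ₗ P.R u (P.J u)) =
      LinearMap.trace ℝ V (P.J ∘ₗ P.R (e 0) (P.J (e 0))) := by
    rw [h0]
    simp [LinearMap.comp_smul]
    ring
  linear_combination 2 * h3 + (1/2) * h - h2 - P.star b * hcu

omit hE in
theorem normSq_nonneg (u : V) : 0 ≤ P.normSq u := by
  by_cases hu : u = 0
  · simp [hu, normSq]
  obtain ⟨e, he, -⟩ := P.exists_unitaryFrame hd u hu
  exact he.normSq_nonneg hd u

-- The factor ½ comes from the quasi-Kähler property: in a frame starting along u, the vectors e₀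
-- and Je₀ contribute equally to |∇J|², and the two remaining contributions are nonnegative.
omit hE in
theorem normSq_le (u : V) : P.normSq u ≤ (1 / 2) * P.totalNormSq b * P.G u u := by
  by_cases hu : u = 0
  · simp [hu, normSq]
  obtain ⟨e, he, c, hc, hcu, h0⟩ := P.exists_unitaryFrame hd u hu
  rw [P.totalNormSq_eq he b, Fin.sum_univ_four, ← he.J0, he.normSq_J hd]
  have h1 := P.normSq_nonneg hd (e 2)
  have h2 := P.normSq_nonneg hd (e 3)
  have h3 : c ^ 2 * P.normSq u = P.normSq (e 0) := by
    rw [h0]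
    simp [normSq, LinearMap.comp_smul, LinearMap.smul_comp]
    ring
  have h4 := (P.G_pos u hu).le
  have h5 : P.normSq u = P.normSq (e 0) * P.G u u := by
    linear_combination P.G u u * h3 - P.normSq u * hcu
  rw [h5]
  nlinarith

end Einstein

end AlmostKahlerJet

/-! ### Almost-Kähler structures on open subsets of a vector space -/

section LocalGeometry

variable {E : Type*} [NormedAddCommGroup E] [NormedSpace ℝ E]

/-- The curvature `∂ᵤ A_v - ∂_v A_u + [A_u, A_v]` of the connection with coefficients `A`. -/
def localCurv (A : E → E →L[ℝ] E →L[ℝ] E) (y u v : E) : E →L[ℝ] E :=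
  fderiv ℝ A y u v - fderiv ℝ A y v u + (A y u * A y v - A y v * A y u)

/-- The covariant derivative `∇_u J = ∂ᵤ J + [A_u, J]`. -/
def covJ (A : E → E →L[ℝ] E →L[ℝ] E) (J : E → E →L[ℝ] E) (y : E) : E →L[ℝ] E →L[ℝ] E :=
  fderiv ℝ J y + ((ContinuousLinearMap.compL ℝ E E E).flip (J y) ∘L A y
    - ContinuousLinearMap.compL ℝ E E E (J y) ∘L A y)

theorem covJ_apply (A : E → E →L[ℝ] E →L[ℝ] E) (J : E → E →L[ℝ] E) (y u : E) :
    covJ A J y u = fderiv ℝ J y u + (A y u * J y - J y * A y u) := rfl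

/-- The coefficients of the Hermitian connection `∇ - ½ J (∇J)`. -/
def hermitianCoeff (A : E → E →L[ℝ] E →L[ℝ] E) (J : E → E →L[ℝ] E) (y : E) :
    E →L[ℝ] E →L[ℝ] E :=
  A y - (1 / 2 : ℝ) • (ContinuousLinearMap.compL ℝ E E E (J y) ∘L covJ A J y)

theorem hermitianCoeff_apply (A : E → E →L[ℝ] E →L[ℝ] E) (J : E → E →L[ℝ] E) (y u : E) :
    hermitianCoeff A J y u = A y u - (1 / 2 : ℝ) • (J y * covJ A J y u) := rfl

/-- `A` consists of the Levi-Civita connection coefficients of the metric `G` on `U`. -/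
structure IsLeviCivitaOn (U : Set E) (G : E → E →L[ℝ] E →L[ℝ] ℝ)
    (A : E → E →L[ℝ] E →L[ℝ] E) : Prop where
  isOpen : IsOpen U
  G_smooth : ContDiffOn ℝ ∞ G U
  A_smooth : ContDiffOn ℝ ∞ A U
  G_symm : ∀ y ∈ U, ∀ u v, G y u v = G y v u
  G_pos : ∀ y ∈ U, ∀ u, u ≠ 0 → 0 < G y u u
  A_symm : ∀ y ∈ U, ∀ u v, A y u v = A y v u
  A_metric : ∀ y ∈ U, ∀ u v w, fderiv ℝ G y u v w = G y (A y u v) w + G y v (A y u w)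

/-- `(G, J)` is an almost-Kähler structure on `U` with Levi-Civita coefficients `A`. -/
structure IsAlmostKahlerOn (U : Set E) (G : E → E →L[ℝ] E →L[ℝ] ℝ)
    (A : E → E →L[ℝ] E →L[ℝ] E) (J : E → E →L[ℝ] E) : Prop extends IsLeviCivitaOn U G A where
  J_smooth : ContDiffOn ℝ ∞ J U
  J_sq : ∀ y ∈ U, ∀ u, J y (J y u) = -u
  J_orth : ∀ y ∈ U, ∀ u v, G y (J y u) (J y v) = G y u v
  closed : ∀ y ∈ U, ∀ u v w, G y (covJ A J y u v) w + G y (covJ A J y v w) u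
    + G y (covJ A J y w u) v = 0

/-! ### Derivatives of operator-valued maps -/

section Calculus

variable {F F' : Type*} [NormedAddCommGroup F] [NormedSpace ℝ F] [NormedAddCommGroup F']
  [NormedSpace ℝ F']

theorem fderiv_clm_apply_apply {L : E → F →L[ℝ] F'} {f : E → F} {y : E}
    (hL : DifferentiableAt ℝ L y) (hf : DifferentiableAt ℝ f y) (x : E) :
    fderiv ℝ (fun z => L z (f z)) y x = fderiv ℝ L y x (f y) + L y (fderiv ℝ f y x) := by
  rw [fderiv_clm_apply hL hf]
  simp [add_comm]

theorem fderiv_clm_apply_const {L : E → F →L[ℝ] F'} {y : E}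
    (hL : DifferentiableAt ℝ L y) (v : F) (x : E) :
    fderiv ℝ (fun z => L z v) y x = fderiv ℝ L y x v := by
  rw [fderiv_clm_apply_apply hL (differentiableAt_const v)]
  simp

theorem fderiv_bilin_apply {G : E → F →L[ℝ] F →L[ℝ] F'} {f g : E → F} {y : E}
    (hG : DifferentiableAt ℝ G y) (hf : DifferentiableAt ℝ f y) (hg : DifferentiableAt ℝ g y)
    (x : E) :
    fderiv ℝ (fun z => G z (f z) (g z)) y x =
      fderiv ℝ G y x (f y) (g y) + G y (fderiv ℝ f y x) (g y) + G y (f y) (fderiv ℝ g y x) := by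
  rw [fderiv_clm_apply_apply (hG.clm_apply hf) hg, fderiv_clm_apply_apply hG hf]
  rfl

theorem fderiv_eq_of_eqOn {U : Set E} (hU : IsOpen U) {f g : E → F} (h : ∀ y ∈ U, f y = g y)
    {y : E} (hy : y ∈ U) : fderiv ℝ f y = fderiv ℝ g y :=
  Filter.EventuallyEq.fderiv_eq (Filter.eventually_of_mem (hU.mem_nhds hy) h)

theorem ContDiffOn.differentiableAt_of_isOpen {U : Set E} {f : E → F} (hf : ContDiffOn ℝ ∞ f U)
    (hU : IsOpen U) {y : E} (hy : y ∈ U) : DifferentiableAt ℝ f y :=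
  (hf.contDiffAt (hU.mem_nhds hy)).differentiableAt (by simp)

theorem ContDiffOn.fderiv_smooth {U : Set E} {f : E → F} (hf : ContDiffOn ℝ ∞ f U)
    (hU : IsOpen U) : ContDiffOn ℝ ∞ (fderiv ℝ f) U :=
  hf.fderiv_of_isOpen hU (by simp)

theorem ContDiffOn.second_symm {U : Set E} {f : E → F} (hf : ContDiffOn ℝ ∞ f U)
    (hU : IsOpen U) {y : E} (hy : y ∈ U) (u v : E) :
    fderiv ℝ (fderiv ℝ f) y u v = fderiv ℝ (fderiv ℝ f) y v u :=
  (hf.contDiffAt (hU.mem_nhds hy)).isSymmSndFDerivAt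
    (by simp; exact WithTop.coe_le_coe.2 le_top) u v

end Calculus

/-! ### Levi-Civita coefficients: curvature symmetries and change of coordinates -/

namespace IsLeviCivitaOn

variable {U : Set E} {G : E → E →L[ℝ] E →L[ℝ] ℝ} {A : E → E →L[ℝ] E →L[ℝ] E}
  (h : IsLeviCivitaOn U G A)
include h

theorem A_diff {y : E} (hy : y ∈ U) : DifferentiableAt ℝ A y :=
  h.A_smooth.differentiableAt_of_isOpen h.isOpen hy

theorem G_diff {y : E} (hy : y ∈ U) : DifferentiableAt ℝ G y :=
  h.G_smooth.differentiableAt_of_isOpen h.isOpen hy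

theorem fderiv_A_symm {y : E} (hy : y ∈ U) (x u v : E) :
    fderiv ℝ A y x u v = fderiv ℝ A y x v u := by
  have h1 : ∀ a b, fderiv ℝ (fun z => A z a b) y x = fderiv ℝ A y x a b := fun a b => by
    rw [fderiv_clm_apply_const ((h.A_diff hy).clm_apply (differentiableAt_const a)),
      fderiv_clm_apply_const (h.A_diff hy)]
  rw [← h1, ← h1, fderiv_eq_of_eqOn h.isOpen (fun z hz => h.A_symm z hz u v) hy]

theorem curv_cyc {y : E} (hy : y ∈ U) (u v w : E) :
    localCurv A y u v w + localCurv A y v w u + localCurv A y w u v = 0 := by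
  simp only [localCurv, add_apply, sub_apply,
    mul_apply_eq_comp]
  rw [h.fderiv_A_symm hy u v w, h.fderiv_A_symm hy v w u, h.fderiv_A_symm hy w u v,
    h.A_symm y hy v w, h.A_symm y hy u w, h.A_symm y hy v u]
  abel

/-- Differentiating metric compatibility once more expresses D²G through A and its derivative.
Symmetry of D²G in u and v then gives the skewness of the curvature. -/
theorem curv_skew {y : E} (hy : y ∈ U) (u v w z : E) :
    G y (localCurv A y u v w) z = -G y (localCurv A y u v z) w := by
  have hG := h.G_diff hy
  have hA := h.A_diff hy
  have hG' := (h.G_smooth.fderiv_smooth h.isOpen).differentiableAt_of_isOpen h.isOpen hy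
  have h1 : ∀ a b, fderiv ℝ (fderiv ℝ G) y a b w z =
      fderiv ℝ G y a (A y b w) z + G y (fderiv ℝ A y a b w) z +
      (fderiv ℝ G y a w (A y b z) + G y w (fderiv ℝ A y a b z)) := by
    intro a b
    have e := fderiv_eq_of_eqOn h.isOpen (fun x hx => h.A_metric x hx b w z) hy
    have e2 := DFunLike.congr_fun e a
    have hA1 : ∀ c, DifferentiableAt ℝ (fun x => A x b c) y := fun c =>
      (hA.clm_apply (differentiableAt_const b)).clm_apply (differentiableAt_const c)
    have hA2 : ∀ c, fderiv ℝ (fun x => A x b c) y a = fderiv ℝ A y a b c := fun c => by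
      rw [fderiv_clm_apply_const (hA.clm_apply (differentiableAt_const b)),
        fderiv_clm_apply_const hA]
    rw [fderiv_clm_apply_const ((hG'.clm_apply (differentiableAt_const b)).clm_apply
      (differentiableAt_const w)), fderiv_clm_apply_const
      (hG'.clm_apply (differentiableAt_const b)), fderiv_clm_apply_const hG',
      fderiv_fun_add ((hG.clm_apply (hA1 w)).clm_apply (differentiableAt_const z))
        ((hG.clm_apply (differentiableAt_const w)).clm_apply (hA1 z)),
      add_apply, fderiv_bilin_apply hG (hA1 w) (differentiableAt_const z),
      fderiv_bilin_apply hG (differentiableAt_const w) (hA1 z)] at e2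
    simpa [hA2] using e2
  have h2 := h.G_smooth.second_symm h.isOpen hy u v
  have h3 := congrArg (fun L => L w z) h2
  simp only [h1, h.A_metric y hy] at h3
  have h4 := h.G_symm y hy (localCurv A y u v z) w
  rw [h4]
  simp only [localCurv, add_apply, sub_apply,
    mul_apply_eq_comp, map_add, map_sub]
  linarith

theorem koszul {y : E} (hy : y ∈ U) (u v w : E) :
    2 * G y (A y u v) w = fderiv ℝ G y u v w + fderiv ℝ G y v u w - fderiv ℝ G y w u v := by
  rw [h.A_metric y hy, h.A_metric y hy, h.A_metric y hy, h.A_symm y hy v u, h.A_symm y hy w u,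
    h.A_symm y hy w v, h.G_symm y hy (A y u w) v]
  ring

/-- The transformation law of the Levi-Civita connection coefficients. -/
theorem change {U' : Set E} {G' : E → E →L[ℝ] E →L[ℝ] ℝ} {A' : E → E →L[ℝ] E →L[ℝ] E}
    (h' : IsLeviCivitaOn U' G' A') {τ : E → E} {W : Set E} (hW : IsOpen W) (hWU : W ⊆ U)
    (hτ : ContDiffOn ℝ ∞ τ W) (hτU : ∀ y ∈ W, τ y ∈ U')
    (hG : ∀ y ∈ W, ∀ u v, G y u v = G' (τ y) (fderiv ℝ τ y u) (fderiv ℝ τ y v))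
    {y : E} (hy : y ∈ W) (hP : Function.Surjective (fderiv ℝ τ y)) (u v : E) :
    fderiv ℝ τ y (A y u v) =
      A' (τ y) (fderiv ℝ τ y u) (fderiv ℝ τ y v) + fderiv ℝ (fderiv ℝ τ) y u v := by
  have hτ1 := hτ.differentiableAt_of_isOpen hW hy
  have hτ2 := (hτ.fderiv_smooth hW).differentiableAt_of_isOpen hW hy
  have hG' := h'.G_diff (hτU y hy)
  have h1 : ∀ a b c, fderiv ℝ G y a b c =
      fderiv ℝ G' (τ y) (fderiv ℝ τ y a) (fderiv ℝ τ y b) (fderiv ℝ τ y c)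
      + G' (τ y) (fderiv ℝ (fderiv ℝ τ) y a b) (fderiv ℝ τ y c)
      + G' (τ y) (fderiv ℝ τ y b) (fderiv ℝ (fderiv ℝ τ) y a c) := by
    intro a b c
    have e := DFunLike.congr_fun (fderiv_eq_of_eqOn hW (fun x hx => hG x hx b c) hy) a
    have hc : DifferentiableAt ℝ (fun z => G' (τ z)) y := hG'.comp y hτ1
    have hc2 : fderiv ℝ (fun z => G' (τ z)) y a = fderiv ℝ G' (τ y) (fderiv ℝ τ y a) := by
      have := fderiv_comp y hG' hτ1
      rw [show (fun z => G' (τ z)) = G' ∘ τ from rfl, this]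
      rfl
    have hb : ∀ b, DifferentiableAt ℝ (fun z => fderiv ℝ τ z b) y := fun b =>
      hτ2.clm_apply (differentiableAt_const b)
    rw [fderiv_bilin_apply hc (hb b) (hb c), fderiv_clm_apply_const hτ2,
      fderiv_clm_apply_const hτ2, hc2, fderiv_clm_apply_const
      ((h.G_diff (hWU hy)).clm_apply (differentiableAt_const b)),
      fderiv_clm_apply_const (h.G_diff (hWU hy))] at e
    exact e
  by_contra hne
  have hne' := sub_ne_zero.2 hne
  set D := fderiv ℝ τ y (A y u v) -
    (A' (τ y) (fderiv ℝ τ y u) (fderiv ℝ τ y v) + fderiv ℝ (fderiv ℝ τ) y u v) with hD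
  -- Comparing the two Koszul formulas, with D²τ symmetric, shows that the defect D of the law is
  -- orthogonal to the image of dτ. As dτ is onto, D is orthogonal to itself.
  have key : ∀ w, G' (τ y) D (fderiv ℝ τ y w) = 0 := by
    intro w
    have k1 := h.koszul (hWU hy) u v w
    have k2 := h'.koszul (hτU y hy) (fderiv ℝ τ y u) (fderiv ℝ τ y v) (fderiv ℝ τ y w)
    rw [h1, h1, h1, hG y hy, hτ.second_symm hW hy v u, hτ.second_symm hW hy w u,
      hτ.second_symm hW hy w v, h'.G_symm _ (hτU y hy) (fderiv ℝ (fderiv ℝ τ) y u w)] at k1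
    rw [hD]
    simp only [map_sub, map_add, sub_apply, add_apply]
    linarith
  obtain ⟨w, hw⟩ := hP D
  have := h'.G_pos _ (hτU y hy) D hne'
  rw [← hw] at this
  rw [← hw] at key
  exact this.ne' (key w)

end IsLeviCivitaOn

end LocalGeometry

section LocalGeometry

variable {E : Type*} [NormedAddCommGroup E] [NormedSpace ℝ E]

/-- The second covariant derivative `∇²_{u,w} J`. -/
def secondCovJ (A : E → E →L[ℝ] E →L[ℝ] E) (J : E → E →L[ℝ] E) (y u w : E) : E →L[ℝ] E :=
  fderiv ℝ (covJ A J) y u w + A y u * covJ A J y w - covJ A J y w * A y u - covJ A J y (A y u w)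

/-! ### First and second covariant derivatives of J -/

namespace IsAlmostKahlerOn

variable {U : Set E} {G : E → E →L[ℝ] E →L[ℝ] ℝ} {A : E → E →L[ℝ] E →L[ℝ] E}
  {J : E → E →L[ℝ] E} (h : IsAlmostKahlerOn U G A J)
include h

theorem J_diff {y : E} (hy : y ∈ U) : DifferentiableAt ℝ J y :=
  h.J_smooth.differentiableAt_of_isOpen h.isOpen hy

theorem covJ_smooth : ContDiffOn ℝ ∞ (covJ A J) U := by
  unfold covJ
  refine (h.J_smooth.fderiv_smooth h.isOpen).add (ContDiffOn.sub ?_ ?_)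
  · exact ((ContinuousLinearMap.contDiff _).comp_contDiffOn h.J_smooth).clm_comp h.A_smooth
  · exact ((ContinuousLinearMap.contDiff _).comp_contDiffOn h.J_smooth).clm_comp h.A_smooth

theorem hermitianCoeff_smooth : ContDiffOn ℝ ∞ (hermitianCoeff A J) U := by
  unfold hermitianCoeff
  refine h.A_smooth.sub (ContDiffOn.const_smul _ ?_)
  exact ((ContinuousLinearMap.contDiff _).comp_contDiffOn h.J_smooth).clm_comp h.covJ_smooth

theorem covJ_diff {y : E} (hy : y ∈ U) : DifferentiableAt ℝ (covJ A J) y :=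
  h.covJ_smooth.differentiableAt_of_isOpen h.isOpen hy

theorem J_skew {y : E} (hy : y ∈ U) (u v : E) : G y (J y u) v = -G y u (J y v) := by
  have := h.J_orth y hy u (J y v)
  rw [h.J_sq y hy, map_neg] at this
  linarith

theorem fderiv_J_J {y : E} (hy : y ∈ U) (u v : E) :
    fderiv ℝ J y u (J y v) = -J y (fderiv ℝ J y u v) := by
  have hJ := h.J_diff hy
  have hv : DifferentiableAt ℝ (fun z => J z v) y := hJ.clm_apply (differentiableAt_const v)
  have e := DFunLike.congr_fun (fderiv_eq_of_eqOn h.isOpen (fun x hx => h.J_sq x hx v) hy) u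
  rw [fderiv_clm_apply_apply hJ hv, fderiv_clm_apply_const hJ] at e
  rw [eq_neg_iff_add_eq_zero, e]
  simp

theorem covJ_J {y : E} (hy : y ∈ U) (u v : E) :
    covJ A J y u (J y v) = -J y (covJ A J y u v) := by
  simp only [covJ_apply, add_apply, sub_apply, mul_apply_eq_comp, map_add, map_sub,
    h.fderiv_J_J hy, h.J_sq y hy, map_neg]
  abel

theorem covJ_skew {y : E} (hy : y ∈ U) (u v w : E) :
    G y (covJ A J y u v) w = -G y (covJ A J y u w) v := by
  have hJ := h.J_diff hy
  have hG := h.G_diff hy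
  have hv : ∀ v, DifferentiableAt ℝ (fun z => J z v) y := fun v =>
    hJ.clm_apply (differentiableAt_const v)
  have e := DFunLike.congr_fun (fderiv_eq_of_eqOn h.isOpen
    (f := fun z => G z (J z v) w + G z v (J z w)) (g := fun _ => 0)
    (fun x hx => by rw [h.J_skew hx]; ring) hy) u
  rw [fderiv_fun_add ((hG.clm_apply (hv v)).clm_apply (differentiableAt_const w))
    ((hG.clm_apply (differentiableAt_const v)).clm_apply (hv w)), add_apply,
    fderiv_bilin_apply hG (hv v) (differentiableAt_const w),
    fderiv_bilin_apply hG (differentiableAt_const v) (hv w),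
    fderiv_clm_apply_const hJ, fderiv_clm_apply_const hJ, h.A_metric y hy, h.A_metric y hy] at e
  simp only [fderiv_fun_const, Pi.zero_apply, zero_apply, map_zero,
    add_zero] at e
  rw [h.G_symm y hy (covJ A J y u w)]
  simp only [covJ_apply, add_apply, sub_apply, mul_apply_eq_comp, map_add, map_sub]
  rw [h.J_skew hy (A y u v)]
  linarith [h.J_skew hy v (A y u w)]

theorem fderiv_covJ_apply {y : E} (hy : y ∈ U) (u w v : E) :
    fderiv ℝ (covJ A J) y u w v = fderiv ℝ (fderiv ℝ J) y u w v
      + (fderiv ℝ A y u w (J y v) + A y w (fderiv ℝ J y u v))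
      - (fderiv ℝ J y u (A y w v) + J y (fderiv ℝ A y u w v)) := by
  have hJ := h.J_diff hy
  have hA := h.A_diff hy
  have hJ' := (h.J_smooth.fderiv_smooth h.isOpen).differentiableAt_of_isOpen h.isOpen hy
  have hJv : DifferentiableAt ℝ (fun z => J z v) y := hJ.clm_apply (differentiableAt_const v)
  have hAw : DifferentiableAt ℝ (fun z => A z w) y := hA.clm_apply (differentiableAt_const w)
  have hAv : DifferentiableAt ℝ (fun z => A z w v) y := hAw.clm_apply (differentiableAt_const v)
  have hJw := hJ'.clm_apply (differentiableAt_const w)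
  rw [← fderiv_clm_apply_const (h.covJ_diff hy) w u, ← fderiv_clm_apply_const
    ((h.covJ_diff hy).clm_apply (differentiableAt_const w)) v u]
  simp only [covJ_apply, add_apply, sub_apply, mul_apply_eq_comp]
  rw [fderiv_fun_add (hJw.clm_apply (differentiableAt_const v))
    ((hAw.clm_apply hJv).fun_sub (hJ.clm_apply hAv)), add_apply,
    fderiv_fun_sub (hAw.clm_apply hJv) (hJ.clm_apply hAv), sub_apply,
    fderiv_clm_apply_apply hAw hJv, fderiv_clm_apply_apply hJ hAv,
    fderiv_clm_apply_const hJ, fderiv_clm_apply_const hAw, fderiv_clm_apply_const hA,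
    fderiv_clm_apply_const hJw, fderiv_clm_apply_const hJ']
  abel

/-- The Ricci identity: second derivatives of J cancel by symmetry, and the terms ∇_{A(u,w)}J cancel
because the connection is torsion-free. -/
theorem secondCovJ_comm {y : E} (hy : y ∈ U) (u w v : E) :
    secondCovJ A J y u w v - secondCovJ A J y w u v =
      localCurv A y u w (J y v) - J y (localCurv A y u w v) := by
  simp only [secondCovJ, localCurv, add_apply, sub_apply, mul_apply_eq_comp,
    h.fderiv_covJ_apply hy, h.J_smooth.second_symm h.isOpen hy u w, h.A_symm y hy u w]
  simp only [covJ_apply, add_apply, sub_apply, mul_apply_eq_comp, map_add, map_sub]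
  abel

/-- Obtained by differentiating `covJ_skew`. The connection terms cancel by the same identity with
A(u,·) inserted in one argument; `secondCovJ_cyc` follows from closedness in the same way. -/
theorem secondCovJ_skew {y : E} (hy : y ∈ U) (u w a b : E) :
    G y (secondCovJ A J y u w a) b = -G y (secondCovJ A J y u w b) a := by
  have hG := h.G_diff hy
  have hQ := h.covJ_diff hy
  have hQw : DifferentiableAt ℝ (fun z => covJ A J z w) y :=
    hQ.clm_apply (differentiableAt_const w)
  have hQv : ∀ v, DifferentiableAt ℝ (fun z => covJ A J z w v) y := fun v =>
    hQw.clm_apply (differentiableAt_const v)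
  have e := DFunLike.congr_fun (fderiv_eq_of_eqOn h.isOpen
    (f := fun z => G z (covJ A J z w a) b + G z (covJ A J z w b) a) (g := fun _ => 0)
    (fun x hx => by rw [h.covJ_skew hx]; ring) hy) u
  rw [fderiv_fun_add ((hG.clm_apply (hQv a)).clm_apply (differentiableAt_const b))
    ((hG.clm_apply (hQv b)).clm_apply (differentiableAt_const a)), add_apply,
    fderiv_bilin_apply hG (hQv a) (differentiableAt_const b),
    fderiv_bilin_apply hG (hQv b) (differentiableAt_const a),
    fderiv_clm_apply_const hQw, fderiv_clm_apply_const hQ, fderiv_clm_apply_const hQw,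
    fderiv_clm_apply_const hQ, h.A_metric y hy, h.A_metric y hy] at e
  simp only [fderiv_fun_const, Pi.zero_apply, zero_apply, map_zero,
    add_zero] at e
  simp only [secondCovJ, add_apply, sub_apply, mul_apply_eq_comp, map_add, map_sub]
  linarith [h.covJ_skew hy w (A y u a) b, h.covJ_skew hy w (A y u b) a,
    h.covJ_skew hy (A y u w) a b, h.G_symm y hy (covJ A J y w a) (A y u b),
    h.G_symm y hy (covJ A J y w b) (A y u a)]

theorem secondCovJ_cyc {y : E} (hy : y ∈ U) (u a b c : E) :
    G y (secondCovJ A J y u a b) c + G y (secondCovJ A J y u b c) a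
      + G y (secondCovJ A J y u c a) b = 0 := by
  have hG := h.G_diff hy
  have hQ := h.covJ_diff hy
  have hQw : ∀ w, DifferentiableAt ℝ (fun z => covJ A J z w) y := fun w =>
    hQ.clm_apply (differentiableAt_const w)
  have hQv : ∀ w v, DifferentiableAt ℝ (fun z => covJ A J z w v) y := fun w v =>
    (hQw w).clm_apply (differentiableAt_const v)
  have hGQ : ∀ a b c, DifferentiableAt ℝ (fun z => G z (covJ A J z a b) c) y := fun a b c =>
    (hG.clm_apply (hQv a b)).clm_apply (differentiableAt_const c)
  have f : ∀ a b c, fderiv ℝ (fun z => G z (covJ A J z a b) c) y u =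
      G y (A y u (covJ A J y a b)) c + G y (covJ A J y a b) (A y u c)
      + G y (fderiv ℝ (covJ A J) y u a b) c := by
    intro a b c
    rw [fderiv_bilin_apply hG (hQv a b) (differentiableAt_const c),
      fderiv_clm_apply_const (hQw a), fderiv_clm_apply_const hQ, h.A_metric y hy]
    simp
  have e := DFunLike.congr_fun (fderiv_eq_of_eqOn h.isOpen
    (f := fun z => G z (covJ A J z a b) c + G z (covJ A J z b c) a + G z (covJ A J z c a) b)
    (g := fun _ => 0) (fun x hx => h.closed x hx a b c) hy) u
  rw [fderiv_fun_add ((hGQ a b c).fun_add (hGQ b c a)) (hGQ c a b), add_apply,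
    fderiv_fun_add (hGQ a b c) (hGQ b c a), add_apply, f, f, f] at e
  simp only [fderiv_fun_const, Pi.zero_apply, zero_apply] at e
  simp only [secondCovJ, add_apply, sub_apply, mul_apply_eq_comp, map_add, map_sub]
  linarith [h.closed y hy (A y u a) b c, h.closed y hy a (A y u b) c, h.closed y hy a b (A y u c)]

/-- The derivative of the relation (∇_wJ)J + J(∇_wJ) = 0; the right side collects the terms in which
the derivative falls on the explicit factor J. -/
theorem secondCovJ_J {y : E} (hy : y ∈ U) (u w v : E) :
    secondCovJ A J y u w (J y v) + J y (secondCovJ A J y u w v) =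
      -(covJ A J y u (covJ A J y w v) + covJ A J y w (covJ A J y u v)) := by
  have hJ := h.J_diff hy
  have hQ := h.covJ_diff hy
  have hQw : DifferentiableAt ℝ (fun z => covJ A J z w) y :=
    hQ.clm_apply (differentiableAt_const w)
  have hQv : DifferentiableAt ℝ (fun z => covJ A J z w v) y :=
    hQw.clm_apply (differentiableAt_const v)
  have hJv : DifferentiableAt ℝ (fun z => J z v) y := hJ.clm_apply (differentiableAt_const v)
  have e := DFunLike.congr_fun (fderiv_eq_of_eqOn h.isOpen
    (f := fun z => covJ A J z w (J z v) + J z (covJ A J z w v)) (g := fun _ => 0)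
    (fun x hx => by rw [h.covJ_J hx]; simp) hy) u
  rw [fderiv_fun_add (hQw.clm_apply hJv) (hJ.clm_apply hQv), add_apply,
    fderiv_clm_apply_apply hQw hJv, fderiv_clm_apply_apply hJ hQv, fderiv_clm_apply_const hQw,
    fderiv_clm_apply_const hQ, fderiv_clm_apply_const hJ] at e
  simp only [fderiv_fun_const, Pi.zero_apply, zero_apply] at e
  have d : ∀ x, fderiv ℝ J y u x = covJ A J y u x - A y u (J y x) + J y (A y u x) := by
    intro x
    simp only [covJ_apply, add_apply, sub_apply, mul_apply_eq_comp]
    abel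
  rw [d, d] at e
  simp only [map_add, map_sub, h.covJ_J hy] at e
  simp only [secondCovJ, add_apply, sub_apply, mul_apply_eq_comp, map_add, map_sub, h.covJ_J hy,
    map_neg]
  rw [← sub_eq_zero, ← e]
  abel

/-- The algebraic data at a point of a local almost-Kähler structure. -/
def jet {y : E} (hy : y ∈ U) : AlmostKahlerJet E where
  G := LinearMap.mk₂ ℝ (fun u v => G y u v) (by simp) (by simp) (by simp) (by simp)
  J := J y
  R := LinearMap.mk₂ ℝ (fun u v => (localCurv A y u v : E →ₗ[ℝ] E))
    (by intros; ext; simp [localCurv]; abel) (by intros; ext; simp [localCurv, smul_sub, smul_add])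
    (by intros; ext; simp [localCurv]; abel) (by intros; ext; simp [localCurv, smul_sub, smul_add])
  Q := LinearMap.mk₂ ℝ (fun u v => covJ A J y u v) (by simp) (by simp) (by simp) (by simp)
  S := LinearMap.mk₂ ℝ (fun u v => (secondCovJ A J y u v : E →ₗ[ℝ] E))
    (by intros; ext; simp [secondCovJ]; abel)
    (by intros; ext; simp [secondCovJ, smul_sub, smul_add])
    (by intros; ext; simp [secondCovJ]; abel)
    (by intros; ext; simp [secondCovJ, smul_sub, smul_add])
  G_symm := h.G_symm y hy
  G_pos := h.G_pos y hy
  J_sq := h.J_sq y hy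
  J_orth := h.J_orth y hy
  R_anti u v w := by simp [localCurv]; abel
  R_skew := h.curv_skew hy
  R_cyc := h.curv_cyc hy
  Q_skew := h.covJ_skew hy
  Q_J := h.covJ_J hy
  Q_cyc := h.closed y hy
  S_comm := h.secondCovJ_comm hy
  S_skew := h.secondCovJ_skew hy
  S_cyc := h.secondCovJ_cyc hy
  S_J := h.secondCovJ_J hy

/-! ### Traced curvature of the Hermitian connection -/

/-- The trace of an endomorphism. -/
def endTrace : (E →L[ℝ] E) →ₗ[ℝ] ℝ :=
  LinearMap.trace ℝ E ∘ₗ ContinuousLinearMap.coeLM ℝ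

omit h in
theorem endTrace_mul_comm (a b : E →L[ℝ] E) : endTrace (a * b) = endTrace (b * a) :=
  LinearMap.trace_mul_comm ℝ (a : E →ₗ[ℝ] E) (b : E →ₗ[ℝ] E)

/-- Anticommutation with J gives ∇_vJ = J(∇_vJ)J, whose trace is -tr(∇_vJ) by cyclicity and J² = -1.
-/
theorem endTrace_covJ {y : E} (hy : y ∈ U) (v : E) : endTrace (covJ A J y v) = 0 := by
  have h1 : covJ A J y v = J y * (covJ A J y v * J y) := by
    ext x
    simp only [mul_apply_eq_comp, h.covJ_J hy, map_neg, h.J_sq y hy, neg_neg]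
  have h2 : J y * J y = -1 := by
    ext x
    simp only [mul_apply_eq_comp, h.J_sq y hy]
    rfl
  have h3 : endTrace (J y * (covJ A J y v * J y)) = -endTrace (covJ A J y v) := by
    rw [endTrace_mul_comm, mul_assoc, h2]
    simp
  rw [← h1] at h3
  linarith

variable [FiniteDimensional ℝ E]

/-- This removes the derivatives of ∇J from the traced Hermitian curvature, where they appear
multiplied by J² = -1. -/
theorem endTrace_fderiv_covJ {y : E} (hy : y ∈ U) (u v : E) :
    endTrace (fderiv ℝ (covJ A J) y u v) = 0 := by
  have hQ := h.covJ_diff hy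
  have e := DFunLike.congr_fun (fderiv_eq_of_eqOn h.isOpen
    (f := fun z => LinearMap.toContinuousLinearMap endTrace (covJ A J z v)) (g := fun _ => 0)
    (fun x hx => h.endTrace_covJ hx v) hy) u
  rw [fderiv_clm_apply_apply (differentiableAt_const _) (hQ.clm_apply (differentiableAt_const v)),
    fderiv_clm_apply_const hQ] at e
  simpa using e

omit [FiniteDimensional ℝ E] in
theorem fderiv_hermitianCoeff {y : E} (hy : y ∈ U) (u v : E) :
    fderiv ℝ (hermitianCoeff A J) y u v = fderiv ℝ A y u v
      - (1 / 2 : ℝ) • (fderiv ℝ J y u * covJ A J y v + J y * fderiv ℝ (covJ A J) y u v) := by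
  have hJ := h.J_diff hy
  have hA := h.A_diff hy
  have hQ := h.covJ_diff hy
  have hH := h.hermitianCoeff_smooth.differentiableAt_of_isOpen h.isOpen hy
  ext1 x
  have hQx : DifferentiableAt ℝ (fun z => covJ A J z v x) y :=
    (hQ.clm_apply (differentiableAt_const v)).clm_apply (differentiableAt_const x)
  rw [← fderiv_clm_apply_const hH v u, ← fderiv_clm_apply_const
    (hH.clm_apply (differentiableAt_const v)) x u]
  simp only [hermitianCoeff_apply, add_apply, sub_apply, mul_apply_eq_comp, smul_apply]
  rw [fderiv_fun_sub ((hA.clm_apply (differentiableAt_const v)).clm_apply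
    (differentiableAt_const x)) ((hJ.clm_apply hQx).fun_const_smul _), sub_apply,
    fderiv_fun_const_smul (hJ.clm_apply hQx), smul_apply, fderiv_clm_apply_apply hJ hQx,
    fderiv_clm_apply_const (hQ.clm_apply (differentiableAt_const v)), fderiv_clm_apply_const hQ,
    fderiv_clm_apply_const (hA.clm_apply (differentiableAt_const v)), fderiv_clm_apply_const hA]

/-- The curvature of the Hermitian connection, traced against `J`. -/
theorem endTrace_J_localCurv {y : E} (hy : y ∈ U) (u v : E) :
    endTrace (J y * localCurv (hermitianCoeff A J) y u v) =
      endTrace (J y * localCurv A y u v)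
        - (1 / 2) * endTrace (J y * (covJ A J y u * covJ A J y v)) := by
  have d : ∀ u, fderiv ℝ J y u = covJ A J y u - (A y u * J y - J y * A y u) := fun u => by
    rw [covJ_apply]; abel
  have hJJ : J y * J y = -1 := by
    ext x
    simp only [mul_apply_eq_comp, h.J_sq y hy]
    rfl
  have hJx : ∀ x, J y * (J y * x) = -x := fun x => by rw [← mul_assoc, hJJ, neg_one_mul]
  have hQJ : ∀ u, covJ A J y u * J y = -(J y * covJ A J y u) := fun u => by
    ext x
    exact h.covJ_J hy u x
  have hQx : ∀ u x, covJ A J y u * (J y * x) = -(J y * (covJ A J y u * x)) := fun u x => by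
    rw [← mul_assoc, hQJ, neg_mul, mul_assoc]
  simp only [localCurv, h.fderiv_hermitianCoeff hy, hermitianCoeff_apply]
  rw [d u, d v]
  have tu := h.endTrace_fderiv_covJ hy u v
  have tv := h.endTrace_fderiv_covJ hy v u
  -- Cyclicity cancels the terms mixing A with ∇J and makes tr(J ∇_uJ ∇_vJ) antisymmetric in u and
  -- v.
  have c1 := endTrace_mul_comm (covJ A J y u) (A y v)
  have c2 := endTrace_mul_comm (covJ A J y v) (A y u)
  have c3 := endTrace_mul_comm (covJ A J y u) (J y * covJ A J y v)
  simp only [mul_assoc, hQx, map_neg] at c3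
  simp only [mul_add, mul_sub, sub_mul, mul_assoc, smul_mul_assoc, mul_smul_comm,
    smul_add, smul_sub, smul_smul, hJx, hQx, map_add, map_sub, map_smul, map_neg, smul_neg,
    mul_neg, smul_eq_mul, tu, tv]
  linarith

end IsAlmostKahlerOn

/-- Subtracting ½J(∇J) from the connection changes the derivative of J by -½[J(∇J), J], which is -∇J
because J and ∇J anticommute. This fixes the coefficient ½. -/
theorem IsAlmostKahlerOn.covJ_hermitianCoeff {U : Set E} {G : E → E →L[ℝ] E →L[ℝ] ℝ}
    {A : E → E →L[ℝ] E →L[ℝ] E} {J : E → E →L[ℝ] E} (h : IsAlmostKahlerOn U G A J)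
    {y : E} (hy : y ∈ U) (u v : E) :
    covJ (hermitianCoeff A J) J y u v = 0 := by
  have h1 : covJ (hermitianCoeff A J) J y u v = covJ A J y u v
      - (1 / 2 : ℝ) • (J y (covJ A J y u (J y v)) - J y (J y (covJ A J y u v))) := by
    have h2 : covJ A J y u v = fderiv ℝ J y u v + (A y u (J y v) - J y (A y u v)) := rfl
    rw [covJ_apply]
    simp only [hermitianCoeff_apply, add_apply, sub_apply, mul_apply_eq_comp, smul_apply,
      map_sub, map_smul]
    have d : fderiv ℝ J y u v = covJ A J y u v - (A y u (J y v) - J y (A y u v)) := by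
      rw [h2]; abel
    rw [d]
    module
  rw [h1, h.covJ_J hy, map_neg, h.J_sq y hy]
  module

/-! ### Transgression between two complex connections -/

section Difference

open IsAlmostKahlerOn

variable [FiniteDimensional ℝ E]

/-- The trace of an endomorphism, as a continuous linear form. -/
def endTraceL : (E →L[ℝ] E) →L[ℝ] ℝ := LinearMap.toContinuousLinearMap endTrace

theorem endTraceL_apply (a : E →L[ℝ] E) : endTraceL a = endTrace a := rfl

/-- The `1`-form `v ↦ tr (J B_v)`. -/
def traceForm (J : E → E →L[ℝ] E) (B : E → E →L[ℝ] E →L[ℝ] E) (y : E) : E →L[ℝ] ℝ :=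
  endTraceL ∘L ContinuousLinearMap.compL ℝ E E E (J y) ∘L B y

theorem traceForm_apply (J : E → E →L[ℝ] E) (B : E → E →L[ℝ] E →L[ℝ] E) (y v : E) :
    traceForm J B y v = endTrace (J y * B y v) := rfl

theorem fderiv_traceForm {J : E → E →L[ℝ] E} {B : E → E →L[ℝ] E →L[ℝ] E} {y : E}
    (hJ : DifferentiableAt ℝ J y) (hB : DifferentiableAt ℝ B y) (u v : E) :
    fderiv ℝ (traceForm J B) y u v = endTrace (fderiv ℝ J y u * B y v + J y * fderiv ℝ B y u v) := by
  have hd : DifferentiableAt ℝ (traceForm J B) y := by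
    unfold traceForm
    exact (differentiableAt_const _).clm_comp
      (((ContinuousLinearMap.differentiableAt _).comp y hJ).clm_comp hB)
  have hBv : DifferentiableAt ℝ (fun z => B z v) y := hB.clm_apply (differentiableAt_const v)
  rw [← fderiv_clm_apply_const hd v u]
  have e : (fun z => traceForm J B z v) = fun z => endTraceL ((J * fun z => B z v) z) := rfl
  have hm : DifferentiableAt ℝ (J * fun z => B z v) y := hJ.mul hBv
  rw [e, fderiv_clm_apply_apply (differentiableAt_const _) hm]
  simp only [fderiv_fun_const, Pi.zero_apply, zero_apply, zero_add, endTraceL_apply]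
  congr 1
  rw [fderiv_mul' hJ hBv]
  simp only [add_apply, smul_apply, smul_eq_mul, fderiv_clm_apply_const hB]
  rw [add_comm]
  rfl

/-- Changing a complex connection changes the traced curvature by an exact form. -/
theorem endTrace_localCurv_sub {J : E → E →L[ℝ] E} {A B : E → E →L[ℝ] E →L[ℝ] E} {y : E}
    (hJ : DifferentiableAt ℝ J y) (hA : DifferentiableAt ℝ A y) (hB : DifferentiableAt ℝ B y)
    (hJA : ∀ u v, covJ A J y u v = 0) (hJB : ∀ u v, B y u (J y v) = J y (B y u v)) (u v : E) :
    endTrace (J y * localCurv (A + B) y u v) = endTrace (J y * localCurv A y u v) +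
      (fderiv ℝ (traceForm J B) y u v - fderiv ℝ (traceForm J B) y v u) := by
  have hBJ : ∀ u, B y u * J y = J y * B y u := fun u => by ext x; exact hJB u x
  have d : ∀ u, fderiv ℝ J y u = J y * A y u - A y u * J y := fun u => by
    have : covJ A J y u = 0 := by ext1 x; exact hJA u x
    rw [covJ_apply] at this
    rw [← sub_eq_zero, ← this]
    abel
  have hBx : ∀ u x, B y u * (J y * x) = J y * (B y u * x) := fun u x => by
    rw [← mul_assoc, hBJ, mul_assoc]
  rw [fderiv_traceForm hJ hB, fderiv_traceForm hJ hB, d, d]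
  simp only [localCurv, fderiv_add hA hB, Pi.add_apply, add_apply]
  -- Since B commutes with J, tr(J[B_u, B_v]) vanishes. The terms mixing A and B match those
  -- produced by ∂J = [J, A] in the derivative of tr(JB).
  have c1 := endTrace_mul_comm (A y u) (J y * B y v)
  have c2 := endTrace_mul_comm (A y v) (J y * B y u)
  have c3 := endTrace_mul_comm (B y u) (J y * B y v)
  simp only [mul_assoc, hBx] at c1 c2 c3
  simp only [mul_add, mul_sub, add_mul, sub_mul, mul_assoc, map_add, map_sub]
  linarith

end Difference

/-! ### Behaviour under maps and coordinate changes -/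

/-- The exterior derivative of a `1`-form commutes with pull-back. -/
theorem fderiv_pullback_antisymm {X : Type*} [NormedAddCommGroup X] [NormedSpace ℝ X]
    {α : E → E →L[ℝ] ℝ} {f : X → E} {W : Set X} (hW : IsOpen W) (hf : ContDiffOn ℝ ∞ f W)
    {z : X} (hz : z ∈ W) (hα : DifferentiableAt ℝ α (f z)) (u v : X) :
    fderiv ℝ (fun x => (α (f x)).comp (fderiv ℝ f x)) z u v
      - fderiv ℝ (fun x => (α (f x)).comp (fderiv ℝ f x)) z v u =
    fderiv ℝ α (f z) (fderiv ℝ f z u) (fderiv ℝ f z v)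
      - fderiv ℝ α (f z) (fderiv ℝ f z v) (fderiv ℝ f z u) := by
  have hf1 := hf.differentiableAt_of_isOpen hW hz
  have hf2 := (hf.fderiv_smooth hW).differentiableAt_of_isOpen hW hz
  have hc : DifferentiableAt ℝ (fun x => α (f x)) z := hα.comp z hf1
  have hd := hc.clm_comp hf2
  have key : ∀ u v, fderiv ℝ (fun x => (α (f x)).comp (fderiv ℝ f x)) z u v =
      fderiv ℝ α (f z) (fderiv ℝ f z u) (fderiv ℝ f z v)
        + α (f z) (fderiv ℝ (fderiv ℝ f) z u v) := by
    intro u v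
    rw [← fderiv_clm_apply_const hd v u]
    simp only [ContinuousLinearMap.comp_apply]
    rw [fderiv_clm_apply_apply hc (hf2.clm_apply (differentiableAt_const v)),
      fderiv_clm_apply_const hf2]
    have := fderiv_comp z hα hf1
    rw [show (fun x => α (f x)) = α ∘ f from rfl, this]
    rfl
  rw [key, key, hf.second_symm hW hz u v]
  ring

/-- The transformation law of `∇J`. -/
theorem covJ_change {U U' W : Set E} {A A' : E → E →L[ℝ] E →L[ℝ] E} {J J' : E → E →L[ℝ] E}
    (hU : IsOpen U) (hU' : IsOpen U')
    (hJ : ContDiffOn ℝ ∞ J U) (hJ' : ContDiffOn ℝ ∞ J' U')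
    {τ : E → E} (hW : IsOpen W) (hWU : W ⊆ U)
    (hτ : ContDiffOn ℝ ∞ τ W) (hτU : ∀ y ∈ W, τ y ∈ U')
    (hJJ : ∀ y ∈ W, ∀ u, fderiv ℝ τ y (J y u) = J' (τ y) (fderiv ℝ τ y u))
    (hAA : ∀ y ∈ W, ∀ u v, fderiv ℝ τ y (A y u v) =
      A' (τ y) (fderiv ℝ τ y u) (fderiv ℝ τ y v) + fderiv ℝ (fderiv ℝ τ) y u v)
    {y : E} (hy : y ∈ W) (u v : E) :
    fderiv ℝ τ y (covJ A J y u v) = covJ A' J' (τ y) (fderiv ℝ τ y u) (fderiv ℝ τ y v) := by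
  have hτ1 := hτ.differentiableAt_of_isOpen hW hy
  have hτ2 := (hτ.fderiv_smooth hW).differentiableAt_of_isOpen hW hy
  have hJ1 := hJ.differentiableAt_of_isOpen hU (hWU hy)
  have hJ2 := hJ'.differentiableAt_of_isOpen hU' (hτU y hy)
  have e := DFunLike.congr_fun (fderiv_eq_of_eqOn hW (fun x hx => hJJ x hx v) hy) u
  have hc : DifferentiableAt ℝ (fun z => J' (τ z)) y := hJ2.comp y hτ1
  have hc2 : fderiv ℝ (fun z => J' (τ z)) y u = fderiv ℝ J' (τ y) (fderiv ℝ τ y u) := by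
    have := fderiv_comp y hJ2 hτ1
    rw [show (fun z => J' (τ z)) = J' ∘ τ from rfl, this]
    rfl
  rw [fderiv_clm_apply_apply hτ2 (hJ1.clm_apply (differentiableAt_const v)),
    fderiv_clm_apply_apply hc (hτ2.clm_apply (differentiableAt_const v)), hc2,
    fderiv_clm_apply_const hτ2, fderiv_clm_apply_const hJ1] at e
  simp only [covJ_apply, add_apply, sub_apply, mul_apply_eq_comp, map_add, map_sub, hJJ y hy,
    hAA y hy]
  rw [← sub_eq_zero] at e ⊢
  rw [← e]
  abel

/-- The transformation law of the coefficients of the Hermitian connection. -/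
theorem hermitianCoeff_change {U U' W : Set E} {A A' : E → E →L[ℝ] E →L[ℝ] E}
    {J J' : E → E →L[ℝ] E} (hU : IsOpen U) (hU' : IsOpen U')
    (hJ : ContDiffOn ℝ ∞ J U) (hJ' : ContDiffOn ℝ ∞ J' U')
    {τ : E → E} (hW : IsOpen W) (hWU : W ⊆ U)
    (hτ : ContDiffOn ℝ ∞ τ W) (hτU : ∀ y ∈ W, τ y ∈ U')
    (hJJ : ∀ y ∈ W, ∀ u, fderiv ℝ τ y (J y u) = J' (τ y) (fderiv ℝ τ y u))
    (hAA : ∀ y ∈ W, ∀ u v, fderiv ℝ τ y (A y u v) =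
      A' (τ y) (fderiv ℝ τ y u) (fderiv ℝ τ y v) + fderiv ℝ (fderiv ℝ τ) y u v)
    {y : E} (hy : y ∈ W) (u v : E) :
    fderiv ℝ τ y (hermitianCoeff A J y u v) =
      hermitianCoeff A' J' (τ y) (fderiv ℝ τ y u) (fderiv ℝ τ y v)
        + fderiv ℝ (fderiv ℝ τ) y u v := by
  simp only [hermitianCoeff_apply, sub_apply, smul_apply, mul_apply_eq_comp, map_sub, map_smul,
    hAA y hy, hJJ y hy, covJ_change hU hU' hJ hJ' hW hWU hτ hτU hJJ hAA hy]
  abel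

end LocalGeometry

/-! ### Vector fields and one-forms in the preferred charts -/

section ChartCalculus

variable {E : Type*} [NormedAddCommGroup E] [NormedSpace ℝ E]
  {H : Type*} [TopologicalSpace H] (I : ModelWithCorners ℝ E H)
  {M : Type*} [TopologicalSpace M] [ChartedSpace H M]

/-- The derivative at `q` of the preferred chart at `p`. -/
def chartD (p q : M) : TangentSpace I q →L[ℝ] E := mvfderiv I (extChartAt I p) q

/-- The inverse of `chartD`. -/
def chartDInv (p q : M) : E →L[ℝ] TangentSpace I q := (chartD I p q).inverse

/-- The transition map from the preferred chart at `p` to the one at `p'`. -/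
def chartTrans (p p' : M) (y : E) : E := extChartAt I p' ((extChartAt I p).symm y)

/-- The domain of `chartTrans`. -/
def chartOverlap (p p' : M) : Set E :=
  (extChartAt I p).target ∩ (extChartAt I p).symm ⁻¹' (extChartAt I p').source

/-- The expression of a vector field in the preferred chart at `p`. -/
def vecRep (p : M) (Y : ∀ q : M, TangentSpace I q) (y : E) : E :=
  chartD I p ((extChartAt I p).symm y) (Y ((extChartAt I p).symm y))

/-- The vector field which is constant in the preferred chart at `p`. -/
def chartField (p : M) (v : E) (q : M) : TangentSpace I q := chartDInv I p q v

variable {I}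

theorem mem_chartOverlap {p p' q : M} (hp : q ∈ (extChartAt I p).source)
    (hp' : q ∈ (extChartAt I p').source) : extChartAt I p q ∈ chartOverlap I p p' :=
  ⟨(extChartAt I p).map_source hp, by
    rw [Set.mem_preimage, (extChartAt I p).left_inv hp]; exact hp'⟩

theorem chartTrans_mem {p p' : M} {y : E} (hy : y ∈ chartOverlap I p p') :
    chartTrans I p p' y ∈ (extChartAt I p').target :=
  (extChartAt I p').map_source hy.2

theorem chartTrans_extChartAt {p p' q : M} (hp : q ∈ (extChartAt I p).source) :
    chartTrans I p p' (extChartAt I p q) = extChartAt I p' q := by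
  rw [chartTrans, (extChartAt I p).left_inv hp]

theorem symm_chartTrans {p p' : M} {y : E} (hy : y ∈ chartOverlap I p p') :
    (extChartAt I p').symm (chartTrans I p p' y) = (extChartAt I p).symm y :=
  (extChartAt I p').left_inv hy.2

variable [I.Boundaryless]

theorem isOpen_chartOverlap (p p' : M) : IsOpen (chartOverlap I p p') :=
  (continuousOn_extChartAt_symm p).isOpen_inter_preimage (isOpen_extChartAt_target p)
    (isOpen_extChartAt_source p')

variable [IsManifold I ∞ M]

theorem contDiffOn_chartTrans (p p' : M) :
    ContDiffOn ℝ ∞ (chartTrans I p p') (chartOverlap I p p') := by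
  have := contDiffOn_ext_coord_change (I := I) (n := ∞) p' p
  refine this.mono fun y hy => ?_
  simpa [chartOverlap] using hy

omit [I.Boundaryless] in
theorem isManifold_one : IsManifold I 1 M := .of_le (n := ∞) (by simp)

theorem chartD_isInvertible {p q : M} (hq : q ∈ (extChartAt I p).source) :
    (chartD I p q).IsInvertible := by
  have : IsManifold I 1 M := isManifold_one
  exact isInvertible_mfderiv_extChartAt hq

theorem chartDInv_chartD {p q : M} (hq : q ∈ (extChartAt I p).source) (v : TangentSpace I q) :
    chartDInv I p q (chartD I p q v) = v :=
  (chartD_isInvertible hq).inverse_apply_self v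

theorem chartD_chartDInv {p q : M} (hq : q ∈ (extChartAt I p).source) (v : E) :
    chartD I p q (chartDInv I p q v) = v :=
  (chartD_isInvertible hq).self_apply_inverse v

theorem chartD_injective {p q : M} (hq : q ∈ (extChartAt I p).source) :
    Function.Injective (chartD I p q) :=
  Function.LeftInverse.injective (chartDInv_chartD hq)

theorem mdifferentiableAt_extChartAt_source {p q : M} (hq : q ∈ (extChartAt I p).source) :
    MDifferentiableAt I 𝓘(ℝ, E) (extChartAt I p) q := by
  have : IsManifold I 1 M := isManifold_one
  exact mdifferentiableAt_extChartAt (by simpa using hq)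

omit [I.Boundaryless] [IsManifold I ∞ M] in
theorem mvfderiv_comp_fderiv {E' F : Type*} [NormedAddCommGroup E'] [NormedSpace ℝ E']
    [NormedAddCommGroup F] [NormedSpace ℝ F] {f : M → E'} {g : E' → F} {q : M}
    (hg : DifferentiableAt ℝ g (f q)) (hf : MDifferentiableAt I 𝓘(ℝ, E') f q)
    (v : TangentSpace I q) :
    mvfderiv I (g ∘ f) q v = fderiv ℝ g (f q) (mvfderiv I f q v) := by
  have h := mfderiv_comp_apply q hg.mdifferentiableAt hf v
  rw [mfderiv_eq_fderiv] at h
  exact h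

/-- The chain rule for the identity φ_{p'} = (φ_{p'} ∘ φ_p⁻¹) ∘ φ_p, valid near q. -/
theorem fderiv_chartTrans {p p' q : M} (hp : q ∈ (extChartAt I p).source)
    (hp' : q ∈ (extChartAt I p').source) (v : TangentSpace I q) :
    fderiv ℝ (chartTrans I p p') (extChartAt I p q) (chartD I p q v) = chartD I p' q v := by
  have hd : DifferentiableAt ℝ (chartTrans I p p') (extChartAt I p q) :=
    (contDiffOn_chartTrans p p').differentiableAt_of_isOpen (isOpen_chartOverlap p p')
      (mem_chartOverlap hp hp')
  have h1 := mvfderiv_comp_fderiv hd (mdifferentiableAt_extChartAt_source hp) v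
  have h2 : (chartTrans I p p' ∘ extChartAt I p) =ᶠ[𝓝 q] extChartAt I p' := by
    filter_upwards [(isOpen_extChartAt_source p).mem_nhds hp] with x hx
    exact chartTrans_extChartAt hx
  have h3 : mvfderiv I (chartTrans I p p' ∘ extChartAt I p) q = chartD I p' q := by
    unfold chartD mvfderiv
    rw [h2.mfderiv_eq]
    rfl
  rw [h3] at h1
  exact h1.symm

theorem fderiv_chartTrans' {p p' : M} {y : E} (hy : y ∈ chartOverlap I p p')
    (v : TangentSpace I ((extChartAt I p).symm y)) :
    fderiv ℝ (chartTrans I p p') y (chartD I p ((extChartAt I p).symm y) v)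
      = chartD I p' ((extChartAt I p).symm y) v := by
  have := fderiv_chartTrans ((extChartAt I p).map_target hy.1) hy.2 v
  rwa [(extChartAt I p).right_inv hy.1] at this

theorem surjective_fderiv_chartTrans {p p' : M} {y : E} (hy : y ∈ chartOverlap I p p') :
    Function.Surjective (fderiv ℝ (chartTrans I p p') y) := fun v =>
  ⟨_, (fderiv_chartTrans' hy (chartDInv I p' _ v)).trans (chartD_chartDInv hy.2 v)⟩

theorem vecRep_chartTrans {p p' : M} (Y : ∀ q : M, TangentSpace I q) {y : E}
    (hy : y ∈ chartOverlap I p p') :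
    vecRep I p' Y (chartTrans I p p' y) = fderiv ℝ (chartTrans I p p') y (vecRep I p Y y) := by
  rw [vecRep, symm_chartTrans hy, vecRep, fderiv_chartTrans' hy]

theorem vecRep_chartField (p : M) (v : E) {y : E} (hy : y ∈ (extChartAt I p).target) :
    vecRep I p (chartField I p v) y = v :=
  chartD_chartDInv ((extChartAt I p).map_target hy) v

omit [I.Boundaryless] [IsManifold I ∞ M] in
theorem vecRep_extChartAt {p q : M} (Y : ∀ q : M, TangentSpace I q)
    (hq : q ∈ (extChartAt I p).source) :
    vecRep I p Y (extChartAt I p q) = chartD I p q (Y q) := by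
  rw [vecRep, (extChartAt I p).left_inv hq]

section Functions

variable {F : Type*} [NormedAddCommGroup F] [NormedSpace ℝ F] {f : M → F} {p q : M}

theorem contMDiffAt_iff_chart (hq : q ∈ (extChartAt I p).source) :
    ContMDiffAt I 𝓘(ℝ, F) ∞ f q ↔
      ContDiffAt ℝ ∞ (f ∘ (extChartAt I p).symm) (extChartAt I p q) := by
  rw [contMDiffAt_iff_source_of_mem_source (x := p) (by simpa using hq), I.range_eq_univ,
    contMDiffWithinAt_univ, contMDiffAt_iff_contDiffAt]

theorem mdifferentiableAt_iff_chart (hq : q ∈ (extChartAt I p).source) :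
    MDifferentiableAt I 𝓘(ℝ, F) f q ↔
      DifferentiableAt ℝ (f ∘ (extChartAt I p).symm) (extChartAt I p q) := by
  have : IsManifold I 1 M := isManifold_one
  rw [mdifferentiableAt_iff_source_of_mem_source (x := p) (by simpa using hq), I.range_eq_univ,
    mdifferentiableWithinAt_univ, mdifferentiableAt_iff_differentiableAt]

theorem mvfderiv_eq_fderiv_chart (hq : q ∈ (extChartAt I p).source)
    (hf : MDifferentiableAt I 𝓘(ℝ, F) f q) (v : TangentSpace I q) :
    mvfderiv I f q v = fderiv ℝ (f ∘ (extChartAt I p).symm) (extChartAt I p q) (chartD I p q v) := by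
  have hd := (mdifferentiableAt_iff_chart hq).1 hf
  have h1 := mvfderiv_comp_fderiv hd (mdifferentiableAt_extChartAt_source hq) v
  have h2 : ((f ∘ (extChartAt I p).symm) ∘ extChartAt I p) =ᶠ[𝓝 q] f := by
    filter_upwards [(isOpen_extChartAt_source p).mem_nhds hq] with x hx
    simp only [Function.comp_apply, (extChartAt I p).left_inv hx]
  have h3 : mvfderiv I ((f ∘ (extChartAt I p).symm) ∘ extChartAt I p) q v = mvfderiv I f q v := by
    unfold mvfderiv
    rw [h2.mfderiv_eq]
    rfl
  rw [← h3, h1]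
  rfl

end Functions

section Sections

variable {Y : ∀ q : M, TangentSpace I q} {p q : M}

/-- The tangent-bundle trivialization is the derivative of the chart; hence regularity of a vector
field can be read off from `vecRep`. -/
theorem trivializationAt_snd (hq : q ∈ (extChartAt I p).source) (v : TangentSpace I q) :
    (trivializationAt E (TangentSpace I) p ⟨q, v⟩).2 = chartD I p q v := by
  have : IsManifold I 1 M := isManifold_one
  have hq' : q ∈ (chartAt H p).source := by simpa using hq
  have h := TangentBundle.continuousLinearMapAt_trivializationAt (I := I) (x₀ := p) hq'
  rw [← Trivialization.continuousLinearMapAt_apply_of_mem (R := ℝ) _ (by simpa using hq), h]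
  rfl

theorem contMDiffAt_vecRep (hq : q ∈ (extChartAt I p).source) :
    ContMDiffAt I (I.prod 𝓘(ℝ, E)) ∞
      (fun q => TotalSpace.mk' E (E := fun q : M => TangentSpace I q) q (Y q)) q ↔
      ContDiffAt ℝ ∞ (vecRep I p Y) (extChartAt I p q) := by
  have hq' : q ∈ (trivializationAt E (TangentSpace I) p).baseSet := by simpa using hq
  rw [Trivialization.contMDiffAt_section_iff _ hq', contMDiffAt_iff_chart hq]
  have h : ((fun q => (trivializationAt E (TangentSpace I) p ⟨q, Y q⟩).2) ∘
      (extChartAt I p).symm) =ᶠ[𝓝 (extChartAt I p q)] vecRep I p Y := by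
    filter_upwards [(isOpen_extChartAt_target p).mem_nhds ((extChartAt I p).map_source hq)]
      with y hy
    exact trivializationAt_snd ((extChartAt I p).map_target hy) _
  exact ⟨fun h' => h'.congr_of_eventuallyEq h.symm, fun h' => h'.congr_of_eventuallyEq h⟩

theorem mdifferentiableAt_vecRep (hq : q ∈ (extChartAt I p).source) :
    MDifferentiableAt I (I.prod 𝓘(ℝ, E))
      (fun q => TotalSpace.mk' E (E := fun q : M => TangentSpace I q) q (Y q)) q ↔
      DifferentiableAt ℝ (vecRep I p Y) (extChartAt I p q) := by
  have : IsManifold I 1 M := isManifold_one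
  have hq' : q ∈ (trivializationAt E (TangentSpace I) p).baseSet := by simpa using hq
  rw [Trivialization.mdifferentiableAt_section_iff _ _ _ hq', mdifferentiableAt_iff_chart hq]
  refine Filter.EventuallyEq.differentiableAt_iff ?_
  filter_upwards [(isOpen_extChartAt_target p).mem_nhds ((extChartAt I p).map_source hq)] with y hy
  exact trivializationAt_snd ((extChartAt I p).map_target hy) _

theorem contMDiffAt_chartField (hq : q ∈ (extChartAt I p).source) (v : E) :
    ContMDiffAt I (I.prod 𝓘(ℝ, E)) ∞
      (fun q => TotalSpace.mk' E (E := fun q : M => TangentSpace I q) q (chartField I p v q)) q := by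
  rw [contMDiffAt_vecRep hq]
  refine (contDiffAt_const (c := v)).congr_of_eventuallyEq ?_
  filter_upwards [(isOpen_extChartAt_target p).mem_nhds ((extChartAt I p).map_source hq)] with y hy
  exact vecRep_chartField p v hy

end Sections

end ChartCalculus

/-! ### Connections from local coefficients -/

section ConnectionFamily

variable {E : Type*} [NormedAddCommGroup E] [NormedSpace ℝ E]
  {H : Type*} [TopologicalSpace H] {I : ModelWithCorners ℝ E H} [I.Boundaryless]
  {M : Type*} [TopologicalSpace M] [ChartedSpace H M] [IsManifold I ∞ M]

variable (I) in
/-- Connection coefficients in all preferred charts, related by the transformation law. -/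
structure IsConnectionFamily (A : M → E → E →L[ℝ] E →L[ℝ] E) : Prop where
  smooth : ∀ p, ContDiffOn ℝ ∞ (A p) (extChartAt I p).target
  change : ∀ p p', ∀ y ∈ chartOverlap I p p', ∀ u v,
    fderiv ℝ (chartTrans I p p') y (A p y u v) =
      A p' (chartTrans I p p' y) (fderiv ℝ (chartTrans I p p') y u)
        (fderiv ℝ (chartTrans I p p') y v)
        + fderiv ℝ (fderiv ℝ (chartTrans I p p')) y u v

variable (I) in
/-- The covariant derivative with coefficients `A`. -/
def covDerivOf (A : M → E → E →L[ℝ] E →L[ℝ] E) (Y : ∀ q : M, TangentSpace I q) (q : M) :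
    TangentSpace I q →L[ℝ] TangentSpace I q :=
  chartDInv I q q ∘L (fderiv ℝ (vecRep I q Y) (extChartAt I q q)
    + (A q (extChartAt I q q)).flip (chartD I q q (Y q))) ∘L chartD I q q

theorem vecRep_add (p : M) (Y Z : ∀ q : M, TangentSpace I q) :
    vecRep I p (Y + Z) = vecRep I p Y + vecRep I p Z := by
  ext y
  exact map_add _ _ _

theorem vecRep_smul (p : M) (f : M → ℝ) (Y : ∀ q : M, TangentSpace I q) :
    vecRep I p (f • Y) = fun y => (f ∘ (extChartAt I p).symm) y • vecRep I p Y y := by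
  ext y
  exact map_smul _ _ _

namespace IsConnectionFamily

variable {A : M → E → E →L[ℝ] E →L[ℝ] E} (hA : IsConnectionFamily I A)
include hA

/-- The covariant derivative in an arbitrary preferred chart. -/
theorem chartD_covDerivOf {p q : M} (hq : q ∈ (extChartAt I p).source)
    {Y : ∀ q : M, TangentSpace I q} (hY : DifferentiableAt ℝ (vecRep I p Y) (extChartAt I p q))
    (v : TangentSpace I q) :
    chartD I p q (covDerivOf I A Y q v) =
      fderiv ℝ (vecRep I p Y) (extChartAt I p q) (chartD I p q v)
        + A p (extChartAt I p q) (chartD I p q v) (chartD I p q (Y q)) := by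
  have hqq : q ∈ (extChartAt I q).source := mem_extChartAt_source q
  have hy := mem_chartOverlap hq hqq
  have hτ := contDiffOn_chartTrans (I := I) p q
  have hW := isOpen_chartOverlap (I := I) p q
  have hτ1 := hτ.differentiableAt_of_isOpen hW hy
  have hτ2 := (hτ.fderiv_smooth hW).differentiableAt_of_isOpen hW hy
  have hd : DifferentiableAt ℝ (vecRep I q Y) (chartTrans I p q (extChartAt I p q)) := by
    rw [chartTrans_extChartAt hq, ← mdifferentiableAt_vecRep hqq, mdifferentiableAt_vecRep hq]
    exact hY
  -- Differentiating the transformation law of the components of Y produces a second derivative of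
  -- the transition map, which the inhomogeneous term of `hA.change` cancels.
  have e := DFunLike.congr_fun (fderiv_eq_of_eqOn hW
    (fun y hy => vecRep_chartTrans (I := I) Y hy) hy) (chartD I p q v)
  rw [fderiv_clm_apply_apply hτ2 hY,
    show (fun y => vecRep I q Y (chartTrans I p q y)) = vecRep I q Y ∘ chartTrans I p q from rfl,
    fderiv_comp _ hd hτ1, ContinuousLinearMap.comp_apply, fderiv_chartTrans hq hqq,
    chartTrans_extChartAt hq, vecRep_extChartAt Y hq] at e
  have e2 := hA.change p q _ hy (chartD I p q v) (chartD I p q (Y q))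
  rw [fderiv_chartTrans hq hqq, fderiv_chartTrans hq hqq, chartTrans_extChartAt hq] at e2
  have e3 : fderiv ℝ (vecRep I q Y) (extChartAt I q q) (chartD I q q v)
      + A q (extChartAt I q q) (chartD I q q v) (chartD I q q (Y q)) =
      fderiv ℝ (chartTrans I p q) (extChartAt I p q)
        (fderiv ℝ (vecRep I p Y) (extChartAt I p q) (chartD I p q v)
        + A p (extChartAt I p q) (chartD I p q v) (chartD I p q (Y q))) := by
    rw [map_add, e2, e]
    abel
  have e4 : ∀ w : E, chartD I p q (chartDInv I q q
      (fderiv ℝ (chartTrans I p q) (extChartAt I p q) w)) = w := fun w => by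
    conv_lhs => rw [← chartD_chartDInv hq w, fderiv_chartTrans hq hqq, chartDInv_chartD hqq]
    exact chartD_chartDInv hq w
  change chartD I p q (chartDInv I q q (fderiv ℝ (vecRep I q Y) (extChartAt I q q) (chartD I q q v)
      + A q (extChartAt I q q) (chartD I q q v) (chartD I q q (Y q)))) = _
  rw [e3, e4]

/-- The covariant derivative with given coefficients. -/
def covariantDerivative (_ : IsConnectionFamily I A) :
    CovariantDerivative I E (fun q : M => TangentSpace I q) where
  toFun := covDerivOf I A
  isCovariantDerivativeOnUniv :=
    { add := by
        intro Y Z q hY hZ _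
        have hqq : q ∈ (extChartAt I q).source := mem_extChartAt_source q
        rw [mdifferentiableAt_vecRep hqq] at hY hZ
        unfold covDerivOf
        rw [vecRep_add, fderiv_add hY hZ]
        ext v
        simp only [Pi.add_apply, map_add, ContinuousLinearMap.comp_apply, add_apply]
        abel
      leibniz := by
        intro Y f q hY hf _
        have hqq : q ∈ (extChartAt I q).source := mem_extChartAt_source q
        rw [mdifferentiableAt_vecRep hqq] at hY
        have hf' := (mdifferentiableAt_iff_chart hqq).1 hf
        have e := fderiv_fun_smul hf' hY
        ext v
        have e2 := mvfderiv_eq_fderiv_chart hqq hf v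
        unfold covDerivOf
        rw [vecRep_smul, e]
        simp only [Pi.smul_apply', map_smul, ContinuousLinearMap.comp_apply, add_apply,
          smul_apply, ContinuousLinearMap.smulRight_apply, map_add, e2, vecRep_extChartAt Y hqq,
          chartDInv_chartD hqq, Function.comp_apply, (extChartAt I q).left_inv hqq, smul_add]
        abel }

theorem covariantDerivative_apply (Y : ∀ q : M, TangentSpace I q) :
    hA.covariantDerivative Y = covDerivOf I A Y := rfl

/-- A section of Hom(TM, TM) is tested in the trivialization over x₀. There `chartD_covDerivOf`
turns the covariant derivative, at all nearby points, into the ordinary derivative plus A in the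
single chart at x₀. -/
theorem covariantDerivative_smooth :
    CovariantDerivative.ContMDiffCovariantDerivative hA.covariantDerivative ∞ := by
  refine ⟨⟨fun {Y} hY x₀ _ => ContMDiffAt.contMDiffWithinAt ?_⟩⟩
  have hY' : ∀ q, ContMDiffAt I (I.prod 𝓘(ℝ, E)) ∞
      (fun q => TotalSpace.mk' E (E := fun q : M => TangentSpace I q) q (Y q)) q := fun q =>
    (hY.contMDiffAt Filter.univ_mem).of_le (by simp)
  have h0 : x₀ ∈ (extChartAt I x₀).source := mem_extChartAt_source x₀
  rw [contMDiffAt_hom_bundle]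
  refine ⟨contMDiffAt_id, ?_⟩
  rw [contMDiffAt_iff_chart h0]
  have hU := isOpen_extChartAt_target (I := I) x₀
  have hs : ContDiffOn ℝ ∞ (vecRep I x₀ Y) (extChartAt I x₀).target := fun y hy => by
    have := (contMDiffAt_vecRep ((extChartAt I x₀).map_target hy)).1 (hY' ((extChartAt I x₀).symm y))
    rw [(extChartAt I x₀).right_inv hy] at this
    exact this.contDiffWithinAt
  have hmem := hU.mem_nhds ((extChartAt I x₀).map_source h0)
  have hsm : ContDiffAt ℝ ∞ (fun y => fderiv ℝ (vecRep I x₀ Y) y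
      + (A x₀ y).flip (vecRep I x₀ Y y)) (extChartAt I x₀ x₀) := by
    refine ((hs.fderiv_smooth hU).add (ContDiffOn.clm_apply ?_ hs)).contDiffAt hmem
    exact (ContinuousLinearMap.flipₗᵢ ℝ E E E).contDiff.comp_contDiffOn (hA.smooth x₀)
  refine hsm.congr_of_eventuallyEq ?_
  filter_upwards [hmem] with y hy
  have hq := (extChartAt I x₀).map_target hy
  have hq' : (extChartAt I x₀).symm y ∈ (trivializationAt E (TangentSpace I) x₀).baseSet := by
    simpa using hq
  ext w
  rw [Function.comp_apply, ContinuousLinearMap.inCoordinates]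
  simp only [ContinuousLinearMap.comp_apply]
  rw [Trivialization.continuousLinearMapAt_apply_of_mem (R := ℝ) (trivializationAt E (TangentSpace I) x₀) hq', trivializationAt_snd hq]
  have hw : chartD I x₀ ((extChartAt I x₀).symm y) (Trivialization.symmL ℝ
      (trivializationAt E (TangentSpace I) x₀) ((extChartAt I x₀).symm y) w) = w := by
    rw [← trivializationAt_snd hq, ← Trivialization.continuousLinearMapAt_apply_of_mem (R := ℝ)
        (trivializationAt E (TangentSpace I) x₀) hq',
      Trivialization.continuousLinearMapAt_symmL (R := ℝ) _ hq']
  have hd : DifferentiableAt ℝ (vecRep I x₀ Y) (extChartAt I x₀ ((extChartAt I x₀).symm y)) := by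
    rw [(extChartAt I x₀).right_inv hy]
    exact hs.differentiableAt_of_isOpen hU hy
  rw [covariantDerivative_apply, hA.chartD_covDerivOf hq hd, hw, (extChartAt I x₀).right_inv hy]
  rfl

end IsConnectionFamily

end ConnectionFamily

/-! ### Tensor fields in the preferred charts -/

section TensorReps

variable {E : Type*} [NormedAddCommGroup E] [NormedSpace ℝ E]
  {H : Type*} [TopologicalSpace H] {I : ModelWithCorners ℝ E H}
  {M : Type*} [TopologicalSpace M] [ChartedSpace H M]

/-- The expression of a field of bilinear forms in the preferred chart at `p`. -/
def bilRep (β : ∀ q : M, TangentSpace I q →L[ℝ] TangentSpace I q →L[ℝ] ℝ) (p : M) (y : E) :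
    E →L[ℝ] E →L[ℝ] ℝ :=
  (ContinuousLinearMap.precomp ℝ (chartDInv I p ((extChartAt I p).symm y))).comp
    ((β ((extChartAt I p).symm y)).comp (chartDInv I p ((extChartAt I p).symm y)))

theorem bilRep_apply (β : ∀ q : M, TangentSpace I q →L[ℝ] TangentSpace I q →L[ℝ] ℝ) (p : M)
    (y u v : E) : bilRep β p y u v = β ((extChartAt I p).symm y)
      (chartField I p u ((extChartAt I p).symm y)) (chartField I p v ((extChartAt I p).symm y)) :=
  rfl

/-- The expression of a field of endomorphisms in the preferred chart at `p`. -/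
def endRep (J : ∀ q : M, TangentSpace I q →L[ℝ] TangentSpace I q) (p : M) (y : E) : E →L[ℝ] E :=
  chartD I p ((extChartAt I p).symm y) ∘L J ((extChartAt I p).symm y) ∘L
    chartDInv I p ((extChartAt I p).symm y)

theorem endRep_apply (J : ∀ q : M, TangentSpace I q →L[ℝ] TangentSpace I q) (p : M) (y u : E) :
    endRep J p y u = vecRep I p (fun q => J q (chartField I p u q)) y := rfl

variable [I.Boundaryless] [IsManifold I ∞ M]

theorem chartDInv_fderiv_chartTrans {p p' : M} {y : E} (hy : y ∈ chartOverlap I p p') (u : E) :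
    chartDInv I p' ((extChartAt I p).symm y) (fderiv ℝ (chartTrans I p p') y u) =
      chartDInv I p ((extChartAt I p).symm y) u := by
  have h := fderiv_chartTrans' hy (chartDInv I p ((extChartAt I p).symm y) u)
  rw [chartD_chartDInv ((extChartAt I p).map_target hy.1)] at h
  rw [h, chartDInv_chartD hy.2]

theorem bilRep_chartTrans (β : ∀ q : M, TangentSpace I q →L[ℝ] TangentSpace I q →L[ℝ] ℝ)
    {p p' : M} {y : E} (hy : y ∈ chartOverlap I p p') (u v : E) :
    bilRep β p y u v = bilRep β p' (chartTrans I p p' y) (fderiv ℝ (chartTrans I p p') y u)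
      (fderiv ℝ (chartTrans I p p') y v) := by
  rw [bilRep_apply, bilRep_apply, symm_chartTrans hy, chartField, chartField, chartField,
    chartField, chartDInv_fderiv_chartTrans hy, chartDInv_fderiv_chartTrans hy]

theorem endRep_chartTrans (J : ∀ q : M, TangentSpace I q →L[ℝ] TangentSpace I q)
    {p p' : M} {y : E} (hy : y ∈ chartOverlap I p p') (u : E) :
    fderiv ℝ (chartTrans I p p') y (endRep J p y u) =
      endRep J p' (chartTrans I p p' y) (fderiv ℝ (chartTrans I p p') y u) := by
  rw [endRep_apply, ← vecRep_chartTrans _ hy, endRep_apply, vecRep, vecRep, symm_chartTrans hy,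
    chartField, chartField, chartDInv_fderiv_chartTrans hy]

theorem vecRep_endRep (J : ∀ q : M, TangentSpace I q →L[ℝ] TangentSpace I q)
    (Y : ∀ q : M, TangentSpace I q) {p : M} {y : E} (hy : y ∈ (extChartAt I p).target) :
    vecRep I p (fun q => J q (Y q)) y = endRep J p y (vecRep I p Y y) := by
  rw [endRep_apply, vecRep, vecRep, vecRep, chartField,
    chartDInv_chartD ((extChartAt I p).map_target hy)]

variable [FiniteDimensional ℝ E]

/-- In finite dimension it suffices to test on fixed vectors u and v, that is, to evaluate β on the
smooth fields that are constant in the chart. -/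
theorem contDiffOn_bilRep {β : ∀ q : M, TangentSpace I q →L[ℝ] TangentSpace I q →L[ℝ] ℝ}
    (hβ : ContMDiff I (I.prod 𝓘(ℝ, E →L[ℝ] E →L[ℝ] ℝ)) ∞
      (fun p => TotalSpace.mk' (E →L[ℝ] E →L[ℝ] ℝ)
        (E := fun p : M => TangentSpace I p →L[ℝ] TangentSpace I p →L[ℝ] ℝ) p (β p))) (p : M) :
    ContDiffOn ℝ ∞ (bilRep β p) (extChartAt I p).target := by
  refine contDiffOn_clm_apply.2 fun u => contDiffOn_clm_apply.2 fun v y hy => ?_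
  have hq := (extChartAt I p).map_target hy
  have h : ContMDiffAt I (I.prod 𝓘(ℝ, ℝ)) ∞
      (fun q => TotalSpace.mk' ℝ (E := Bundle.Trivial M ℝ) q
        (β q (chartField I p u q) (chartField I p v q))) ((extChartAt I p).symm y) :=
    ContMDiffAt.clm_bundle_apply₂ (F₁ := E) (F₂ := E) (hβ _) (contMDiffAt_chartField hq u)
      (contMDiffAt_chartField hq v)
  simp only [contMDiffAt_totalSpace] at h
  have h2 := (contMDiffAt_iff_chart hq).1 h.2
  rw [(extChartAt I p).right_inv hy] at h2
  exact h2.contDiffWithinAt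

theorem contDiffOn_endRep {J : ∀ q : M, TangentSpace I q →L[ℝ] TangentSpace I q}
    (hJ : ContMDiff I (I.prod 𝓘(ℝ, E →L[ℝ] E)) ∞
      (fun p => TotalSpace.mk' (E →L[ℝ] E)
        (E := fun p : M => TangentSpace I p →L[ℝ] TangentSpace I p) p (J p))) (p : M) :
    ContDiffOn ℝ ∞ (endRep J p) (extChartAt I p).target := by
  refine contDiffOn_clm_apply.2 fun u y hy => ?_
  have hq := (extChartAt I p).map_target hy
  have h := ContMDiffAt.clm_bundle_apply (F₁ := E) (F₂ := E) (hJ _) (contMDiffAt_chartField hq u)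
  rw [contMDiffAt_vecRep hq, (extChartAt I p).right_inv hy] at h
  exact h.contDiffWithinAt

end TensorReps

/-! ### Coordinates -/

section Coordinates

variable {n : ℕ}

theorem sum_coordVec (u : EuclideanSpace ℝ (Fin n)) : ∑ i, u i • coordVec i = u := by
  ext j
  simp [coordVec, Finset.sum_apply, Pi.single_apply]

theorem coordVec_apply (i j : Fin n) : coordVec i j = if j = i then 1 else 0 := by
  simp [coordVec]

theorem coord_induction {P : EuclideanSpace ℝ (Fin n) → Prop} (h0 : P 0)
    (hadd : ∀ u v, P u → P v → P (u + v)) (hsmul : ∀ (c : ℝ) u, P u → P (c • u))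
    (h : ∀ i, P (coordVec i)) (u : EuclideanSpace ℝ (Fin n)) : P u := by
  rw [← sum_coordVec u]
  exact Finset.sum_induction _ P hadd h0 fun i _ => hsmul _ _ (h i)

/-- The bilinear map with components `Γ i j k`. -/
def ofComponents (Γ : Fin n → Fin n → Fin n → ℝ) :
    EuclideanSpace ℝ (Fin n) →L[ℝ] EuclideanSpace ℝ (Fin n) →L[ℝ] EuclideanSpace ℝ (Fin n) :=
  ∑ i, ∑ j, ∑ k, Γ i j k • (EuclideanSpace.proj i : EuclideanSpace ℝ (Fin n) →L[ℝ] ℝ).smulRight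
    ((EuclideanSpace.proj j : EuclideanSpace ℝ (Fin n) →L[ℝ] ℝ).smulRight (coordVec k))

theorem ofComponents_coordVec (Γ : Fin n → Fin n → Fin n → ℝ) (i j k : Fin n) :
    ofComponents Γ (coordVec i) (coordVec j) k = Γ i j k := by
  simp [ofComponents, sum_apply, coordVec_apply, Finset.sum_apply]

theorem contDiffOn_ofComponents {U : Set (EuclideanSpace ℝ (Fin n))}
    {Γ : EuclideanSpace ℝ (Fin n) → Fin n → Fin n → Fin n → ℝ}
    (h : ∀ i j k, ContDiffOn ℝ ∞ (fun y => Γ y i j k) U) :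
    ContDiffOn ℝ ∞ (fun y => ofComponents (Γ y)) U := by
  unfold ofComponents
  exact ContDiffOn.sum fun i _ => ContDiffOn.sum fun j _ => ContDiffOn.sum fun k _ =>
    (h i j k).smul contDiffOn_const

theorem contDiffOn_det {E : Type*} [NormedAddCommGroup E] [NormedSpace ℝ E] {U : Set E}
    {A : E → Matrix (Fin n) (Fin n) ℝ} (h : ∀ i j, ContDiffOn ℝ ∞ (fun y => A y i j) U) :
    ContDiffOn ℝ ∞ (fun y => (A y).det) U := by
  simp only [Matrix.det_apply]
  exact ContDiffOn.sum fun σ _ => ContDiffOn.const_smul _ (contDiffOn_prod fun i _ => h _ _)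

/-- Cramer's rule: the entries of the inverse are determinants divided by a nonvanishing
determinant. -/
theorem contDiffOn_matrix_inv {E : Type*} [NormedAddCommGroup E] [NormedSpace ℝ E] {U : Set E}
    {A : E → Matrix (Fin n) (Fin n) ℝ} (h : ∀ i j, ContDiffOn ℝ ∞ (fun y => A y i j) U)
    (hA : ∀ y ∈ U, (A y).det ≠ 0) (i j : Fin n) :
    ContDiffOn ℝ ∞ (fun y => (A y)⁻¹ i j) U := by
  simp only [Matrix.inv_def, Ring.inverse_eq_inv', Matrix.smul_apply, smul_eq_mul,
    Matrix.adjugate_apply]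
  refine ((contDiffOn_det h).inv hA).mul (contDiffOn_det fun k l => ?_)
  simp only [Matrix.updateRow_apply]
  split_ifs
  · exact contDiffOn_const
  · exact h k l

end Coordinates

/-! ### The Levi-Civita connection in the preferred charts -/

section LeviCivita

variable {n : ℕ} {M : Type*} [TopologicalSpace M] [ChartedSpace (EuclideanSpace ℝ (Fin n)) M]
  [IsManifold (𝓡 n) ∞ M] (g : SmoothMetric n M)

/-- The Levi-Civita connection coefficients in the preferred chart at `p`. -/
def lcCoeff (p : M) (y : EuclideanSpace ℝ (Fin n)) :
    EuclideanSpace ℝ (Fin n) →L[ℝ] EuclideanSpace ℝ (Fin n) →L[ℝ] EuclideanSpace ℝ (Fin n) :=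
  ofComponents (christoffel g p y)

theorem bilinComp_eq (β : ∀ q : M, TangentSpace (𝓡 n) q →L[ℝ] TangentSpace (𝓡 n) q →L[ℝ] ℝ)
    (p : M) (i j : Fin n) (y : EuclideanSpace ℝ (Fin n)) :
    bilinComp β p i j y = bilRep β p y (coordVec i) (coordVec j) := rfl

theorem partialDeriv_bilinComp
    {β : ∀ q : M, TangentSpace (𝓡 n) q →L[ℝ] TangentSpace (𝓡 n) q →L[ℝ] ℝ} {p : M}
    {y : EuclideanSpace ℝ (Fin n)} (h : DifferentiableAt ℝ (bilRep β p) y) (i j k : Fin n) :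
    partialDeriv i (bilinComp β p j k) y =
      fderiv ℝ (bilRep β p) y (coordVec i) (coordVec j) (coordVec k) := by
  rw [partialDeriv, show bilinComp β p j k = fun y => bilRep β p y (coordVec j) (coordVec k) from
    rfl, fderiv_clm_apply_const (h.clm_apply (differentiableAt_const _)), fderiv_clm_apply_const h]

variable {g}

theorem contDiffOn_metricRep (p : M) :
    ContDiffOn ℝ ∞ (bilRep g.inner p) (extChartAt (𝓡 n) p).target :=
  contDiffOn_bilRep g.contMDiff p

theorem differentiableAt_metricRep {p : M} {y : EuclideanSpace ℝ (Fin n)}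
    (hy : y ∈ (extChartAt (𝓡 n) p).target) : DifferentiableAt ℝ (bilRep g.inner p) y :=
  (contDiffOn_metricRep p).differentiableAt_of_isOpen (isOpen_extChartAt_target p) hy

theorem metricRep_symm (p : M) (y u v : EuclideanSpace ℝ (Fin n)) :
    bilRep g.inner p y u v = bilRep g.inner p y v u := g.symm _ _ _

theorem metricRep_pos {p : M} {y : EuclideanSpace ℝ (Fin n)}
    (hy : y ∈ (extChartAt (𝓡 n) p).target) {u : EuclideanSpace ℝ (Fin n)} (hu : u ≠ 0) :
    0 < bilRep g.inner p y u u := by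
  refine g.pos _ _ fun h => hu ?_
  have h' : chartField (𝓡 n) p u ((extChartAt (𝓡 n) p).symm y) = 0 := h
  have := vecRep_chartField (I := 𝓡 n) p u hy
  rw [vecRep, h', map_zero] at this
  exact this.symm

theorem metricMatrix_posDef {p : M} {y : EuclideanSpace ℝ (Fin n)}
    (hy : y ∈ (extChartAt (𝓡 n) p).target) : (metricMatrix g p y).PosDef := by
  refine Matrix.PosDef.of_dotProduct_mulVec_pos ?_ fun x hx => ?_
  · ext i j
    exact metricRep_symm p y _ _
  · have hx' : (WithLp.toLp 2 x : EuclideanSpace ℝ (Fin n)) ≠ 0 := by simpa using hx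
    have h := metricRep_pos (g := g) hy hx'
    rw [← sum_coordVec (WithLp.toLp 2 x : EuclideanSpace ℝ (Fin n))] at h
    simp only [map_sum, map_smul, sum_apply, smul_apply, smul_eq_mul] at h
    simp only [dotProduct, Matrix.mulVec, star_trivial, metricMatrix, Matrix.of_apply,
      bilinComp_eq]
    refine h.trans_eq (Finset.sum_congr rfl fun i _ => congrArg _ (Finset.sum_congr rfl
      fun j _ => ?_))
    rw [metricRep_symm, mul_comm]

theorem metricMatrix_det_ne_zero {p : M} {y : EuclideanSpace ℝ (Fin n)}
    (hy : y ∈ (extChartAt (𝓡 n) p).target) : (metricMatrix g p y).det ≠ 0 :=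
  (metricMatrix_posDef hy).det_pos.ne'

theorem contDiffOn_bilinComp (p : M) (i j : Fin n) :
    ContDiffOn ℝ ∞ (bilinComp g.inner p i j) (extChartAt (𝓡 n) p).target :=
  ((contDiffOn_metricRep p).clm_apply contDiffOn_const).clm_apply contDiffOn_const

theorem contDiffOn_partialDeriv {U : Set (EuclideanSpace ℝ (Fin n))} (hU : IsOpen U)
    {f : EuclideanSpace ℝ (Fin n) → ℝ} (hf : ContDiffOn ℝ ∞ f U) (i : Fin n) :
    ContDiffOn ℝ ∞ (partialDeriv i f) U :=
  (hf.fderiv_smooth hU).clm_apply contDiffOn_const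

theorem contDiffOn_christoffel (p : M) (i j k : Fin n) :
    ContDiffOn ℝ ∞ (fun y => christoffel g p y i j k) (extChartAt (𝓡 n) p).target := by
  have hU := isOpen_extChartAt_target (I := 𝓡 n) p
  unfold christoffel
  refine contDiffOn_const.mul (ContDiffOn.sum fun l _ => ContDiffOn.mul ?_ ?_)
  · exact contDiffOn_matrix_inv (fun i j => contDiffOn_bilinComp p i j)
      (fun y hy => metricMatrix_det_ne_zero hy) k l
  · exact ((contDiffOn_partialDeriv hU (contDiffOn_bilinComp p _ _) _).add
      (contDiffOn_partialDeriv hU (contDiffOn_bilinComp p _ _) _)).sub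
      (contDiffOn_partialDeriv hU (contDiffOn_bilinComp p _ _) _)

theorem fderiv_metricRep_symm {p : M} {y : EuclideanSpace ℝ (Fin n)}
    (hy : y ∈ (extChartAt (𝓡 n) p).target) (u v w : EuclideanSpace ℝ (Fin n)) :
    fderiv ℝ (bilRep g.inner p) y u v w = fderiv ℝ (bilRep g.inner p) y u w v := by
  have hd := differentiableAt_metricRep (g := g) hy
  have h1 : ∀ v w, fderiv ℝ (fun y => bilRep g.inner p y v w) y u =
      fderiv ℝ (bilRep g.inner p) y u v w := fun v w => by
    rw [fderiv_clm_apply_const (hd.clm_apply (differentiableAt_const _)),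
      fderiv_clm_apply_const hd]
  rw [← h1, ← h1]
  simp only [metricRep_symm p _ v w]

theorem lcCoeff_symm {p : M} {y : EuclideanSpace ℝ (Fin n)}
    (hy : y ∈ (extChartAt (𝓡 n) p).target) (u v : EuclideanSpace ℝ (Fin n)) :
    lcCoeff g p y u v = lcCoeff g p y v u := by
  induction u using coord_induction with
  | h0 => simp
  | hadd a b ha hb => rw [map_add, map_add, add_apply, ha, hb]
  | hsmul c a ha => rw [map_smul, map_smul, smul_apply, ha]
  | h i =>
    induction v using coord_induction with
    | h0 => simp
    | hadd a b ha hb => rw [map_add, map_add, add_apply, ha, hb]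
    | hsmul c a ha => rw [map_smul, map_smul, smul_apply, ha]
    | h j =>
      ext k
      have hd := differentiableAt_metricRep (g := g) hy
      simp only [lcCoeff, ofComponents_coordVec, christoffel, partialDeriv_bilinComp hd]
      refine congrArg _ (Finset.sum_congr rfl fun l _ => ?_)
      rw [fderiv_metricRep_symm hy (coordVec l) (coordVec i)]
      ring

/-- Lowering the upper index cancels the inverse metric in `christoffel` and leaves the Koszul
formula. -/
theorem metricRep_lcCoeff {p : M} {y : EuclideanSpace ℝ (Fin n)}
    (hy : y ∈ (extChartAt (𝓡 n) p).target) (i j k : Fin n) :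
    2 * bilRep g.inner p y (lcCoeff g p y (coordVec i) (coordVec j)) (coordVec k) =
      fderiv ℝ (bilRep g.inner p) y (coordVec i) (coordVec j) (coordVec k)
      + fderiv ℝ (bilRep g.inner p) y (coordVec j) (coordVec i) (coordVec k)
      - fderiv ℝ (bilRep g.inner p) y (coordVec k) (coordVec i) (coordVec j) := by
  have hd := differentiableAt_metricRep (g := g) hy
  have h1 : bilRep g.inner p y (lcCoeff g p y (coordVec i) (coordVec j)) (coordVec k) =
      ((metricMatrix g p y).mulVec (fun m => christoffel g p y i j m)) k := by
    conv_lhs => rw [← sum_coordVec (lcCoeff g p y (coordVec i) (coordVec j))]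
    simp only [map_sum, map_smul, sum_apply, smul_apply, smul_eq_mul, lcCoeff,
      ofComponents_coordVec, Matrix.mulVec, dotProduct, metricMatrix, Matrix.of_apply,
      bilinComp_eq]
    refine Finset.sum_congr rfl fun l _ => ?_
    rw [metricRep_symm p y (coordVec l), mul_comm]
  have h2 : (fun m => christoffel g p y i j m) = (1 / 2 : ℝ) • ((metricMatrix g p y)⁻¹.mulVec
      fun l => fderiv ℝ (bilRep g.inner p) y (coordVec i) (coordVec j) (coordVec l)
      + fderiv ℝ (bilRep g.inner p) y (coordVec j) (coordVec i) (coordVec l)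
      - fderiv ℝ (bilRep g.inner p) y (coordVec l) (coordVec i) (coordVec j)) := by
    ext m
    simp only [christoffel, partialDeriv_bilinComp hd, Pi.smul_apply, smul_eq_mul, Matrix.mulVec,
      dotProduct]
  rw [h1, h2, Matrix.mulVec_smul, Matrix.mulVec_mulVec, Matrix.mul_nonsing_inv _
    (isUnit_iff_ne_zero.2 (metricMatrix_det_ne_zero hy)), Matrix.one_mulVec]
  simp

theorem isLeviCivitaOn_lcCoeff (p : M) :
    IsLeviCivitaOn (extChartAt (𝓡 n) p).target (bilRep g.inner p) (lcCoeff g p) where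
  isOpen := isOpen_extChartAt_target p
  G_smooth := contDiffOn_metricRep p
  A_smooth := contDiffOn_ofComponents fun i j k => contDiffOn_christoffel p i j k
  G_symm := fun y _ u v => metricRep_symm p y u v
  G_pos := fun _ hy _ hu => metricRep_pos hy hu
  A_symm := fun _ hy u v => lcCoeff_symm hy u v
  A_metric := by
    intro y hy u v w
    induction u using coord_induction with
    | h0 => simp
    | hadd a b ha hb => simp only [map_add, add_apply, ha, hb]; ring
    | hsmul c a ha => simp only [map_smul, smul_apply, ha, smul_eq_mul]; ring
    | h i =>
      induction v using coord_induction with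
      | h0 => simp
      | hadd a b ha hb => simp only [map_add, add_apply, ha, hb]; ring
      | hsmul c a ha => simp only [map_smul, smul_apply, ha, smul_eq_mul]; ring
      | h j =>
        induction w using coord_induction with
        | h0 => simp
        | hadd a b ha hb => simp only [map_add, ha, hb]; ring
        | hsmul c a ha => simp only [map_smul, ha, smul_eq_mul]; ring
        | h k =>
          -- Metric compatibility is half the sum of the Koszul formulas for (i,j,k) and (i,k,j).
          have h1 := metricRep_lcCoeff (g := g) hy i j k
          have h2 := metricRep_lcCoeff (g := g) hy i k j
          rw [metricRep_symm p y (coordVec j)]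
          have h3 := fderiv_metricRep_symm (g := g) hy (coordVec i) (coordVec j) (coordVec k)
          have h4 := fderiv_metricRep_symm (g := g) hy (coordVec j) (coordVec i) (coordVec k)
          have h5 := fderiv_metricRep_symm (g := g) hy (coordVec k) (coordVec i) (coordVec j)
          linarith

theorem lcCoeff_change (p p' : M) {y : EuclideanSpace ℝ (Fin n)}
    (hy : y ∈ chartOverlap (𝓡 n) p p') (u v : EuclideanSpace ℝ (Fin n)) :
    fderiv ℝ (chartTrans (𝓡 n) p p') y (lcCoeff g p y u v) =
      lcCoeff g p' (chartTrans (𝓡 n) p p' y) (fderiv ℝ (chartTrans (𝓡 n) p p') y u)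
        (fderiv ℝ (chartTrans (𝓡 n) p p') y v)
        + fderiv ℝ (fderiv ℝ (chartTrans (𝓡 n) p p')) y u v :=
  (isLeviCivitaOn_lcCoeff p).change (isLeviCivitaOn_lcCoeff p') (isOpen_chartOverlap p p')
    Set.inter_subset_left (contDiffOn_chartTrans p p') (fun _ h => chartTrans_mem h)
    (fun _ h u v => bilRep_chartTrans _ h u v) hy (surjective_fderiv_chartTrans hy) u v

end LeviCivita

/-! ### Almost-Kähler manifolds in the preferred charts -/

namespace AlmostKahler

variable {n : ℕ} {M : Type*} [TopologicalSpace M] [ChartedSpace (EuclideanSpace ℝ (Fin n)) M]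
  [IsManifold (𝓡 n) ∞ M] (K : AlmostKahler n M)

theorem Om_skew (p : M) (v w : TangentSpace (𝓡 n) p) : K.Om p v w = -K.Om p w v := by
  have h := K.Om_alt p (v + w)
  simp only [map_add, add_apply, K.Om_alt] at h
  linarith

theorem Om_eq (p : M) (v w : TangentSpace (𝓡 n) p) : K.Om p v w = K.g.inner p (K.J p v) w := by
  rw [K.g.symm, K.compat, K.J_sq, map_neg, ← K.Om_skew]

theorem g_J_J (p : M) (v w : TangentSpace (𝓡 n) p) :
    K.g.inner p (K.J p v) (K.J p w) = K.g.inner p v w := by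
  rw [← K.Om_eq, K.compat]

theorem OmRep_eq {p : M} {y : EuclideanSpace ℝ (Fin n)} (hy : y ∈ (extChartAt (𝓡 n) p).target)
    (u v : EuclideanSpace ℝ (Fin n)) :
    bilRep K.Om p y u v = bilRep K.g.inner p y (endRep K.J p y u) v := by
  simp only [bilRep_apply, K.Om_eq, endRep_apply, vecRep, chartField,
    chartDInv_chartD ((extChartAt (𝓡 n) p).map_target hy)]

theorem JRep_sq {p : M} {y : EuclideanSpace ℝ (Fin n)} (hy : y ∈ (extChartAt (𝓡 n) p).target)
    (u : EuclideanSpace ℝ (Fin n)) : endRep K.J p y (endRep K.J p y u) = -u := by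
  rw [endRep_apply K.J p y u, ← vecRep_endRep _ _ hy, vecRep, K.J_sq, map_neg]
  exact congrArg _ (vecRep_chartField (I := 𝓡 n) p u hy)

theorem JRep_orth {p : M} {y : EuclideanSpace ℝ (Fin n)} (hy : y ∈ (extChartAt (𝓡 n) p).target)
    (u v : EuclideanSpace ℝ (Fin n)) :
    bilRep K.g.inner p y (endRep K.J p y u) (endRep K.J p y v) = bilRep K.g.inner p y u v := by
  simp only [bilRep_apply, endRep_apply, vecRep, chartField,
    chartDInv_chartD ((extChartAt (𝓡 n) p).map_target hy), K.g_J_J]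

theorem isAlmostKahlerOn (p : M) :
    IsAlmostKahlerOn (extChartAt (𝓡 n) p).target (bilRep K.g.inner p) (lcCoeff K.g p)
      (endRep K.J p) where
  toIsLeviCivitaOn := isLeviCivitaOn_lcCoeff p
  J_smooth := contDiffOn_endRep K.J_smooth p
  J_sq := fun _ hy u => K.JRep_sq hy u
  J_orth := fun _ hy u v => K.JRep_orth hy u v
  closed := by
    intro y hy u v w
    have hU := isOpen_extChartAt_target (I := 𝓡 n) p
    have hLC := isLeviCivitaOn_lcCoeff (g := K.g) p
    have hG := hLC.G_diff hy
    have hJ := (contDiffOn_endRep K.J_smooth p).differentiableAt_of_isOpen hU hy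
    have hO : DifferentiableAt ℝ (bilRep K.Om p) y :=
      (contDiffOn_bilRep K.Om_smooth p).differentiableAt_of_isOpen hU hy
    have hcl : ∀ u v w, fderiv ℝ (bilRep K.Om p) y u v w + fderiv ℝ (bilRep K.Om p) y v w u
        + fderiv ℝ (bilRep K.Om p) y w u v = 0 := by
      intro u v w
      induction u using coord_induction with
      | h0 => simp
      | hadd a b ha hb => simp only [map_add, add_apply]; linear_combination ha + hb
      | hsmul c a ha => simp only [map_smul, smul_apply, smul_eq_mul]; linear_combination c * ha
      | h i =>
        induction v using coord_induction with
        | h0 => simp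
        | hadd a b ha hb => simp only [map_add, add_apply]; linear_combination ha + hb
        | hsmul c a ha => simp only [map_smul, smul_apply, smul_eq_mul]; linear_combination c * ha
        | h j =>
          induction w using coord_induction with
          | h0 => simp
          | hadd a b ha hb => simp only [map_add, add_apply]; linear_combination ha + hb
          | hsmul c a ha =>
            simp only [map_smul, smul_apply, smul_eq_mul]; linear_combination c * ha
          | h k =>
            have := K.Om_closed p y hy i j k
            simpa only [partialDeriv_bilinComp hO] using this
    -- The derivative of ω is ∇ω plus connection terms. In the cyclic sum the latter cancel, because
    -- A is symmetric and ω is skew; so dω = 0 becomes the cyclic identity for ∇J.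
    have hd : ∀ u v w, fderiv ℝ (bilRep K.Om p) y u v w =
        bilRep K.g.inner p y (covJ (lcCoeff K.g p) (endRep K.J p) y u v) w
        + bilRep K.g.inner p y (endRep K.J p y (lcCoeff K.g p y u v)) w
        + bilRep K.g.inner p y (endRep K.J p y v) (lcCoeff K.g p y u w) := by
      intro u v w
      have e := DFunLike.congr_fun (fderiv_eq_of_eqOn hU (fun z hz => K.OmRep_eq hz v w) hy) u
      rw [fderiv_clm_apply_const (hO.clm_apply (differentiableAt_const _)),
        fderiv_clm_apply_const hO, fderiv_bilin_apply hG (hJ.clm_apply (differentiableAt_const v))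
        (differentiableAt_const w), fderiv_clm_apply_const hJ, hLC.A_metric y hy] at e
      rw [e]
      simp only [covJ_apply, add_apply, sub_apply, mul_apply_eq_comp, map_add, map_sub,
        fderiv_fun_const, Pi.zero_apply, zero_apply, map_zero]
      ring
    have hsk : ∀ u v, bilRep K.g.inner p y (endRep K.J p y u) v =
        -bilRep K.g.inner p y (endRep K.J p y v) u := fun u v => by
      rw [← K.OmRep_eq hy, ← K.OmRep_eq hy]
      exact K.Om_skew _ _ _
    have h := hcl u v w
    rw [hd, hd, hd, hsk (lcCoeff K.g p y u v), hsk (lcCoeff K.g p y v w),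
      hsk (lcCoeff K.g p y w u), hLC.A_symm y hy v u, hLC.A_symm y hy w v,
      hLC.A_symm y hy u w] at h
    linarith

/-- The coefficients of the canonical Hermitian connection in the preferred charts. -/
def hermCoeff (p : M) (y : EuclideanSpace ℝ (Fin n)) :
    EuclideanSpace ℝ (Fin n) →L[ℝ] EuclideanSpace ℝ (Fin n) →L[ℝ] EuclideanSpace ℝ (Fin n) :=
  hermitianCoeff (lcCoeff K.g p) (endRep K.J p) y

theorem isConnectionFamily_hermCoeff : IsConnectionFamily (𝓡 n) K.hermCoeff where
  smooth := fun p => (K.isAlmostKahlerOn p).hermitianCoeff_smooth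
  change := fun p p' _ hy u v =>
    hermitianCoeff_change (isOpen_extChartAt_target p) (isOpen_extChartAt_target p')
      (K.isAlmostKahlerOn p).J_smooth (K.isAlmostKahlerOn p').J_smooth (isOpen_chartOverlap p p')
      Set.inter_subset_left (contDiffOn_chartTrans p p') (fun _ h => chartTrans_mem h)
      (fun _ h u => endRep_chartTrans _ h u) (fun _ h u v => lcCoeff_change p p' h u v) hy u v

/-- The canonical Hermitian connection `∇ - ½ J (∇J)`. -/
def hermitianConnection :
    CovariantDerivative (𝓡 n) (EuclideanSpace ℝ (Fin n)) (fun p : M => TangentSpace (𝓡 n) p) :=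
  K.isConnectionFamily_hermCoeff.covariantDerivative

/-- Commuting with J on vector fields is the statement that J is parallel, which
`covJ_hermitianCoeff` supplies in the chart. -/
theorem isComplexConnection_hermitianConnection :
    IsComplexConnection K.J K.hermitianConnection where
  smooth := K.isConnectionFamily_hermCoeff.covariantDerivative_smooth
  complex_linear := by
    intro Y p v hY
    have hpp : p ∈ (extChartAt (𝓡 n) p).source := mem_extChartAt_source p
    have hy : extChartAt (𝓡 n) p p ∈ (extChartAt (𝓡 n) p).target :=
      (extChartAt (𝓡 n) p).map_source hpp
    have hU := isOpen_extChartAt_target (I := 𝓡 n) p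
    rw [mdifferentiableAt_vecRep hpp] at hY
    have hJ := (K.isAlmostKahlerOn p).J_diff hy
    have e : vecRep (𝓡 n) p (fun q => K.J q (Y q)) =ᶠ[𝓝 (extChartAt (𝓡 n) p p)]
        fun y => endRep K.J p y (vecRep (𝓡 n) p Y y) :=
      Filter.eventually_of_mem (hU.mem_nhds hy) fun z hz => vecRep_endRep _ _ hz
    have hd : DifferentiableAt ℝ (vecRep (𝓡 n) p (fun q => K.J q (Y q))) (extChartAt (𝓡 n) p p) :=
      (hJ.clm_apply hY).congr_of_eventuallyEq e
    have hc := K.isConnectionFamily_hermCoeff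
    apply chartD_injective hpp
    have hJD : ∀ w, chartD (𝓡 n) p p (K.J p w) =
        endRep K.J p (extChartAt (𝓡 n) p p) (chartD (𝓡 n) p p w) := fun w => by
      rw [endRep_apply, vecRep, (extChartAt (𝓡 n) p).left_inv hpp, chartField,
        chartDInv_chartD hpp]
    have h0 := (K.isAlmostKahlerOn p).covJ_hermitianCoeff hy (chartD (𝓡 n) p p v)
      (chartD (𝓡 n) p p (Y p))
    rw [hJD]
    change chartD (𝓡 n) p p (covDerivOf (𝓡 n) K.hermCoeff _ p v) =
      endRep K.J p _ (chartD (𝓡 n) p p (covDerivOf (𝓡 n) K.hermCoeff _ p v))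
    rw [hc.chartD_covDerivOf hpp hd, hc.chartD_covDerivOf hpp hY, e.fderiv_eq,
      fderiv_clm_apply_apply hJ hY, vecRep_extChartAt Y hpp, hJD, map_add]
    rw [covJ_apply] at h0
    simp only [add_apply, sub_apply, mul_apply_eq_comp] at h0
    rw [← sub_eq_zero, ← h0]
    unfold hermCoeff
    abel

end AlmostKahler

/-! ### Curvature in coordinates -/

section CoordinateCurvature

variable {n : ℕ}

/-- The standard basis of `ℝⁿ`. -/
def coordBasis (n : ℕ) : Module.Basis (Fin n) ℝ (EuclideanSpace ℝ (Fin n)) :=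
  (EuclideanSpace.basisFun (Fin n) ℝ).toBasis

theorem coordBasis_apply (i : Fin n) : coordBasis n i = coordVec i := by
  simp [coordBasis, coordVec]

theorem trace_eq_sum_coord (L : EuclideanSpace ℝ (Fin n) →ₗ[ℝ] EuclideanSpace ℝ (Fin n)) :
    LinearMap.trace ℝ _ L = ∑ i, L (coordVec i) i := by
  rw [LinearMap.trace_eq_matrix_trace ℝ (coordBasis n), Matrix.trace]
  refine Finset.sum_congr rfl fun i _ => ?_
  rw [Matrix.diag_apply, LinearMap.toMatrix_apply, coordBasis_apply]
  simp [coordBasis]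

theorem endTrace_eq_sum_coord (L : EuclideanSpace ℝ (Fin n) →L[ℝ] EuclideanSpace ℝ (Fin n)) :
    IsAlmostKahlerOn.endTrace L = ∑ i, L (coordVec i) i :=
  trace_eq_sum_coord (L : EuclideanSpace ℝ (Fin n) →ₗ[ℝ] EuclideanSpace ℝ (Fin n))

theorem curvComp_eq {A : EuclideanSpace ℝ (Fin n) →
      EuclideanSpace ℝ (Fin n) →L[ℝ] EuclideanSpace ℝ (Fin n) →L[ℝ] EuclideanSpace ℝ (Fin n)}
    {y : EuclideanSpace ℝ (Fin n)} (hA : DifferentiableAt ℝ A y) (i j k l : Fin n) :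
    curvComp (fun z i j k => A z (coordVec i) (coordVec j) k) y i j k l =
      localCurv A y (coordVec i) (coordVec j) (coordVec k) l := by
  have h1 : ∀ i j k l, partialDeriv i (fun z => A z (coordVec j) (coordVec k) l) y =
      fderiv ℝ A y (coordVec i) (coordVec j) (coordVec k) l := fun i j k l => by
    have hd : DifferentiableAt ℝ (fun z => A z (coordVec j) (coordVec k)) y :=
      (hA.clm_apply (differentiableAt_const _)).clm_apply (differentiableAt_const _)
    have e := fderiv_clm_apply_apply (L := fun _ => (EuclideanSpace.proj l :
      EuclideanSpace ℝ (Fin n) →L[ℝ] ℝ)) (differentiableAt_const _) hd (coordVec i)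
    rw [fderiv_clm_apply_const (hA.clm_apply (differentiableAt_const _)),
      fderiv_clm_apply_const hA] at e
    rw [partialDeriv]
    simpa using e
  have h2 : ∀ i (w : EuclideanSpace ℝ (Fin n)), A y (coordVec i) w l =
      ∑ m, w m * A y (coordVec i) (coordVec m) l := fun i w => by
    conv_lhs => rw [← sum_coordVec w]
    simp
  simp only [curvComp, h1, localCurv, add_apply, sub_apply, mul_apply_eq_comp, PiLp.add_apply,
    PiLp.sub_apply]
  rw [h2 i (A y (coordVec j) (coordVec k)), h2 j (A y (coordVec i) (coordVec k)),
    Finset.sum_sub_distrib]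

theorem ofComponents_apply_coordVec
    (L : EuclideanSpace ℝ (Fin n) →L[ℝ] EuclideanSpace ℝ (Fin n) →L[ℝ] EuclideanSpace ℝ (Fin n)) :
    ofComponents (fun i j k => L (coordVec i) (coordVec j) k) = L := by
  ext u v k
  induction u using coord_induction with
  | h0 => simp
  | hadd a b ha hb => simp only [map_add, add_apply, PiLp.add_apply, ha, hb]
  | hsmul c a ha => simp only [map_smul, smul_apply, PiLp.smul_apply, ha]
  | h i =>
    induction v using coord_induction with
    | h0 => simp
    | hadd a b ha hb => simp only [map_add, PiLp.add_apply, ha, hb]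
    | hsmul c a ha => simp only [map_smul, PiLp.smul_apply, ha]
    | h j => rw [ofComponents_coordVec]

theorem curvComp_ofComponents {Γ : EuclideanSpace ℝ (Fin n) → Fin n → Fin n → Fin n → ℝ}
    {y : EuclideanSpace ℝ (Fin n)} (hA : DifferentiableAt ℝ (fun z => ofComponents (Γ z)) y)
    (i j k l : Fin n) :
    curvComp Γ y i j k l =
      localCurv (fun z => ofComponents (Γ z)) y (coordVec i) (coordVec j) (coordVec k) l := by
  rw [← curvComp_eq hA]
  simp only [ofComponents_coordVec]

/-- The bilinear form `tr (K F_{uv})`. -/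
def curvTraceForm {E : Type*} [NormedAddCommGroup E] [NormedSpace ℝ E] (K : E →L[ℝ] E)
    (A : E → E →L[ℝ] E →L[ℝ] E) (y : E) : E →ₗ[ℝ] E →ₗ[ℝ] ℝ :=
  LinearMap.mk₂ ℝ (fun u v => IsAlmostKahlerOn.endTrace (K * localCurv A y u v))
    (by
      intro a b c
      rw [← map_add, ← mul_add]
      congr 2
      ext x
      simp [localCurv]
      abel)
    (by
      intro r a c
      rw [← map_smul, ← mul_smul_comm]
      congr 2
      ext x
      simp [localCurv, smul_sub, smul_add])
    (by
      intro a b c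
      rw [← map_add, ← mul_add]
      congr 2
      ext x
      simp [localCurv]
      abel)
    (by
      intro r a c
      rw [← map_smul, ← mul_smul_comm]
      congr 2
      ext x
      simp [localCurv, smul_sub, smul_add])

theorem bilin_expand (B : EuclideanSpace ℝ (Fin n) →ₗ[ℝ] EuclideanSpace ℝ (Fin n) →ₗ[ℝ] ℝ)
    (u v : EuclideanSpace ℝ (Fin n)) :
    B u v = ∑ i, ∑ j, u i * v j * B (coordVec i) (coordVec j) := by
  conv_lhs => rw [← sum_coordVec u, ← sum_coordVec v]
  simp only [map_sum, map_smul, LinearMap.sum_apply, LinearMap.smul_apply, smul_eq_mul,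
    Finset.mul_sum]
  rw [Finset.sum_comm]
  refine Finset.sum_congr rfl fun i _ => Finset.sum_congr rfl fun j _ => ?_
  ring

end CoordinateCurvature

/-! ### The Chern form of a connection in coordinates -/

section ChernForm

variable {n : ℕ} {M : Type*} [TopologicalSpace M] [ChartedSpace (EuclideanSpace ℝ (Fin n)) M]
  [IsManifold (𝓡 n) ∞ M]

/-- The connection coefficients of `D` in the preferred chart at `p`, as a bilinear map. -/
def connRep (D : CovariantDerivative (𝓡 n) (EuclideanSpace ℝ (Fin n))
      (fun p : M => TangentSpace (𝓡 n) p)) (p : M) (y : EuclideanSpace ℝ (Fin n)) :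
    EuclideanSpace ℝ (Fin n) →L[ℝ] EuclideanSpace ℝ (Fin n) →L[ℝ] EuclideanSpace ℝ (Fin n) :=
  ofComponents (connCoeff D p y)

theorem connCoeff_eq (D : CovariantDerivative (𝓡 n) (EuclideanSpace ℝ (Fin n))
      (fun p : M => TangentSpace (𝓡 n) p)) (p : M) (y : EuclideanSpace ℝ (Fin n))
    (i j k : Fin n) :
    connCoeff D p y i j k = chartD (𝓡 n) p ((extChartAt (𝓡 n) p).symm y)
      (D (chartField (𝓡 n) p (coordVec j)) ((extChartAt (𝓡 n) p).symm y)
        (chartField (𝓡 n) p (coordVec i) ((extChartAt (𝓡 n) p).symm y))) k := rfl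

/-- Differentiability of the coefficients lets the componentwise `curvComp` be read as an
operator-valued curvature; bilinear expansion then removes the coordinate vectors. -/
theorem chernForm_apply (J : ∀ p : M, TangentSpace (𝓡 n) p →L[ℝ] TangentSpace (𝓡 n) p)
    (D : CovariantDerivative (𝓡 n) (EuclideanSpace ℝ (Fin n))
      (fun p : M => TangentSpace (𝓡 n) p)) (p : M)
    (hD : DifferentiableAt ℝ (connRep D p) (extChartAt (𝓡 n) p p)) (u v : TangentSpace (𝓡 n) p) :
    chernForm J D p u v = 1 / (4 * Real.pi) * IsAlmostKahlerOn.endTrace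
      (endRep J p (extChartAt (𝓡 n) p p) * localCurv (connRep D p) (extChartAt (𝓡 n) p p)
        (chartD (𝓡 n) p p u) (chartD (𝓡 n) p p v)) := by
  have hpp : p ∈ (extChartAt (𝓡 n) p).source := mem_extChartAt_source p
  have h1 : ∀ i j, chernComp J D p i j = 1 / (4 * Real.pi) * IsAlmostKahlerOn.endTrace
      (endRep J p (extChartAt (𝓡 n) p p) * localCurv (connRep D p) (extChartAt (𝓡 n) p p)
        (coordVec i) (coordVec j)) := by
    intro i j
    rw [chernComp, IsAlmostKahlerOn.endTrace_mul_comm, endTrace_eq_sum_coord, Finset.sum_comm]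
    refine congrArg _ (Finset.sum_congr rfl fun l _ => ?_)
    have hJ : ∀ k, coordCovec p k p (J p (coordField p l p)) =
        endRep J p (extChartAt (𝓡 n) p p) (coordVec l) k := fun k => by
      rw [endRep_apply, vecRep_extChartAt _ hpp]
      rfl
    rw [mul_apply_eq_comp]
    conv_rhs => rw [← sum_coordVec (endRep J p (extChartAt (𝓡 n) p p) (coordVec l))]
    simp only [map_sum, map_smul, hJ]
    rw [WithLp.ofLp_sum, Finset.sum_apply]
    refine Finset.sum_congr rfl fun k _ => ?_
    rw [curvComp_ofComponents hD]
    rfl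
  have h2 := bilin_expand (curvTraceForm (endRep J p (extChartAt (𝓡 n) p p)) (connRep D p)
    (extChartAt (𝓡 n) p p)) (chartD (𝓡 n) p p u) (chartD (𝓡 n) p p v)
  simp only [curvTraceForm, LinearMap.mk₂_apply] at h2
  rw [h2, chernForm]
  simp only [sum_apply, smul_apply, ContinuousLinearMap.smulRight_apply, smul_eq_mul, h1,
    Finset.mul_sum]
  refine Finset.sum_congr rfl fun i _ => Finset.sum_congr rfl fun j _ => ?_
  change _ * (chartD (𝓡 n) p p u i * chartD (𝓡 n) p p v j) = _
  ring

end ChernForm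

theorem IsAlmostKahlerOn.trace_jet {E : Type*} [NormedAddCommGroup E] [NormedSpace ℝ E]
    {U : Set E} {G : E → E →L[ℝ] E →L[ℝ] ℝ} {A : E → E →L[ℝ] E →L[ℝ] E} {J : E → E →L[ℝ] E}
    (h : IsAlmostKahlerOn U G A J) {y : E} (hy : y ∈ U) (u v : E) :
    LinearMap.trace ℝ E ((h.jet hy).J ∘ₗ (h.jet hy).R u v) = endTrace (J y * localCurv A y u v) :=
  rfl

/-! ### The canonical Hermitian connection in coordinates -/

namespace AlmostKahler

section General

variable {n : ℕ} {M : Type*} [TopologicalSpace M] [ChartedSpace (EuclideanSpace ℝ (Fin n)) M]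
  [IsManifold (𝓡 n) ∞ M] (K : AlmostKahler n M)

/-- Coordinate fields are constant in their own chart, so their covariant derivatives contain only
the zeroth-order coefficients. -/
theorem connRep_hermitianConnection {p : M} {y : EuclideanSpace ℝ (Fin n)}
    (hy : y ∈ (extChartAt (𝓡 n) p).target) :
    connRep K.hermitianConnection p y = K.hermCoeff p y := by
  have hq := (extChartAt (𝓡 n) p).map_target hy
  rw [← ofComponents_apply_coordVec (K.hermCoeff p y), connRep]
  congr 1
  ext i j k
  rw [connCoeff_eq]
  have e : vecRep (𝓡 n) p (chartField (𝓡 n) p (coordVec j)) =ᶠ[𝓝 y]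
      fun _ => (coordVec j : EuclideanSpace ℝ (Fin n)) :=
    Filter.eventually_of_mem ((isOpen_extChartAt_target p).mem_nhds hy) fun z hz =>
      vecRep_chartField p _ hz
  have hd : DifferentiableAt ℝ (vecRep (𝓡 n) p (chartField (𝓡 n) p (coordVec j)))
      (extChartAt (𝓡 n) p ((extChartAt (𝓡 n) p).symm y)) := by
    rw [(extChartAt (𝓡 n) p).right_inv hy]
    exact (differentiableAt_const _).congr_of_eventuallyEq e
  have h := K.isConnectionFamily_hermCoeff.chartD_covDerivOf hq hd
    (chartField (𝓡 n) p (coordVec i) ((extChartAt (𝓡 n) p).symm y))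
  change chartD (𝓡 n) p _ (covDerivOf (𝓡 n) K.hermCoeff _ _ _) k = _
  rw [h, (extChartAt (𝓡 n) p).right_inv hy, e.fderiv_eq, chartField, chartField,
    chartD_chartDInv hq, chartD_chartDInv hq]
  simp

theorem contDiffOn_connRep_hermitianConnection (p : M) :
    ContDiffOn ℝ ∞ (connRep K.hermitianConnection p) (extChartAt (𝓡 n) p).target :=
  (K.isConnectionFamily_hermCoeff.smooth p).congr fun _ hy => K.connRep_hermitianConnection hy

theorem localCurv_congr {E : Type*} [NormedAddCommGroup E] [NormedSpace ℝ E]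
    {A B : E → E →L[ℝ] E →L[ℝ] E} {U : Set E} (hU : IsOpen U) (h : ∀ y ∈ U, A y = B y) {y : E}
    (hy : y ∈ U) (u v : E) : localCurv A y u v = localCurv B y u v := by
  rw [localCurv, localCurv, fderiv_eq_of_eqOn hU h hy, h y hy]

/-- The form `-tr (∇_u J ∇_v J)` in the preferred chart at `p`. -/
def nablaJForm (p : M) (y u v : EuclideanSpace ℝ (Fin n)) : ℝ :=
  -IsAlmostKahlerOn.endTrace (covJ (lcCoeff K.g p) (endRep K.J p) y u *
    covJ (lcCoeff K.g p) (endRep K.J p) y v)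

/-- The squared norm of `∇J` in the preferred chart at `p`. -/
def nablaJNormSq (p : M) (y : EuclideanSpace ℝ (Fin n)) : ℝ :=
  ∑ i, ∑ j, (metricMatrix K.g p y)⁻¹ i j * K.nablaJForm p y (coordVec i) (coordVec j)

end General

/-! ### Curvature identities on an almost-Kähler 4-manifold -/

section Dimension4

variable {M : Type*} [TopologicalSpace M] [ChartedSpace (EuclideanSpace ℝ (Fin 4)) M]
  [IsManifold (𝓡 4) ∞ M] (K : AlmostKahler 4 M)

theorem metricAt_det_ne_zero (p : M) : (metricAt K.g p).det ≠ 0 :=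
  metricMatrix_det_ne_zero (mem_extChartAt_target p)

/-- The algebraic data of the almost-Kähler structure at `p`. -/
def jetAt (p : M) : AlmostKahlerJet (EuclideanSpace ℝ (Fin 4)) :=
  (K.isAlmostKahlerOn p).jet (mem_extChartAt_target p)

theorem jetAt_G (p : M) (u v : EuclideanSpace ℝ (Fin 4)) :
    (K.jetAt p).G u v = bilRep K.g.inner p (extChartAt (𝓡 4) p p) u v := rfl

theorem riemannUp_eq (p : M) (i j k l : Fin 4) :
    riemannUp K.g p i j k l = (K.jetAt p).R (coordVec i) (coordVec j) (coordVec k) l :=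
  curvComp_ofComponents ((isLeviCivitaOn_lcCoeff p).A_diff (mem_extChartAt_target p)) i j k l

theorem ricci_eq (p : M) (j k : Fin 4) :
    ricci K.g p j k = LinearMap.trace ℝ _
      (LinearMap.flip ((K.jetAt p).R.flip (coordVec j)) (coordVec k)) := by
  rw [trace_eq_sum_coord, ricci]
  exact Finset.sum_congr rfl fun i _ => K.riemannUp_eq p i j k i

theorem metricAt_eq_gram (p : M) : metricAt K.g p = (K.jetAt p).gram (coordBasis 4) := by
  ext i j
  rw [AlmostKahlerJet.gram, Matrix.of_apply, coordBasis_apply, coordBasis_apply]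
  rfl

theorem formUp_eq (p : M) (i j : Fin 4) :
    K.formUp p i j = (K.jetAt p).formUp (coordBasis 4) i j := by
  rw [formUp, AlmostKahlerJet.formUp, ← metricAt_eq_gram]
  refine Finset.sum_congr rfl fun k _ => Finset.sum_congr rfl fun l _ => ?_
  rw [coordBasis_apply, coordBasis_apply, bilinComp_eq, K.OmRep_eq (mem_extChartAt_target p)]
  rfl

theorem starScalar_eq (p : M) : K.starScalar p = (K.jetAt p).star (coordBasis 4) := by
  rw [starScalar, AlmostKahlerJet.star]
  refine congrArg _ (Finset.sum_congr rfl fun i _ => Finset.sum_congr rfl fun j _ =>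
    Finset.sum_congr rfl fun k _ => Finset.sum_congr rfl fun l _ => ?_)
  rw [formUp_eq, formUp_eq]
  congr 2
  simp only [riemannDown, riemannUp_eq, coordBasis_apply]
  conv_rhs => rw [← sum_coordVec ((K.jetAt p).R (coordVec i) (coordVec j) (coordVec l))]
  simp only [map_sum, map_smul, smul_eq_mul]
  refine Finset.sum_congr rfl fun m _ => ?_
  rw [mul_comm]
  rfl

theorem jetAt_einstein {lam : ℝ} {p : M}
    (h : ∀ j k : Fin 4, ricci K.g p j k = lam * metricAt K.g p j k)
    (v w : EuclideanSpace ℝ (Fin 4)) :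
    LinearMap.trace ℝ _ (LinearMap.flip ((K.jetAt p).R.flip v) w) =
      lam * (K.jetAt p).G v w := by
  have key : ∀ v w : EuclideanSpace ℝ (Fin 4), LinearMap.trace ℝ _
      (LinearMap.flip ((K.jetAt p).R.flip v) w) = ∑ i, (K.jetAt p).R (coordVec i) v w i :=
    fun v w => trace_eq_sum_coord _
  rw [key]
  induction v using coord_induction with
  | h0 => simp
  | hadd a b ha hb =>
    simp only [map_add, LinearMap.add_apply, mul_add, ← ha, ← hb, PiLp.add_apply,
      Finset.sum_add_distrib]
  | hsmul c a ha =>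
    simp only [map_smul, LinearMap.smul_apply, smul_eq_mul, mul_left_comm lam, ← ha,
      PiLp.smul_apply, Finset.mul_sum]
  | h j =>
    induction w using coord_induction with
    | h0 => simp
    | hadd a b ha hb =>
      simp only [map_add, mul_add, ← ha, ← hb, PiLp.add_apply, Finset.sum_add_distrib]
    | hsmul c a ha =>
      simp only [map_smul, smul_eq_mul, mul_left_comm lam, ← ha, PiLp.smul_apply, Finset.mul_sum]
    | h k => rw [← key, ← ricci_eq, h]; rfl

theorem scalarCurvature_eq {lam : ℝ} {p : M}
    (h : ∀ j k : Fin 4, ricci K.g p j k = lam * metricAt K.g p j k) :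
    scalarCurvature K.g p = 4 * lam := by
  have hs : (metricAt K.g p).transpose = metricAt K.g p := by
    ext i j
    exact metricRep_symm p _ _ _
  have h1 : ∑ j, ∑ k, (metricAt K.g p)⁻¹ j k * (metricAt K.g p) j k =
      ((metricAt K.g p)⁻¹ * metricAt K.g p).trace := by
    rw [Matrix.trace]
    refine Finset.sum_congr rfl fun j _ => ?_
    rw [Matrix.diag_apply, Matrix.mul_apply]
    refine Finset.sum_congr rfl fun k _ => ?_
    conv_lhs => rw [← hs, Matrix.transpose_apply, hs]
  rw [Matrix.nonsing_inv_mul _ (isUnit_iff_ne_zero.2 (K.metricAt_det_ne_zero p)),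
    Matrix.trace_one, Fintype.card_fin] at h1
  rw [scalarCurvature]
  calc ∑ j, ∑ k, (metricAt K.g p)⁻¹ j k * ricci K.g p j k
      = lam * ∑ j, ∑ k, (metricAt K.g p)⁻¹ j k * (metricAt K.g p) j k := by
        simp only [h, Finset.mul_sum, mul_left_comm lam]
    _ = 4 * lam := by rw [h1]; push_cast; ring

theorem totalNormSq_jetAt (p : M) :
    (K.jetAt p).totalNormSq (coordBasis 4) = K.nablaJNormSq p (extChartAt (𝓡 4) p p) := by
  rw [AlmostKahlerJet.totalNormSq, nablaJNormSq, ← metricAt_eq_gram]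
  simp only [coordBasis_apply]
  rfl

/-- Besides the lower bound, this serves regularity: along an Einstein metric s⋆ is expressed by ∇J
alone, so its continuity does not require a transformation law for curvature. -/
theorem starScalar_eq_add {lam : ℝ} {p : M}
    (h : ∀ j k : Fin 4, ricci K.g p j k = lam * metricAt K.g p j k) :
    K.starScalar p = 4 * lam + (1 / 2) * K.nablaJNormSq p (extChartAt (𝓡 4) p p) := by
  rw [starScalar_eq, (K.jetAt p).star_eq_scalar_add (by simp) (K.jetAt_einstein h) (coordBasis 4),
    totalNormSq_jetAt]

theorem nablaJForm_nonneg (p : M) (u : EuclideanSpace ℝ (Fin 4)) :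
    0 ≤ K.nablaJForm p (extChartAt (𝓡 4) p p) u u :=
  (K.jetAt p).normSq_nonneg (by simp) u

theorem nablaJForm_le (p : M) (u : EuclideanSpace ℝ (Fin 4)) :
    K.nablaJForm p (extChartAt (𝓡 4) p p) u u ≤
      (1 / 2) * K.nablaJNormSq p (extChartAt (𝓡 4) p p)
        * bilRep K.g.inner p (extChartAt (𝓡 4) p p) u u := by
  rw [← totalNormSq_jetAt]
  exact (K.jetAt p).normSq_le (by simp) (coordBasis 4) u

/-- The identity behind both inequalities. In `endTrace_J_localCurv` with v = Ju the Levi-Civita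
term is ½s⋆|u|² and the correction is -½|∇_uJ|²; the factor 8π is twice the 4π in the normalization
of the Chern form. -/
theorem chernForm_hermitianConnection {lam : ℝ} {p : M}
    (h : ∀ j k : Fin 4, ricci K.g p j k = lam * metricAt K.g p j k) (X : TangentSpace (𝓡 4) p) :
    8 * Real.pi * chernForm K.J K.hermitianConnection p X (K.J p X) =
      K.starScalar p * K.g.inner p X X - K.nablaJForm p (extChartAt (𝓡 4) p p)
        (chartD (𝓡 4) p p X) (chartD (𝓡 4) p p X) := by
  have hpp : p ∈ (extChartAt (𝓡 4) p).source := mem_extChartAt_source p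
  have hy := mem_extChartAt_target (I := 𝓡 4) p
  have hU := isOpen_extChartAt_target (I := 𝓡 4) p
  have hak := K.isAlmostKahlerOn p
  have hd := (K.contDiffOn_connRep_hermitianConnection p).differentiableAt_of_isOpen hU hy
  have hJX : chartD (𝓡 4) p p (K.J p X) =
      endRep K.J p (extChartAt (𝓡 4) p p) (chartD (𝓡 4) p p X) := by
    rw [endRep_apply, vecRep_extChartAt _ hpp, chartField, chartDInv_chartD hpp]
  have hg : K.g.inner p X X = (K.jetAt p).G (chartD (𝓡 4) p p X) (chartD (𝓡 4) p p X) := by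
    rw [jetAt_G, bilRep_apply, (extChartAt (𝓡 4) p).left_inv hpp, chartField,
      chartDInv_chartD hpp]
  rw [chernForm_apply _ _ _ hd, localCurv_congr hU
    (fun y hy => K.connRep_hermitianConnection hy) hy, hJX, hg, starScalar_eq,
    ← (K.jetAt p).trace_J_R_eq (by simp) (K.jetAt_einstein h) (coordBasis 4)]
  set u := chartD (𝓡 4) p p X
  have h1 := hak.endTrace_J_localCurv hy u (endRep K.J p (extChartAt (𝓡 4) p p) u)
  -- From ∇_{Ju}J = -J∇_uJ and anticommutation, J(∇_uJ)(∇_{Ju}J) = -(∇_uJ)².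
  have h2 : endRep K.J p (extChartAt (𝓡 4) p p) * (covJ (lcCoeff K.g p) (endRep K.J p)
      (extChartAt (𝓡 4) p p) u * covJ (lcCoeff K.g p) (endRep K.J p) (extChartAt (𝓡 4) p p)
      (endRep K.J p (extChartAt (𝓡 4) p p) u)) = -(covJ (lcCoeff K.g p) (endRep K.J p)
      (extChartAt (𝓡 4) p p) u * covJ (lcCoeff K.g p) (endRep K.J p) (extChartAt (𝓡 4) p p) u) := by
    ext1 w
    have h3 : covJ (lcCoeff K.g p) (endRep K.J p) (extChartAt (𝓡 4) p p)
        (endRep K.J p (extChartAt (𝓡 4) p p) u) w =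
        -endRep K.J p (extChartAt (𝓡 4) p p) (covJ (lcCoeff K.g p) (endRep K.J p)
          (extChartAt (𝓡 4) p p) u w) := (K.jetAt p).Q_J_left u w
    simp only [mul_apply_eq_comp, neg_apply, h3, map_neg, hak.covJ_J hy, hak.J_sq _ hy, neg_neg]
  have h4 : IsAlmostKahlerOn.endTrace (endRep K.J p (extChartAt (𝓡 4) p p) *
      localCurv (lcCoeff K.g p) (extChartAt (𝓡 4) p p) u
        (endRep K.J p (extChartAt (𝓡 4) p p) u)) =
      LinearMap.trace ℝ _ ((K.jetAt p).J ∘ₗ (K.jetAt p).R u ((K.jetAt p).J u)) :=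
    (hak.trace_jet hy u _).symm
  rw [h2, map_neg] at h1
  have hpi := Real.pi_ne_zero
  rw [← h4, nablaJForm]
  change 8 * Real.pi * (1 / (4 * Real.pi) * IsAlmostKahlerOn.endTrace
    (endRep K.J p (extChartAt (𝓡 4) p p) * localCurv (hermitianCoeff (lcCoeff K.g p)
      (endRep K.J p)) _ _ _)) = _
  rw [h1]
  field_simp
  ring

end Dimension4

end AlmostKahler

/-! ### Invariance of the norm of `∇J` -/

section Congruence

variable {n : ℕ}

/-- The Gram matrix of a bilinear form on `ℝⁿ`. -/
def coordMatrix (B : EuclideanSpace ℝ (Fin n) →ₗ[ℝ] EuclideanSpace ℝ (Fin n) →ₗ[ℝ] ℝ) :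
    Matrix (Fin n) (Fin n) ℝ :=
  Matrix.of fun i j => B (coordVec i) (coordVec j)

/-- The matrix of an endomorphism of `ℝⁿ`. -/
def endMatrix (P : EuclideanSpace ℝ (Fin n) →L[ℝ] EuclideanSpace ℝ (Fin n)) :
    Matrix (Fin n) (Fin n) ℝ :=
  Matrix.of fun i j => P (coordVec j) i

theorem coordMatrix_congr {B B' : EuclideanSpace ℝ (Fin n) →ₗ[ℝ] EuclideanSpace ℝ (Fin n) →ₗ[ℝ] ℝ}
    {P : EuclideanSpace ℝ (Fin n) →L[ℝ] EuclideanSpace ℝ (Fin n)}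
    (h : ∀ u v, B u v = B' (P u) (P v)) :
    coordMatrix B = (endMatrix P).transpose * coordMatrix B' * endMatrix P := by
  ext i j
  simp only [coordMatrix, Matrix.of_apply, h, Matrix.mul_apply, Matrix.transpose_apply, endMatrix]
  rw [bilin_expand B', Finset.sum_comm]
  refine Finset.sum_congr rfl fun k _ => ?_
  rw [Finset.sum_mul]
  refine Finset.sum_congr rfl fun l _ => ?_
  ring

/-- The double sum is the trace of G⁻¹Nᵀ, and simultaneous congruence of G and N conjugates that
product. -/
theorem sum_inv_mul_congr {G N G' N' A : Matrix (Fin n) (Fin n) ℝ}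
    (hG : G = A.transpose * G' * A) (hN : N = A.transpose * N' * A) (hdet : G.det ≠ 0) :
    ∑ i, ∑ j, G⁻¹ i j * N i j = ∑ i, ∑ j, G'⁻¹ i j * N' i j := by
  have tr : ∀ X Y : Matrix (Fin n) (Fin n) ℝ,
      ∑ i, ∑ j, X i j * Y i j = (X * Y.transpose).trace := fun X Y => by
    simp only [Matrix.trace, Matrix.diag_apply, Matrix.mul_apply, Matrix.transpose_apply]
  have hA : IsUnit A.det := by
    refine isUnit_iff_ne_zero.2 fun h => hdet ?_
    rw [hG, Matrix.det_mul, h, mul_zero]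
  have hA' : IsUnit A.transpose.det := by rwa [Matrix.det_transpose]
  rw [tr, tr, hG, hN, Matrix.mul_inv_rev, Matrix.mul_inv_rev, Matrix.transpose_mul,
    Matrix.transpose_mul, Matrix.transpose_transpose, Matrix.mul_assoc, Matrix.mul_assoc,
    Matrix.nonsing_inv_mul_cancel_left _ _ hA', Matrix.trace_mul_comm, Matrix.mul_assoc,
    Matrix.mul_assoc, Matrix.mul_nonsing_inv _ hA, Matrix.mul_one]

end Congruence

theorem endTrace_eq_of_conj {E : Type*} [NormedAddCommGroup E] [NormedSpace ℝ E]
    {a a' P Q : E →L[ℝ] E} (hPQ : P * Q = 1) (hQP : Q * P = 1) (h : P * a = a' * P) :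
    IsAlmostKahlerOn.endTrace a = IsAlmostKahlerOn.endTrace a' := by
  calc IsAlmostKahlerOn.endTrace a = IsAlmostKahlerOn.endTrace (Q * (P * a)) := by
        rw [← mul_assoc, hQP, one_mul]
    _ = IsAlmostKahlerOn.endTrace (a' * (P * Q)) := by
        rw [h, IsAlmostKahlerOn.endTrace_mul_comm, mul_assoc]
    _ = IsAlmostKahlerOn.endTrace a' := by rw [hPQ, mul_one]

/-! ### Chart independence and continuity of ∇J and its norm -/

namespace AlmostKahler

variable {n : ℕ} {M : Type*} [TopologicalSpace M] [ChartedSpace (EuclideanSpace ℝ (Fin n)) M]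
  [IsManifold (𝓡 n) ∞ M] (K : AlmostKahler n M)

theorem covJ_chartTrans {p p' : M} {y : EuclideanSpace ℝ (Fin n)}
    (hy : y ∈ chartOverlap (𝓡 n) p p') (u v : EuclideanSpace ℝ (Fin n)) :
    fderiv ℝ (chartTrans (𝓡 n) p p') y (covJ (lcCoeff K.g p) (endRep K.J p) y u v) =
      covJ (lcCoeff K.g p') (endRep K.J p') (chartTrans (𝓡 n) p p' y)
        (fderiv ℝ (chartTrans (𝓡 n) p p') y u) (fderiv ℝ (chartTrans (𝓡 n) p p') y v) :=
  covJ_change (isOpen_extChartAt_target p) (isOpen_extChartAt_target p')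
    (K.isAlmostKahlerOn p).J_smooth (K.isAlmostKahlerOn p').J_smooth (isOpen_chartOverlap p p')
    Set.inter_subset_left (contDiffOn_chartTrans p p') (fun _ h => chartTrans_mem h)
    (fun _ h u => endRep_chartTrans _ h u) (fun _ h u v => lcCoeff_change p p' h u v) hy u v

theorem nablaJForm_chartTrans {p p' : M} {y : EuclideanSpace ℝ (Fin n)}
    (hy : y ∈ chartOverlap (𝓡 n) p p') (u v : EuclideanSpace ℝ (Fin n)) :
    K.nablaJForm p y u v = K.nablaJForm p' (chartTrans (𝓡 n) p p' y)
      (fderiv ℝ (chartTrans (𝓡 n) p p') y u) (fderiv ℝ (chartTrans (𝓡 n) p p') y v) := by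
  set q := (extChartAt (𝓡 n) p).symm y
  have hq : q ∈ (extChartAt (𝓡 n) p).source := (extChartAt (𝓡 n) p).map_target hy.1
  set P := fderiv ℝ (chartTrans (𝓡 n) p p') y
  let Q : EuclideanSpace ℝ (Fin n) →L[ℝ] EuclideanSpace ℝ (Fin n) :=
    chartD (𝓡 n) p q ∘L chartDInv (𝓡 n) p' q
  have hPQ : P * Q = 1 := by
    ext1 w
    exact (fderiv_chartTrans' hy _).trans (chartD_chartDInv hy.2 w)
  have hQP : Q * P = 1 := by
    ext1 w
    change chartD (𝓡 n) p q (chartDInv (𝓡 n) p' q (P w)) = w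
    rw [chartDInv_fderiv_chartTrans hy]
    exact chartD_chartDInv hq w
  set a := covJ (lcCoeff K.g p) (endRep K.J p) y u * covJ (lcCoeff K.g p) (endRep K.J p) y v
  set a' := covJ (lcCoeff K.g p') (endRep K.J p') (chartTrans (𝓡 n) p p' y) (P u) *
    covJ (lcCoeff K.g p') (endRep K.J p') (chartTrans (𝓡 n) p p' y) (P v)
  have ha : P * a = a' * P := by
    ext1 w
    simp only [a, a', mul_apply_eq_comp, P, K.covJ_chartTrans hy]
  rw [nablaJForm, nablaJForm, endTrace_eq_of_conj hPQ hQP ha]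

/-- `nablaJForm` as a bilinear map. -/
def nablaJBilin (p : M) (y : EuclideanSpace ℝ (Fin n)) :
    EuclideanSpace ℝ (Fin n) →ₗ[ℝ] EuclideanSpace ℝ (Fin n) →ₗ[ℝ] ℝ :=
  LinearMap.mk₂ ℝ (K.nablaJForm p y)
    (by intros; simp only [nablaJForm, map_add, add_mul]; ring)
    (by intros; simp only [nablaJForm, map_smul, smul_mul_assoc, smul_eq_mul]; ring)
    (by intros; simp only [nablaJForm, map_add, mul_add]; ring)
    (by intros; simp only [nablaJForm, map_smul, mul_smul_comm, smul_eq_mul]; ring)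

theorem nablaJNormSq_chartTrans {p p' : M} {y : EuclideanSpace ℝ (Fin n)}
    (hy : y ∈ chartOverlap (𝓡 n) p p') :
    K.nablaJNormSq p y = K.nablaJNormSq p' (chartTrans (𝓡 n) p p' y) := by
  let G : M → EuclideanSpace ℝ (Fin n) →
      EuclideanSpace ℝ (Fin n) →ₗ[ℝ] EuclideanSpace ℝ (Fin n) →ₗ[ℝ] ℝ := fun p y =>
    LinearMap.mk₂ ℝ (fun u v => bilRep K.g.inner p y u v) (by simp) (by simp) (by simp) (by simp)
  exact sum_inv_mul_congr (coordMatrix_congr (B := G p y) (B' := G p' (chartTrans (𝓡 n) p p' y))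
    fun u v => bilRep_chartTrans K.g.inner hy u v)
    (coordMatrix_congr (B := K.nablaJBilin p y) (B' := K.nablaJBilin p' (chartTrans (𝓡 n) p p' y))
    fun u v => K.nablaJForm_chartTrans hy u v) (metricMatrix_det_ne_zero hy.1)

theorem nablaJForm_extChartAt {p q : M} (hq : q ∈ (extChartAt (𝓡 n) p).source)
    (u v : TangentSpace (𝓡 n) q) :
    K.nablaJForm q (extChartAt (𝓡 n) q q) (chartD (𝓡 n) q q u) (chartD (𝓡 n) q q v) =
      K.nablaJForm p (extChartAt (𝓡 n) p q) (chartD (𝓡 n) p q u) (chartD (𝓡 n) p q v) := by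
  have hqq := mem_extChartAt_source (I := 𝓡 n) q
  rw [K.nablaJForm_chartTrans (mem_chartOverlap hqq hq), fderiv_chartTrans hqq hq,
    fderiv_chartTrans hqq hq, chartTrans_extChartAt hqq]

/-- Pointwise quantities at q are defined in the preferred chart at q, which need not vary
continuously with q. Passing to one fixed chart p is what makes their continuity accessible. -/
theorem nablaJNormSq_extChartAt {p q : M} (hq : q ∈ (extChartAt (𝓡 n) p).source) :
    K.nablaJNormSq q (extChartAt (𝓡 n) q q) = K.nablaJNormSq p (extChartAt (𝓡 n) p q) := by
  have hqq := mem_extChartAt_source (I := 𝓡 n) q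
  rw [K.nablaJNormSq_chartTrans (mem_chartOverlap hqq hq), chartTrans_extChartAt hqq]

theorem nablaJForm_continuousOn {X : Type*} [TopologicalSpace X] {W : Set X} {p : M}
    {f u v : X → EuclideanSpace ℝ (Fin n)} (hf : ContinuousOn f W)
    (hfW : Set.MapsTo f W (extChartAt (𝓡 n) p).target) (hu : ContinuousOn u W)
    (hv : ContinuousOn v W) : ContinuousOn (fun x => K.nablaJForm p (f x) (u x) (v x)) W := by
  have h := (K.isAlmostKahlerOn p).covJ_smooth.continuousOn.comp hf hfW
  exact (endTraceL.continuous.comp_continuousOn ((h.clm_apply hu).mul (h.clm_apply hv))).neg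

theorem nablaJNormSq_continuousOn (p : M) :
    ContinuousOn (K.nablaJNormSq p) (extChartAt (𝓡 n) p).target := by
  unfold nablaJNormSq
  refine continuousOn_finsetSum _ fun i _ => continuousOn_finsetSum _ fun j _ => ContinuousOn.mul ?_ ?_
  · exact (contDiffOn_matrix_inv (fun i j => contDiffOn_bilinComp p i j)
      (fun y hy => metricMatrix_det_ne_zero hy) i j).continuousOn
  · exact K.nablaJForm_continuousOn continuousOn_id (Set.mapsTo_id _) continuousOn_const
      continuousOn_const

end AlmostKahler

/-! ### Maps between manifolds in the preferred charts -/

section MapRep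

variable {E : Type*} [NormedAddCommGroup E] [NormedSpace ℝ E]
  {H : Type*} [TopologicalSpace H] {I : ModelWithCorners ℝ E H} [I.Boundaryless]
  {M : Type*} [TopologicalSpace M] [ChartedSpace H M] [IsManifold I ∞ M]
  {E' : Type*} [NormedAddCommGroup E'] [NormedSpace ℝ E']
  {H' : Type*} [TopologicalSpace H'] {I' : ModelWithCorners ℝ E' H'} [I'.Boundaryless]
  {N : Type*} [TopologicalSpace N] [ChartedSpace H' N] [IsManifold I' ∞ N]

theorem mdifferentiableAt_extChartAt_symm {p : M} {z : E} (hz : z ∈ (extChartAt I p).target) :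
    MDifferentiableAt 𝓘(ℝ, E) I (extChartAt I p).symm z :=
  ((contMDiffOn_extChartAt_symm (I := I) (n := ∞) p).contMDiffAt
    ((isOpen_extChartAt_target p).mem_nhds hz)).mdifferentiableAt (by simp)

theorem mfderiv_extChartAt_symm {p : M} {z : E} (hz : z ∈ (extChartAt I p).target) (w : E) :
    mfderiv 𝓘(ℝ, E) I (extChartAt I p).symm z w = chartDInv I p ((extChartAt I p).symm z) w := by
  have hq := (extChartAt I p).map_target hz
  apply chartD_injective hq
  rw [chartD_chartDInv hq]
  have h := mfderiv_comp_apply z (mdifferentiableAt_extChartAt_source hq)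
    (mdifferentiableAt_extChartAt_symm hz) w
  have e : (extChartAt I p ∘ (extChartAt I p).symm) =ᶠ[𝓝 z] id :=
    Filter.eventually_of_mem ((isOpen_extChartAt_target p).mem_nhds hz) fun y hy =>
      (extChartAt I p).right_inv hy
  rw [e.mfderiv_eq, mfderiv_id] at h
  exact h.symm

variable (I I') in
/-- A map `f` in the preferred charts at `x` and `p`. -/
def mapRep (f : N → M) (x : N) (p : M) (z : E') : E :=
  extChartAt I p (f ((extChartAt I' x).symm z))

variable (I I') in
/-- The domain of `mapRep`. -/
def mapDomain (f : N → M) (x : N) (p : M) : Set E' :=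
  (extChartAt I' x).target ∩ (extChartAt I' x).symm ⁻¹' (f ⁻¹' (extChartAt I p).source)

theorem isOpen_mapDomain {f : N → M} (hf : Continuous f) (x : N) (p : M) :
    IsOpen (mapDomain I I' f x p) :=
  (continuousOn_extChartAt_symm x).isOpen_inter_preimage (isOpen_extChartAt_target x)
    ((isOpen_extChartAt_source p).preimage hf)

theorem mapRep_mem {f : N → M} {x : N} {p : M} {z : E'} (hz : z ∈ mapDomain I I' f x p) :
    mapRep I I' f x p z ∈ (extChartAt I p).target :=
  (extChartAt I p).map_source hz.2

theorem contDiffOn_mapRep {f : N → M} (hf : ContMDiff I' I ∞ f) (x : N) (p : M) :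
    ContDiffOn ℝ ∞ (mapRep I I' f x p) (mapDomain I I' f x p) := by
  have h : ContMDiffOn 𝓘(ℝ, E') 𝓘(ℝ, E) ∞ (mapRep I I' f x p) (mapDomain I I' f x p) := by
    refine (contMDiffOn_extChartAt (I := I) (n := ∞) (x := p)).comp
      (hf.comp_contMDiffOn ((contMDiffOn_extChartAt_symm (I := I') (n := ∞) x).mono
        Set.inter_subset_left)) fun z hz => ?_
    simpa using hz.2
  exact contMDiffOn_iff_contDiffOn.1 h

theorem fderiv_mapRep {f : N → M} (hf : ContMDiff I' I ∞ f) {x : N} {p : M} {z : E'}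
    (hz : z ∈ mapDomain I I' f x p) (w : E') :
    fderiv ℝ (mapRep I I' f x p) z w = chartD I p (f ((extChartAt I' x).symm z))
      (mfderiv I' I f ((extChartAt I' x).symm z) (chartDInv I' x ((extChartAt I' x).symm z) w)) := by
  have hf' : MDifferentiableAt I' I f ((extChartAt I' x).symm z) :=
    (hf _).mdifferentiableAt (by simp)
  have h1 := mfderiv_comp_apply z hf' (mdifferentiableAt_extChartAt_symm hz.1) w
  have h2 := mfderiv_comp_apply (I := 𝓘(ℝ, E')) z (f := f ∘ (extChartAt I' x).symm)
    (mdifferentiableAt_extChartAt_source hz.2)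
    (hf'.comp z (mdifferentiableAt_extChartAt_symm hz.1)) w
  rw [h1, mfderiv_extChartAt_symm hz.1] at h2
  rw [← mfderiv_eq_fderiv]
  exact h2

variable (I) in
/-- The expression of a field of covectors in the preferred chart at `p`. -/
def covecRep (α : ∀ q : M, TangentSpace I q →L[ℝ] ℝ) (p : M) (y : E) : E →L[ℝ] ℝ :=
  (α ((extChartAt I p).symm y)).comp (chartDInv I p ((extChartAt I p).symm y))

theorem covecRep_apply (α : ∀ q : M, TangentSpace I q →L[ℝ] ℝ) (p : M) (y u : E) :
    covecRep I α p y u = α ((extChartAt I p).symm y)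
      (chartDInv I p ((extChartAt I p).symm y) u) := rfl

/-- The pull-back of a field of covectors. -/
def pullbackCovec (f : N → M) (α : ∀ q : M, TangentSpace I q →L[ℝ] ℝ) (x : N) :
    TangentSpace I' x →L[ℝ] ℝ :=
  (α (f x)).comp (mfderiv I' I f x)

theorem covecRep_pullbackCovec {f : N → M} (hf : ContMDiff I' I ∞ f)
    (α : ∀ q : M, TangentSpace I q →L[ℝ] ℝ) {x : N} {p : M} {z : E'}
    (hz : z ∈ mapDomain I I' f x p) :
    covecRep I' (pullbackCovec f α) x z =
      (covecRep I α p (mapRep I I' f x p z)).comp (fderiv ℝ (mapRep I I' f x p) z) := by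
  ext1 w
  rw [ContinuousLinearMap.comp_apply, fderiv_mapRep hf hz, covecRep_apply, covecRep_apply, mapRep,
    (extChartAt I p).left_inv hz.2, chartDInv_chartD hz.2]
  rfl

theorem covecRep_chartTrans (α : ∀ q : M, TangentSpace I q →L[ℝ] ℝ) {p p' : M} {y : E}
    (hy : y ∈ chartOverlap I p p') :
    covecRep I α p y = (covecRep I α p' (chartTrans I p p' y)).comp
      (fderiv ℝ (chartTrans I p p') y) := by
  ext1 u
  rw [ContinuousLinearMap.comp_apply, covecRep_apply, covecRep_apply, symm_chartTrans hy,
    chartDInv_fderiv_chartTrans hy]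

end MapRep

/-! ### Holomorphic charts -/

section HolomorphicCharts

variable {S : Type*} [TopologicalSpace S] [ChartedSpace ℂ S] [IsManifold 𝓘(ℂ, ℂ) ω S]

/-- Transition maps are holomorphic, so their real derivative is the restriction of a complex-linear
map. -/
theorem fderiv_chartTrans_mul {x y : S} {z : ℂ} (hz : z ∈ chartOverlap 𝓘(ℝ, ℂ) x y) (w : ℂ) :
    fderiv ℝ (chartTrans 𝓘(ℝ, ℂ) x y) z w = w * fderiv ℝ (chartTrans 𝓘(ℝ, ℂ) x y) z 1 := by
  have h := contDiffOn_ext_coord_change (I := 𝓘(ℂ, ℂ)) (n := ω) y x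
  have hd : DifferentiableAt ℂ (chartTrans 𝓘(ℝ, ℂ) x y) z := by
    refine (h.contDiffAt (x := z) ?_).differentiableAt (by simp)
    refine Filter.mem_of_superset ((isOpen_chartOverlap x y).mem_nhds hz) fun a ha => ?_
    simpa [chartOverlap] using ha
  rw [hd.fderiv_restrictScalars ℝ]
  simp

/-- `surfaceJ` is defined through the preferred chart at q itself; complex linearity of the
transition maps makes it multiplication by i in every preferred chart around q. -/
theorem surfaceJ_chartDInv {x q : S} (hq : q ∈ (extChartAt 𝓘(ℝ, ℂ) x).source) (w : ℂ) :
    surfaceJ q (chartDInv 𝓘(ℝ, ℂ) x q w) = chartDInv 𝓘(ℝ, ℂ) x q (Complex.I * w) := by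
  have hqq : q ∈ (extChartAt 𝓘(ℝ, ℂ) q).source := mem_extChartAt_source q
  have hz := mem_chartOverlap hq hqq
  have h : ∀ w, chartD 𝓘(ℝ, ℂ) q q (chartDInv 𝓘(ℝ, ℂ) x q w) =
      fderiv ℝ (chartTrans 𝓘(ℝ, ℂ) x q) (extChartAt 𝓘(ℝ, ℂ) x q) w := fun w => by
    rw [← fderiv_chartTrans hq hqq, chartD_chartDInv hq]
  apply chartD_injective hqq
  change chartD 𝓘(ℝ, ℂ) q q (chartDInv 𝓘(ℝ, ℂ) q q
    (Complex.I * chartD 𝓘(ℝ, ℂ) q q (chartDInv 𝓘(ℝ, ℂ) x q w))) = _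
  rw [chartD_chartDInv hqq, h, h, fderiv_chartTrans_mul hz w,
    fderiv_chartTrans_mul hz (Complex.I * w), mul_assoc]

end HolomorphicCharts

/-! ### Stokes' theorem in the plane -/

section Plane

open MeasureTheory

/-- The coefficient `∂_a θ_b - ∂_b θ_a` of the exterior derivative of a `1`-form on the plane. -/
def planeCurl (θ : ℂ → ℂ →L[ℝ] ℝ) (z : ℂ) : ℝ :=
  fderiv ℝ θ z 1 Complex.I - fderiv ℝ θ z Complex.I 1

/-- Integration by parts against the constant function 1. -/
theorem integral_fderiv_eq_zero {f : ℂ → ℝ} (hf : ContDiff ℝ ∞ f) (hc : HasCompactSupport f)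
    (v : ℂ) : ∫ z, fderiv ℝ f z v = 0 := by
  have hd : Continuous fun z => fderiv ℝ f z v :=
    (hf.continuous_fderiv (by simp)).clm_apply continuous_const
  have hi : Integrable fun z => fderiv ℝ f z v :=
    hd.integrable_of_hasCompactSupport (hc.fderiv_apply ℝ v)
  have h := integral_bilinear_hasLineDerivAt_right_eq_neg_left_of_integrable (μ := volume)
    (f := fun _ : ℂ => (1 : ℝ)) (f' := fun _ => 0) (g := f) (g' := fun z => fderiv ℝ f z v) (v := v)
    (B := ContinuousLinearMap.mul ℝ ℝ) (by simp) (by simpa using hi)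
    (by simpa using hf.continuous.integrable_of_hasCompactSupport hc)
    (fun x _ => by simpa using (hasFDerivAt_const (1 : ℝ) x).hasLineDerivAt v)
    (fun x _ => ((hf.differentiable (by simp)) x).hasFDerivAt.hasLineDerivAt v)
  simpa using h

theorem integral_planeCurl_eq_zero {θ : ℂ → ℂ →L[ℝ] ℝ} (hθ : ContDiff ℝ ∞ θ)
    (hc : HasCompactSupport θ) : ∫ z, planeCurl θ z = 0 := by
  have hs : ∀ w, ContDiff ℝ ∞ fun z => θ z w := fun w => hθ.clm_apply contDiff_const
  have hsc : ∀ w, HasCompactSupport fun z => θ z w := fun w =>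
    hc.comp_left (g := fun L : ℂ →L[ℝ] ℝ => L w) (by simp)
  have e : ∀ u w z, fderiv ℝ θ z u w = fderiv ℝ (fun z => θ z w) z u := fun u w z =>
    (fderiv_clm_apply_const ((hθ.differentiable (by simp)) z) w u).symm
  have hi : ∀ u w, Integrable fun z => fderiv ℝ (fun z => θ z w) z u := fun u w =>
    (((hs w).continuous_fderiv (by simp)).clm_apply
      continuous_const).integrable_of_hasCompactSupport ((hsc w).fderiv_apply ℝ u)
  simp only [planeCurl, e]
  rw [integral_sub (hi _ _) (hi _ _), integral_fderiv_eq_zero (hs _) (hsc _),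
    integral_fderiv_eq_zero (hs _) (hsc _), sub_zero]

theorem planeCurl_congr {θ θ' : ℂ → ℂ →L[ℝ] ℝ} {z : ℂ} (h : θ =ᶠ[𝓝 z] θ') :
    planeCurl θ z = planeCurl θ' z := by
  rw [planeCurl, planeCurl, h.fderiv_eq]

theorem planeCurl_eq_zero {θ : ℂ → ℂ →L[ℝ] ℝ} {z : ℂ} (h : ∀ᶠ w in 𝓝 z, θ w = 0) :
    planeCurl θ z = 0 := by
  have h' : θ =ᶠ[𝓝 z] fun _ => 0 := h
  rw [planeCurl, h'.fderiv_eq]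
  simp

/-- Extension by zero is smooth on the whole plane, since θ vanishes on U outside the compact set K;
the global statement then applies. -/
theorem setIntegral_planeCurl_eq_zero {θ : ℂ → ℂ →L[ℝ] ℝ} {U K : Set ℂ} (hU : IsOpen U)
    (hK : IsCompact K) (hKU : K ⊆ U) (hθ : ContDiffOn ℝ ∞ θ U) (h0 : ∀ z ∈ U, z ∉ K → θ z = 0) :
    ∫ z in U, planeCurl θ z = 0 := by
  classical
  have h1 : ∀ z ∈ U, U.indicator θ =ᶠ[𝓝 z] θ := fun z hz =>
    Filter.eventually_of_mem (hU.mem_nhds hz) fun w hw => Set.indicator_of_mem hw _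
  have h2 : ∀ z, z ∉ K → U.indicator θ z = 0 := fun z hz => by
    by_cases hzU : z ∈ U
    · rw [Set.indicator_of_mem hzU, h0 z hzU hz]
    · exact Set.indicator_of_notMem hzU _
  have h3 : ∀ z, z ∉ K → ∀ᶠ w in 𝓝 z, U.indicator θ w = 0 := fun z hz =>
    Filter.eventually_of_mem (hK.isClosed.isOpen_compl.mem_nhds hz) h2
  have hs : ContDiff ℝ ∞ (U.indicator θ) := by
    refine contDiff_iff_contDiffAt.2 fun z => ?_
    by_cases hz : z ∈ U
    · exact (hθ.contDiffAt (hU.mem_nhds hz)).congr_of_eventuallyEq (h1 z hz)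
    · exact (contDiffAt_const (c := 0)).congr_of_eventuallyEq (h3 z fun h => hz (hKU h))
  rw [← integral_planeCurl_eq_zero hs (HasCompactSupport.intro hK h2),
    ← setIntegral_eq_integral_of_forall_compl_eq_zero (s := U)
      fun z hz => planeCurl_eq_zero (h3 z fun h => hz (hKU h))]
  exact setIntegral_congr_fun hU.measurableSet fun z hz => (planeCurl_congr (h1 z hz)).symm

theorem integrableOn_of_compact_support {f : ℂ → ℝ} {U K : Set ℂ} (hU : IsOpen U)
    (hK : IsCompact K) (hKU : K ⊆ U) (hf : ContinuousOn f U) (h0 : ∀ z ∈ U, z ∉ K → f z = 0) :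
    IntegrableOn f U :=
  ((hf.mono hKU).integrableOn_compact hK).of_forall_sdiff_eq_zero hU.measurableSet
    fun z hz => h0 z hz.1 hz.2

theorem continuousOn_planeCurl {θ : ℂ → ℂ →L[ℝ] ℝ} {U : Set ℂ} (hU : IsOpen U)
    (hθ : ContDiffOn ℝ ∞ θ U) : ContinuousOn (planeCurl θ) U := by
  have h := (hθ.fderiv_smooth hU).continuousOn
  exact ((h.clm_apply continuousOn_const).clm_apply continuousOn_const).sub
    ((h.clm_apply continuousOn_const).clm_apply continuousOn_const)

/-- Multiplication by c has real determinant |c|². Being nonnegative, it lets the signed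
transformation law of 2-forms match the absolute Jacobian of the change-of-variables formula. -/
theorem det_of_mul {P : ℂ →L[ℝ] ℂ} (hP : ∀ w, P w = w * P 1) : P.det = Complex.normSq (P 1) := by
  have h : (P : ℂ →ₗ[ℝ] ℂ) = LinearMap.mulLeft ℝ (P 1) := by
    ext1 w
    simpa [mul_comm] using hP w
  rw [ContinuousLinearMap.det, h, ← Algebra.norm_complex_apply]
  rfl

/-- The exterior derivative under a holomorphic change of variables. -/
theorem planeCurl_pullback {θ θ' : ℂ → ℂ →L[ℝ] ℝ} {τ : ℂ → ℂ} {W : Set ℂ} (hW : IsOpen W)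
    (hτ : ContDiffOn ℝ ∞ τ W) (h : ∀ z ∈ W, θ z = (θ' (τ z)).comp (fderiv ℝ τ z)) {z : ℂ}
    (hz : z ∈ W) (hθ : DifferentiableAt ℝ θ' (τ z))
    (hP : ∀ w, fderiv ℝ τ z w = w * fderiv ℝ τ z 1) :
    planeCurl θ z = |(fderiv ℝ τ z).det| * planeCurl θ' (τ z) := by
  rw [det_of_mul hP, abs_of_nonneg (Complex.normSq_nonneg _), planeCurl,
    fderiv_eq_of_eqOn hW h hz, fderiv_pullback_antisymm hW hτ hz hθ, hP Complex.I, planeCurl,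
    Complex.normSq_apply]
  set c := fderiv ℝ τ z 1
  have h1 : c = c.re • (1 : ℂ) + c.im • Complex.I := by
    apply Complex.ext <;> simp
  have h2 : Complex.I * c = c.re • Complex.I - c.im • (1 : ℂ) := by
    apply Complex.ext <;> simp
  have h3 : ∀ L : ℂ →L[ℝ] ℝ, L c = c.re * L 1 + c.im * L Complex.I := fun L => by
    conv_lhs => rw [h1, map_add, map_smul, map_smul, smul_eq_mul, smul_eq_mul]
  have h4 : ∀ L : ℂ →L[ℝ] ℂ →L[ℝ] ℝ, L c = c.re • L 1 + c.im • L Complex.I := fun L => by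
    conv_lhs => rw [h1, map_add, map_smul, map_smul]
  simp only [h2, h3, h4, map_sub, map_smul, add_apply, sub_apply, smul_apply, smul_eq_mul]
  ring

end Plane

/-! ### Stokes' theorem on a compact Riemann surface -/

section Stokes

open MeasureTheory

variable {S : Type*} [TopologicalSpace S] [T2Space S] [CompactSpace S] [ChartedSpace ℂ S]
  [IsManifold 𝓘(ℂ, ℂ) ω S]

theorem tsupport_chartPartition_subset (x : S) :
    tsupport (chartPartition S x) ⊆ (extChartAt 𝓘(ℝ, ℂ) x).source := by
  rw [extChartAt_source]
  exact Classical.choose_spec (exists_chartPartition (S := S)) x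

theorem finite_chartPartition_ne_zero : {x : S | chartPartition S x ≠ 0}.Finite := by
  refine (chartPartition S).locallyFinite.finite_nonempty_of_compact.subset fun x hx => ?_
  rw [Set.mem_ofPred_eq, Function.support_nonempty_iff]
  intro h
  exact hx (DFunLike.coe_injective h)

variable (S) in
/-- The finitely many points whose charts contribute to the partition of unity. -/
def chartCenters : Finset S := (finite_chartPartition_ne_zero (S := S)).toFinset

theorem chartPartition_eq_zero {x : S} (hx : x ∉ chartCenters S) : chartPartition S x = 0 := by
  by_contra h
  exact hx (finite_chartPartition_ne_zero.mem_toFinset.2 h)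

theorem sum_chartPartition (q : S) : ∑ x ∈ chartCenters S, chartPartition S x q = 1 := by
  rw [← (chartPartition S).sum_eq_one (Set.mem_univ q)]
  refine (finsum_eq_sum_of_support_subset _ fun x hx => ?_).symm
  rw [Finset.mem_coe]
  by_contra h
  exact hx (by simp [chartPartition_eq_zero h])

/-- The function `ρ_y` of the partition of unity in the preferred chart at `x`. -/
def partRep (x y : S) (z : ℂ) : ℝ := chartPartition S y ((extChartAt 𝓘(ℝ, ℂ) x).symm z)

/-- The support of `ρ_x` in the preferred chart at `x`. -/
def partSupport (x : S) : Set ℂ := extChartAt 𝓘(ℝ, ℂ) x '' tsupport (chartPartition S x)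

theorem isCompact_partSupport (x : S) : IsCompact (partSupport x) :=
  (isClosed_tsupport _).isCompact.image_of_continuousOn
    ((continuousOn_extChartAt x).mono (tsupport_chartPartition_subset x))

theorem partSupport_subset (x : S) : partSupport x ⊆ (extChartAt 𝓘(ℝ, ℂ) x).target := by
  rintro _ ⟨q, hq, rfl⟩
  exact (extChartAt 𝓘(ℝ, ℂ) x).map_source (tsupport_chartPartition_subset x hq)

theorem symm_notMem_tsupport {x : S} {z : ℂ} (hz : z ∈ (extChartAt 𝓘(ℝ, ℂ) x).target)
    (h : z ∉ partSupport x) :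
    (extChartAt 𝓘(ℝ, ℂ) x).symm z ∉ tsupport (chartPartition S x) := fun h' =>
  h ⟨_, h', (extChartAt 𝓘(ℝ, ℂ) x).right_inv hz⟩

theorem partRep_eq_zero {x y : S} {z : ℂ}
    (h : (extChartAt 𝓘(ℝ, ℂ) x).symm z ∉ tsupport (chartPartition S y)) : partRep x y z = 0 :=
  image_eq_zero_of_notMem_tsupport (f := chartPartition S y) h

theorem contDiffOn_partRep (x y : S) :
    ContDiffOn ℝ ∞ (partRep x y) (extChartAt 𝓘(ℝ, ℂ) x).target := fun z hz => by
  have h := (contMDiffAt_iff_chart ((extChartAt 𝓘(ℝ, ℂ) x).map_target hz)).1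
    ((chartPartition S y).contMDiff ((extChartAt 𝓘(ℝ, ℂ) x).symm z))
  rw [(extChartAt 𝓘(ℝ, ℂ) x).right_inv hz] at h
  exact h.contDiffWithinAt

theorem integrableOn_partRep_mul {f : ℂ → ℝ} {x : S}
    (hf : ContinuousOn f (extChartAt 𝓘(ℝ, ℂ) x).target) :
    IntegrableOn (fun z => partRep x x z * f z) (extChartAt 𝓘(ℝ, ℂ) x).target :=
  integrableOn_of_compact_support (isOpen_extChartAt_target x) (isCompact_partSupport x)
    (partSupport_subset x) ((contDiffOn_partRep x x).continuousOn.mul hf) fun z hz h => by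
      rw [partRep_eq_zero (symm_notMem_tsupport hz h), zero_mul]

/-- Compactness leaves finitely many nonzero ρ_x, and the derivative of the inverse chart is
`chartDInv`, so the integrands become chart components. -/
theorem surfaceIntegral_eq
    (η : ∀ x : S, TangentSpace 𝓘(ℝ, ℂ) x →L[ℝ] TangentSpace 𝓘(ℝ, ℂ) x →L[ℝ] ℝ) :
    surfaceIntegral η = ∑ x ∈ chartCenters S, ∫ z in (extChartAt 𝓘(ℝ, ℂ) x).target,
      partRep x x z * bilRep η x z 1 Complex.I := by
  rw [surfaceIntegral]
  have e : ∀ x : S, ∫ z in (extChartAt 𝓘(ℝ, ℂ) x).target,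
      chartPartition S x ((extChartAt 𝓘(ℝ, ℂ) x).symm z) *
        pullbackForm 𝓘(ℝ, ℂ) 𝓘(ℝ, ℂ) (extChartAt 𝓘(ℝ, ℂ) x).symm η z
          ((NormedSpace.fromTangentSpace z).symm 1)
          ((NormedSpace.fromTangentSpace z).symm Complex.I) =
      ∫ z in (extChartAt 𝓘(ℝ, ℂ) x).target, partRep x x z * bilRep η x z 1 Complex.I := fun x => by
    refine setIntegral_congr_fun (isOpen_extChartAt_target x).measurableSet fun z hz => ?_
    have h : ∀ w : ℂ, mfderiv 𝓘(ℝ, ℂ) 𝓘(ℝ, ℂ) (extChartAt 𝓘(ℝ, ℂ) x).symm z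
        ((NormedSpace.fromTangentSpace z).symm w) =
        chartField 𝓘(ℝ, ℂ) x w ((extChartAt 𝓘(ℝ, ℂ) x).symm z) := fun w =>
      mfderiv_extChartAt_symm hz w
    change _ * η _ (mfderiv 𝓘(ℝ, ℂ) 𝓘(ℝ, ℂ) (extChartAt 𝓘(ℝ, ℂ) x).symm z
        ((NormedSpace.fromTangentSpace z).symm 1)) (mfderiv 𝓘(ℝ, ℂ) 𝓘(ℝ, ℂ)
        (extChartAt 𝓘(ℝ, ℂ) x).symm z ((NormedSpace.fromTangentSpace z).symm Complex.I)) = _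
    rw [h, h]
    rfl
  simp only [e]
  refine finsum_eq_sum_of_support_subset _ fun x hx => ?_
  rw [Finset.mem_coe]
  by_contra h
  refine hx ?_
  simp [partRep, chartPartition_eq_zero h]

theorem chartTrans_mem_overlap {x y : S} {z : ℂ} (hz : z ∈ chartOverlap 𝓘(ℝ, ℂ) x y) :
    chartTrans 𝓘(ℝ, ℂ) x y z ∈ chartOverlap 𝓘(ℝ, ℂ) y x :=
  mem_chartOverlap hz.2 ((extChartAt 𝓘(ℝ, ℂ) x).map_target hz.1)

theorem chartTrans_chartTrans {x y : S} {z : ℂ} (hz : z ∈ chartOverlap 𝓘(ℝ, ℂ) x y) :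
    chartTrans 𝓘(ℝ, ℂ) y x (chartTrans 𝓘(ℝ, ℂ) x y z) = z := by
  rw [chartTrans, symm_chartTrans hz, (extChartAt 𝓘(ℝ, ℂ) x).right_inv hz.1]

/-- Change of variables between two charts. -/
theorem setIntegral_chart_change {x y : S} {F F' : ℂ → ℝ}
    (h : ∀ z ∈ chartOverlap 𝓘(ℝ, ℂ) x y, F z =
      |(fderiv ℝ (chartTrans 𝓘(ℝ, ℂ) x y) z).det| * F' (chartTrans 𝓘(ℝ, ℂ) x y z))
    (hF : ∀ z ∈ (extChartAt 𝓘(ℝ, ℂ) x).target, z ∉ chartOverlap 𝓘(ℝ, ℂ) x y → F z = 0)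
    (hF' : ∀ z ∈ (extChartAt 𝓘(ℝ, ℂ) y).target, z ∉ chartOverlap 𝓘(ℝ, ℂ) y x → F' z = 0) :
    ∫ z in (extChartAt 𝓘(ℝ, ℂ) x).target, F z = ∫ z in (extChartAt 𝓘(ℝ, ℂ) y).target, F' z := by
  have hW := isOpen_chartOverlap (I := 𝓘(ℝ, ℂ)) x y
  have hW' := isOpen_chartOverlap (I := 𝓘(ℝ, ℂ)) y x
  have himg : chartTrans 𝓘(ℝ, ℂ) x y '' chartOverlap 𝓘(ℝ, ℂ) x y = chartOverlap 𝓘(ℝ, ℂ) y x := by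
    refine Set.Subset.antisymm ?_ fun w hw => ?_
    · rintro _ ⟨z, hz, rfl⟩
      exact chartTrans_mem_overlap hz
    · exact ⟨_, chartTrans_mem_overlap hw, chartTrans_chartTrans hw⟩
  have hinj : Set.InjOn (chartTrans 𝓘(ℝ, ℂ) x y) (chartOverlap 𝓘(ℝ, ℂ) x y) := fun a ha b hb hab =>
    by rw [← chartTrans_chartTrans ha, hab, chartTrans_chartTrans hb]
  rw [setIntegral_eq_of_subset_of_forall_sdiff_eq_zero (s := chartOverlap 𝓘(ℝ, ℂ) x y)
      (isOpen_extChartAt_target x).measurableSet Set.inter_subset_left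
      (fun z hz => hF z hz.1 hz.2),
    setIntegral_eq_of_subset_of_forall_sdiff_eq_zero (s := chartOverlap 𝓘(ℝ, ℂ) y x)
      (isOpen_extChartAt_target y).measurableSet Set.inter_subset_left
      (fun z hz => hF' z hz.1 hz.2), ← himg,
    integral_image_eq_integral_abs_det_fderiv_smul volume hW.measurableSet (fun z hz =>
      ((contDiffOn_chartTrans x y).differentiableAt_of_isOpen hW
        hz).hasFDerivAt.hasFDerivWithinAt) hinj]
  exact setIntegral_congr_fun hW.measurableSet h

variable (α : ∀ x : S, TangentSpace 𝓘(ℝ, ℂ) x →L[ℝ] ℝ)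

/-- The `1`-form `ρ_y α` in the preferred chart at `x`. -/
def cutoffRep (x y : S) (z : ℂ) : ℂ →L[ℝ] ℝ := partRep x y z • covecRep 𝓘(ℝ, ℂ) α x z

variable {α}

theorem contDiffOn_cutoffRep {x : S}
    (hα : ContDiffOn ℝ ∞ (covecRep 𝓘(ℝ, ℂ) α x) (extChartAt 𝓘(ℝ, ℂ) x).target) (y : S) :
    ContDiffOn ℝ ∞ (cutoffRep α x y) (extChartAt 𝓘(ℝ, ℂ) x).target :=
  (contDiffOn_partRep x y).smul hα

theorem planeCurl_cutoffRep_eq_zero {x y : S} {z : ℂ} (hz : z ∈ (extChartAt 𝓘(ℝ, ℂ) x).target)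
    (h : (extChartAt 𝓘(ℝ, ℂ) x).symm z ∉ tsupport (chartPartition S y)) :
    planeCurl (cutoffRep α x y) z = 0 := by
  refine planeCurl_eq_zero ?_
  have hc : ContinuousAt (extChartAt 𝓘(ℝ, ℂ) x).symm z :=
    (continuousOn_extChartAt_symm x).continuousAt ((isOpen_extChartAt_target x).mem_nhds hz)
  filter_upwards [hc.preimage_mem_nhds ((isClosed_tsupport _).isOpen_compl.mem_nhds h)] with w hw
  rw [cutoffRep, partRep_eq_zero hw, zero_smul]

theorem planeCurl_covecRep {x : S}
    (hα : ContDiffOn ℝ ∞ (covecRep 𝓘(ℝ, ℂ) α x) (extChartAt 𝓘(ℝ, ℂ) x).target) {z : ℂ}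
    (hz : z ∈ (extChartAt 𝓘(ℝ, ℂ) x).target) :
    planeCurl (covecRep 𝓘(ℝ, ℂ) α x) z =
      ∑ y ∈ chartCenters S, planeCurl (cutoffRep α x y) z := by
  have hU := isOpen_extChartAt_target (I := 𝓘(ℝ, ℂ)) x
  have h1 : covecRep 𝓘(ℝ, ℂ) α x = fun z => ∑ y ∈ chartCenters S, cutoffRep α x y z := by
    ext1 w
    simp only [cutoffRep, ← Finset.sum_smul]
    rw [show ∑ y ∈ chartCenters S, partRep x y w = 1 from sum_chartPartition _, one_smul]
  have h2 : fderiv ℝ (covecRep 𝓘(ℝ, ℂ) α x) z =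
      ∑ y ∈ chartCenters S, fderiv ℝ (cutoffRep α x y) z := by
    rw [h1]
    exact fderiv_fun_sum fun y _ => (contDiffOn_cutoffRep hα y).differentiableAt_of_isOpen hU hz
  simp only [planeCurl, h2, sum_apply, Finset.sum_sub_distrib]

theorem planeCurl_cutoffRep_chartTrans {x y y' : S}
    (hα : ∀ x : S, ContDiffOn ℝ ∞ (covecRep 𝓘(ℝ, ℂ) α x) (extChartAt 𝓘(ℝ, ℂ) x).target) {z : ℂ}
    (hz : z ∈ chartOverlap 𝓘(ℝ, ℂ) x y) :
    planeCurl (cutoffRep α x y') z = |(fderiv ℝ (chartTrans 𝓘(ℝ, ℂ) x y) z).det| *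
      planeCurl (cutoffRep α y y') (chartTrans 𝓘(ℝ, ℂ) x y z) := by
  refine planeCurl_pullback (isOpen_chartOverlap x y) (contDiffOn_chartTrans x y)
    (fun w hw => ?_) hz ((contDiffOn_cutoffRep (hα y) y').differentiableAt_of_isOpen
      (isOpen_extChartAt_target y) (chartTrans_mem hz)) fun w => fderiv_chartTrans_mul hz w
  rw [cutoffRep, cutoffRep, covecRep_chartTrans α hw, partRep, partRep, symm_chartTrans hw,
    ContinuousLinearMap.smul_comp]

/-- Stokes' theorem: the integral of an exact form vanishes. -/
theorem sum_integral_planeCurl_eq_zero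
    (hα : ∀ x : S, ContDiffOn ℝ ∞ (covecRep 𝓘(ℝ, ℂ) α x) (extChartAt 𝓘(ℝ, ℂ) x).target) :
    ∑ x ∈ chartCenters S, ∫ z in (extChartAt 𝓘(ℝ, ℂ) x).target,
      partRep x x z * planeCurl (covecRep 𝓘(ℝ, ℂ) α x) z = 0 := by
  have hU := fun x : S => isOpen_extChartAt_target (I := 𝓘(ℝ, ℂ)) x
  have hcurl : ∀ x y : S, ContinuousOn (planeCurl (cutoffRep α x y))
      (extChartAt 𝓘(ℝ, ℂ) x).target := fun x y =>
    continuousOn_planeCurl (hU x) (contDiffOn_cutoffRep (hα x) y)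
  -- A second copy of the partition of unity is inserted under the derivative: dα = ∑_y d(ρ_y α).
  have h1 : ∀ x : S, ∫ z in (extChartAt 𝓘(ℝ, ℂ) x).target,
      partRep x x z * planeCurl (covecRep 𝓘(ℝ, ℂ) α x) z =
      ∑ y ∈ chartCenters S, ∫ z in (extChartAt 𝓘(ℝ, ℂ) x).target,
        partRep x x z * planeCurl (cutoffRep α x y) z := fun x => by
    rw [← integral_finsetSum _ fun y _ => integrableOn_partRep_mul (hcurl x y)]
    refine setIntegral_congr_fun (hU x).measurableSet fun z hz => ?_
    simp only [planeCurl_covecRep (hα x) hz, Finset.mul_sum]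
  -- Each product ρ_x d(ρ_y α) is supported in both chart domains, so its integral can be carried
  -- from the chart at x to the chart at y.
  have h2 : ∀ x y : S, ∫ z in (extChartAt 𝓘(ℝ, ℂ) x).target,
      partRep x x z * planeCurl (cutoffRep α x y) z =
      ∫ z in (extChartAt 𝓘(ℝ, ℂ) y).target,
        partRep y x z * planeCurl (cutoffRep α y y) z := fun x y => by
    refine setIntegral_chart_change (fun z hz => ?_) (fun z hz h => ?_) (fun z hz h => ?_)
    · rw [planeCurl_cutoffRep_chartTrans hα hz, partRep, partRep, symm_chartTrans hz]
      ring
    · rw [planeCurl_cutoffRep_eq_zero hz fun h' => h ⟨hz, tsupport_chartPartition_subset y h'⟩,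
        mul_zero]
    · rw [partRep_eq_zero fun h' => h ⟨hz, tsupport_chartPartition_subset x h'⟩, zero_mul]
  -- In the chart at y the weights ρ_x now add up to 1, leaving the integral of d(ρ_y α) with ρ_y α
  -- compactly supported in that chart.
  have h3 : ∀ y : S, ∑ x ∈ chartCenters S, ∫ z in (extChartAt 𝓘(ℝ, ℂ) y).target,
      partRep y x z * planeCurl (cutoffRep α y y) z = 0 := fun y => by
    have h0 : ∀ z ∈ (extChartAt 𝓘(ℝ, ℂ) y).target, z ∉ partSupport y →
        planeCurl (cutoffRep α y y) z = 0 := fun z hz h =>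
      planeCurl_cutoffRep_eq_zero hz (symm_notMem_tsupport hz h)
    have hi : ∀ x ∈ chartCenters S, IntegrableOn
        (fun z => partRep y x z * planeCurl (cutoffRep α y y) z)
        (extChartAt 𝓘(ℝ, ℂ) y).target := fun x _ =>
      integrableOn_of_compact_support (hU y) (isCompact_partSupport y) (partSupport_subset y)
        ((contDiffOn_partRep y x).continuousOn.mul (hcurl y y)) fun z hz h => by
          rw [h0 z hz h, mul_zero]
    rw [← integral_finsetSum _ hi]
    rw [← setIntegral_planeCurl_eq_zero (hU y) (isCompact_partSupport y) (partSupport_subset y)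
      (contDiffOn_cutoffRep (hα y) y) fun z hz h => by
        rw [cutoffRep, partRep_eq_zero (symm_notMem_tsupport hz h), zero_smul]]
    refine setIntegral_congr_fun (hU y).measurableSet fun z hz => ?_
    simp only [← Finset.sum_mul]
    rw [show ∑ x ∈ chartCenters S, partRep y x z = 1 from sum_chartPartition _, one_mul]
  rw [Finset.sum_congr rfl fun x _ => h1 x,
    Finset.sum_congr rfl fun x _ => Finset.sum_congr rfl fun y _ => h2 x y, Finset.sum_comm]
  exact Finset.sum_eq_zero fun y _ => h3 y

end Stokes

/-! ### Comparison of complex connections -/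

section Difference

variable {n : ℕ} {M : Type*} [TopologicalSpace M] [T2Space M]
  [ChartedSpace (EuclideanSpace ℝ (Fin n)) M] [IsManifold (𝓡 n) ∞ M]

/-- Smoothness of a covariant derivative is tested on global sections; a bump function extends a
coordinate field without changing it near q. -/
theorem exists_smooth_extension {p q : M} (hq : q ∈ (extChartAt (𝓡 n) p).source)
    (v : EuclideanSpace ℝ (Fin n)) :
    ∃ Y : ∀ q : M, TangentSpace (𝓡 n) q, (∀ q, ContMDiffAt (𝓡 n)
      ((𝓡 n).prod 𝓘(ℝ, EuclideanSpace ℝ (Fin n))) ∞ (fun q => TotalSpace.mk'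
        (EuclideanSpace ℝ (Fin n)) (E := fun q : M => TangentSpace (𝓡 n) q) q (Y q)) q) ∧
      ∀ᶠ q' in 𝓝 q, Y q' = chartField (𝓡 n) p v q' := by
  obtain ⟨f, -, hf⟩ := (SmoothBumpFunction.nhds_basis_tsupport (I := 𝓡 n) q).mem_iff.1
    ((isOpen_extChartAt_source (I := 𝓡 n) p).mem_nhds hq)
  refine ⟨fun q => f q • chartField (𝓡 n) p v q, fun q' => ?_, ?_⟩
  · by_cases hq' : q' ∈ (extChartAt (𝓡 n) p).source
    · rw [contMDiffAt_vecRep hq']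
      have h1 := (contMDiffAt_iff_chart hq').1 (f.contMDiff q')
      refine (h1.smul (contDiffAt_const (c := v))).congr_of_eventuallyEq ?_
      filter_upwards [(isOpen_extChartAt_target p).mem_nhds
        ((extChartAt (𝓡 n) p).map_source hq')] with y hy
      have h2 := vecRep_chartField (I := 𝓡 n) p v hy
      rw [vecRep] at h2 ⊢
      rw [map_smul, h2]
      rfl
    · have hqq : q' ∈ (extChartAt (𝓡 n) q').source := mem_extChartAt_source q'
      rw [contMDiffAt_vecRep hqq]
      refine (contDiffAt_const (c := 0)).congr_of_eventuallyEq ?_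
      have hc : ContinuousAt (extChartAt (𝓡 n) q').symm (extChartAt (𝓡 n) q' q') :=
        (continuousOn_extChartAt_symm q').continuousAt
          ((isOpen_extChartAt_target q').mem_nhds (mem_extChartAt_target q'))
      have hn : (tsupport f)ᶜ ∈ 𝓝 ((extChartAt (𝓡 n) q').symm (extChartAt (𝓡 n) q' q')) := by
        rw [(extChartAt (𝓡 n) q').left_inv hqq]
        exact (isClosed_tsupport _).isOpen_compl.mem_nhds fun h => hq' (hf h)
      filter_upwards [hc.preimage_mem_nhds hn] with y hy
      rw [vecRep, image_eq_zero_of_notMem_tsupport hy, zero_smul, map_zero]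
  · filter_upwards [f.eventuallyEq_one] with q' h
    simp [h]

variable {D : CovariantDerivative (𝓡 n) (EuclideanSpace ℝ (Fin n))
  (fun p : M => TangentSpace (𝓡 n) p)}

theorem mdifferentiableAt_chartField {p q : M} (hq : q ∈ (extChartAt (𝓡 n) p).source)
    (v : EuclideanSpace ℝ (Fin n)) :
    MDifferentiableAt (𝓡 n) ((𝓡 n).prod 𝓘(ℝ, EuclideanSpace ℝ (Fin n)))
      (fun q => TotalSpace.mk' (EuclideanSpace ℝ (Fin n))
        (E := fun q : M => TangentSpace (𝓡 n) q) q (chartField (𝓡 n) p v q)) q :=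
  (contMDiffAt_chartField hq v).mdifferentiableAt (by simp)

/-- Near each point a coordinate field is replaced by a global extension, which does not affect the
covariant derivative because that is local. -/
theorem contDiffOn_connRep (hD : CovariantDerivative.ContMDiffCovariantDerivative D ∞) (p : M) :
    ContDiffOn ℝ ∞ (connRep D p) (extChartAt (𝓡 n) p).target := by
  refine contDiffOn_ofComponents fun i j k y hy => ?_
  have hq := (extChartAt (𝓡 n) p).map_target hy
  obtain ⟨Y, hY, hYe⟩ := exists_smooth_extension hq (coordVec j)
  have h1 := hD.contMDiff.contMDiff (σ := Y) fun q _ => ((hY q).of_le (by simp)).contMDiffWithinAt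
  have h2 := ContMDiffAt.clm_bundle_apply (h1.contMDiffAt Filter.univ_mem)
    (contMDiffAt_chartField hq (coordVec i))
  rw [contMDiffAt_vecRep hq, (extChartAt (𝓡 n) p).right_inv hy] at h2
  have h3 : ContDiffAt ℝ ∞ (fun z => vecRep (𝓡 n) p (fun q => D Y q
      (chartField (𝓡 n) p (coordVec i) q)) z k) y :=
    (EuclideanSpace.proj k : EuclideanSpace ℝ (Fin n) →L[ℝ] ℝ).contDiff.contDiffAt.comp y h2
  refine (h3.congr_of_eventuallyEq ?_).contDiffWithinAt
  have hc : ContinuousAt (extChartAt (𝓡 n) p).symm y :=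
    (continuousOn_extChartAt_symm p).continuousAt ((isOpen_extChartAt_target p).mem_nhds hy)
  filter_upwards [hc.eventually hYe.eventually_nhds, (isOpen_extChartAt_target p).mem_nhds hy]
    with z hz hzt
  rw [connCoeff_eq, vecRep, (D.isCovariantDerivativeOn (s := Set.univ)).congr_of_eventuallyEq
    ((hY _).mdifferentiableAt (by simp)) (mdifferentiableAt_chartField
      ((extChartAt (𝓡 n) p).map_target hzt) (coordVec j)) Filter.univ_mem hz]

variable {D' : CovariantDerivative (𝓡 n) (EuclideanSpace ℝ (Fin n))
  (fun p : M => TangentSpace (𝓡 n) p)}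

variable (D D') in
/-- The difference tensor of two connections, as a map `(v, w) ↦ D_v w - D'_v w`. -/
def connDiff (q : M) (v w : TangentSpace (𝓡 n) q) : TangentSpace (𝓡 n) q :=
  haveI : IsManifold (𝓡 n) 1 M := isManifold_one
  D.difference D' q w v

theorem connDiff_apply {q : M} {Y : ∀ q : M, TangentSpace (𝓡 n) q}
    (hY : MDifferentiableAt (𝓡 n) ((𝓡 n).prod 𝓘(ℝ, EuclideanSpace ℝ (Fin n)))
      (fun q => TotalSpace.mk' (EuclideanSpace ℝ (Fin n))
        (E := fun q : M => TangentSpace (𝓡 n) q) q (Y q)) q) (v : TangentSpace (𝓡 n) q) :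
    connDiff D D' q v (Y q) = D Y q v - D' Y q v := by
  have : IsManifold (𝓡 n) 1 M := isManifold_one
  have h := IsCovariantDerivativeOn.difference_apply D.isCovariantDerivativeOnUniv
    D'.isCovariantDerivativeOnUniv (Set.mem_univ q) hY
  exact DFunLike.congr_fun h v

/-- The inhomogeneous parts of the two connections cancel, leaving a tensor; bilinearity reduces the
comparison to coordinate vectors. -/
theorem connRep_sub {p : M} {y : EuclideanSpace ℝ (Fin n)}
    (hy : y ∈ (extChartAt (𝓡 n) p).target) (u w : EuclideanSpace ℝ (Fin n)) :
    connRep D p y u w - connRep D' p y u w = chartD (𝓡 n) p ((extChartAt (𝓡 n) p).symm y)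
      (connDiff D D' ((extChartAt (𝓡 n) p).symm y)
        (chartDInv (𝓡 n) p ((extChartAt (𝓡 n) p).symm y) u)
        (chartDInv (𝓡 n) p ((extChartAt (𝓡 n) p).symm y) w)) := by
  have hq := (extChartAt (𝓡 n) p).map_target hy
  induction u using coord_induction with
  | h0 => simp only [connDiff, map_zero, zero_apply, sub_self]
  | hadd a b ha hb =>
    simp only [connDiff, map_add, add_apply] at ha hb ⊢
    rw [← ha, ← hb]
    abel
  | hsmul c a ha =>
    simp only [connDiff, map_smul, smul_apply] at ha ⊢
    rw [← ha, smul_sub]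
  | h i =>
    induction w using coord_induction with
    | h0 => simp only [connDiff, map_zero, zero_apply, sub_self]
    | hadd a b ha hb =>
      simp only [connDiff, map_add, add_apply] at ha hb ⊢
      rw [← ha, ← hb]
      abel
    | hsmul c a ha =>
      simp only [connDiff, map_smul, smul_apply] at ha ⊢
      rw [← ha, smul_sub]
    | h j =>
      have h := connDiff_apply (D := D) (D' := D') (mdifferentiableAt_chartField hq (coordVec j))
        (chartField (𝓡 n) p (coordVec i) ((extChartAt (𝓡 n) p).symm y))
      change _ = chartD (𝓡 n) p _ (connDiff D D' _ (chartField (𝓡 n) p (coordVec i) _)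
        (chartField (𝓡 n) p (coordVec j) _))
      rw [h, map_sub]
      ext k
      simp only [connRep, PiLp.sub_apply, ofComponents_coordVec, connCoeff_eq]

/-- Extending w to a smooth field Y and applying both connections to JY gives complex linearity,
first for fields and then, by tensoriality, at the point. -/
theorem connDiff_J {J : ∀ p : M, TangentSpace (𝓡 n) p →L[ℝ] TangentSpace (𝓡 n) p}
    (hJ : ContMDiff (𝓡 n) ((𝓡 n).prod 𝓘(ℝ, EuclideanSpace ℝ (Fin n) →L[ℝ]
      EuclideanSpace ℝ (Fin n))) ∞ (fun p => TotalSpace.mk'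
        (EuclideanSpace ℝ (Fin n) →L[ℝ] EuclideanSpace ℝ (Fin n))
        (E := fun p : M => TangentSpace (𝓡 n) p →L[ℝ] TangentSpace (𝓡 n) p) p (J p)))
    (hD : IsComplexConnection J D) (hD' : IsComplexConnection J D') (q : M)
    (v w : TangentSpace (𝓡 n) q) :
    connDiff D D' q v (J q w) = J q (connDiff D D' q v w) := by
  have hqq : q ∈ (extChartAt (𝓡 n) q).source := mem_extChartAt_source q
  have hY := contMDiffAt_chartField hqq (chartD (𝓡 n) q q w)
  have hY' := hY.mdifferentiableAt (by simp)
  have hJY := ((ContMDiffAt.clm_bundle_apply (hJ q) hY)).mdifferentiableAt (by simp)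
  have hw : chartField (𝓡 n) q (chartD (𝓡 n) q q w) q = w := chartDInv_chartD hqq w
  have h1 := connDiff_apply (D := D) (D' := D') hY' v
  have h2 := connDiff_apply (D := D) (D' := D') hJY v
  rw [hD.complex_linear _ q v hY', hD'.complex_linear _ q v hY', ← map_sub, ← h1, hw] at h2
  exact h2

variable (D D') in
/-- The `1`-form `v ↦ tr (J (D_v - D'_v))`. -/
def traceDiff (J : ∀ p : M, TangentSpace (𝓡 n) p →L[ℝ] TangentSpace (𝓡 n) p) (q : M) :
    TangentSpace (𝓡 n) q →L[ℝ] ℝ :=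
  (traceForm (endRep J q) (connRep D q - connRep D' q) (extChartAt (𝓡 n) q q)).comp
    (chartD (𝓡 n) q q)

/-- `traceDiff` uses a different chart at each point. Since the trace is invariant under
conjugation, in a fixed chart it has the same formula, which is what allows it to be differentiated.
-/
theorem covecRep_traceDiff (J : ∀ p : M, TangentSpace (𝓡 n) p →L[ℝ] TangentSpace (𝓡 n) p) {p : M}
    {y : EuclideanSpace ℝ (Fin n)} (hy : y ∈ (extChartAt (𝓡 n) p).target) :
    covecRep (𝓡 n) (traceDiff D D' J) p y =
      traceForm (endRep J p) (connRep D p - connRep D' p) y := by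
  ext1 u
  set q := (extChartAt (𝓡 n) p).symm y with hqdef
  have hq : q ∈ (extChartAt (𝓡 n) p).source := (extChartAt (𝓡 n) p).map_target hy
  have hqq : q ∈ (extChartAt (𝓡 n) q).source := mem_extChartAt_source q
  have hqt := mem_extChartAt_target (I := 𝓡 n) q
  rw [covecRep_apply, traceDiff, ContinuousLinearMap.comp_apply, traceForm_apply, traceForm_apply]
  symm
  refine endTrace_eq_of_conj (P := chartD (𝓡 n) q q ∘L chartDInv (𝓡 n) p q)
    (Q := chartD (𝓡 n) p q ∘L chartDInv (𝓡 n) q q) ?_ ?_ ?_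
  · ext1 w
    change chartD (𝓡 n) q q (chartDInv (𝓡 n) p q (chartD (𝓡 n) p q (chartDInv (𝓡 n) q q w))) = w
    rw [chartDInv_chartD hq, chartD_chartDInv hqq]
  · ext1 w
    change chartD (𝓡 n) p q (chartDInv (𝓡 n) q q (chartD (𝓡 n) q q (chartDInv (𝓡 n) p q w))) = w
    rw [chartDInv_chartD hqq, chartD_chartDInv hq]
  · ext1 w
    have h1 := connRep_sub (D := D) (D' := D') hy u w
    have h2 := connRep_sub (D := D) (D' := D') hqt (chartD (𝓡 n) q q (chartDInv (𝓡 n) p q u))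
      (chartD (𝓡 n) q q (chartDInv (𝓡 n) p q w))
    rw [(extChartAt (𝓡 n) q).left_inv hqq, chartDInv_chartD hqq, chartDInv_chartD hqq] at h2
    rw [← hqdef] at h1
    simp only [mul_apply_eq_comp, Pi.sub_apply, sub_apply, ContinuousLinearMap.comp_apply]
    rw [h1, h2, endRep_apply, endRep_apply, vecRep_extChartAt _ hqq, vecRep, ← hqdef, chartField,
      chartField, chartDInv_chartD hq, chartDInv_chartD hq, chartDInv_chartD hqq]

theorem contDiffOn_covecRep_traceDiff
    {J : ∀ p : M, TangentSpace (𝓡 n) p →L[ℝ] TangentSpace (𝓡 n) p}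
    (hJ : ∀ p, ContDiffOn ℝ ∞ (endRep J p) (extChartAt (𝓡 n) p).target)
    (hD : CovariantDerivative.ContMDiffCovariantDerivative D ∞)
    (hD' : CovariantDerivative.ContMDiffCovariantDerivative D' ∞) (p : M) :
    ContDiffOn ℝ ∞ (covecRep (𝓡 n) (traceDiff D D' J) p) (extChartAt (𝓡 n) p).target := by
  refine ContDiffOn.congr ?_ fun y hy => covecRep_traceDiff J hy
  unfold traceForm
  exact contDiffOn_const.clm_comp (((ContinuousLinearMap.contDiff _).comp_contDiffOn
    (hJ p)).clm_comp ((contDiffOn_connRep hD p).sub (contDiffOn_connRep hD' p)))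

end Difference

/-- The Chern forms of two complex connections differ by an exact form. -/
theorem AlmostKahler.chernForm_sub {n : ℕ} {M : Type*} [TopologicalSpace M] [T2Space M]
    [ChartedSpace (EuclideanSpace ℝ (Fin n)) M] [IsManifold (𝓡 n) ∞ M] (K : AlmostKahler n M)
    {D : CovariantDerivative (𝓡 n) (EuclideanSpace ℝ (Fin n)) (fun p : M => TangentSpace (𝓡 n) p)}
    (hD : IsComplexConnection K.J D) (p : M) (u v : TangentSpace (𝓡 n) p) :
    chernForm K.J D p u v = chernForm K.J K.hermitianConnection p u v + 1 / (4 * Real.pi) *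
      (fderiv ℝ (covecRep (𝓡 n) (traceDiff D K.hermitianConnection K.J) p) (extChartAt (𝓡 n) p p)
        (chartD (𝓡 n) p p u) (chartD (𝓡 n) p p v)
      - fderiv ℝ (covecRep (𝓡 n) (traceDiff D K.hermitianConnection K.J) p) (extChartAt (𝓡 n) p p)
        (chartD (𝓡 n) p p v) (chartD (𝓡 n) p p u)) := by
  have hU := isOpen_extChartAt_target (I := 𝓡 n) p
  have hy := mem_extChartAt_target (I := 𝓡 n) p
  have hc := K.isComplexConnection_hermitianConnection
  have hak := K.isAlmostKahlerOn p
  have hd := (contDiffOn_connRep hD.smooth p).differentiableAt_of_isOpen hU hy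
  have hd' := (contDiffOn_connRep hc.smooth p).differentiableAt_of_isOpen hU hy
  have h0 : ∀ u v, covJ (connRep K.hermitianConnection p) (endRep K.J p) (extChartAt (𝓡 n) p p)
      u v = 0 := fun u v => by
    rw [covJ_apply, K.connRep_hermitianConnection hy]
    exact hak.covJ_hermitianCoeff hy u v
  have hB : ∀ u v, (connRep D p - connRep K.hermitianConnection p) (extChartAt (𝓡 n) p p) u
      (endRep K.J p (extChartAt (𝓡 n) p p) v) = endRep K.J p (extChartAt (𝓡 n) p p)
      ((connRep D p - connRep K.hermitianConnection p) (extChartAt (𝓡 n) p p) u v) := by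
    intro u v
    have hq := (extChartAt (𝓡 n) p).map_target hy
    simp only [Pi.sub_apply, sub_apply]
    rw [connRep_sub hy, connRep_sub hy, endRep_apply, endRep_apply, vecRep, vecRep,
      chartDInv_chartD hq, chartField, chartField, chartDInv_chartD hq,
      connDiff_J K.J_smooth hD hc]
  -- Transgression with A the Hermitian connection, for which J is parallel by `h0`, and with B the
  -- difference tensor, which commutes with J by `hB`.
  have h := endTrace_localCurv_sub (hak.J_diff hy) hd' (hd.sub hd') h0 hB
    (chartD (𝓡 n) p p u) (chartD (𝓡 n) p p v)
  rw [add_sub_cancel] at h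
  rw [chernForm_apply _ _ _ hd, chernForm_apply _ _ _ hd', h, ← mul_add,
    fderiv_eq_of_eqOn hU (fun y hy => covecRep_traceDiff K.J hy) hy]

/-! ### Curves -/

section CurveDensities

open MeasureTheory

variable {S : Type*} [TopologicalSpace S] [ChartedSpace ℂ S] [IsManifold 𝓘(ℂ, ℂ) ω S]

/-- Continuity is local, and each z lies in the domain attached to its own image point; so a
computation in one target chart at a time is enough. -/
theorem continuousOn_of_mapDomain {n : ℕ} {M : Type*} [TopologicalSpace M]
    [ChartedSpace (EuclideanSpace ℝ (Fin n)) M] [IsManifold (𝓡 n) ∞ M]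
    {X : Type*} [TopologicalSpace X] {ψ : S → M} (hψ : Continuous ψ) {x : S} {f : ℂ → X}
    (h : ∀ p : M, ContinuousOn f (mapDomain (𝓡 n) 𝓘(ℝ, ℂ) ψ x p)) :
    ContinuousOn f (extChartAt 𝓘(ℝ, ℂ) x).target := fun z hz =>
  ((h (ψ ((extChartAt 𝓘(ℝ, ℂ) x).symm z))).continuousAt
    ((isOpen_mapDomain hψ x _).mem_nhds ⟨hz, mem_extChartAt_source _⟩)).continuousWithinAt

/-- The image `ψ_*(∂/∂a)` of the coordinate field of the holomorphic chart `a + i b` at `x`. -/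
def curveVec {n : ℕ} {M : Type*} [TopologicalSpace M] [ChartedSpace (EuclideanSpace ℝ (Fin n)) M]
    (ψ : S → M) (x : S) (z : ℂ) : TangentSpace (𝓡 n) (ψ ((extChartAt 𝓘(ℝ, ℂ) x).symm z)) :=
  mfderiv 𝓘(ℝ, ℂ) (𝓡 n) ψ ((extChartAt 𝓘(ℝ, ℂ) x).symm z)
    (chartDInv 𝓘(ℝ, ℂ) x ((extChartAt 𝓘(ℝ, ℂ) x).symm z) 1)

/-! ### Densities along a J-holomorphic curve -/

section General

variable {n : ℕ} {M : Type*} [TopologicalSpace M] [ChartedSpace (EuclideanSpace ℝ (Fin n)) M]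
  [IsManifold (𝓡 n) ∞ M] {ψ : S → M}

theorem chartD_curveVec (hψ : ContMDiff 𝓘(ℝ, ℂ) (𝓡 n) ∞ ψ) {x : S} {p : M} {z : ℂ}
    (hz : z ∈ mapDomain (𝓡 n) 𝓘(ℝ, ℂ) ψ x p) :
    chartD (𝓡 n) p (ψ ((extChartAt 𝓘(ℝ, ℂ) x).symm z)) (curveVec ψ x z) =
      fderiv ℝ (mapRep (𝓡 n) 𝓘(ℝ, ℂ) ψ x p) z 1 :=
  (fderiv_mapRep hψ hz 1).symm

theorem continuousOn_fderiv_mapRep (hψ : ContMDiff 𝓘(ℝ, ℂ) (𝓡 n) ∞ ψ) (x : S) (p : M) (w : ℂ) :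
    ContinuousOn (fun z => fderiv ℝ (mapRep (𝓡 n) 𝓘(ℝ, ℂ) ψ x p) z w)
      (mapDomain (𝓡 n) 𝓘(ℝ, ℂ) ψ x p) :=
  (((contDiffOn_mapRep hψ x p).fderiv_smooth (isOpen_mapDomain hψ.continuous x p)).continuousOn
    ).clm_apply continuousOn_const

/-- In a holomorphic coordinate ∂_b = J_S ∂_a, hence ψ_*∂_b = Jψ_*∂_a. This is what brings the
pointwise estimates, stated on pairs (X, JX), to bear on the curve. -/
theorem pullbackForm_curve {J : ∀ p : M, TangentSpace (𝓡 n) p →L[ℝ] TangentSpace (𝓡 n) p}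
    (hψ : IsJHolomorphicCurve J ψ)
    (β : ∀ q : M, TangentSpace (𝓡 n) q →L[ℝ] TangentSpace (𝓡 n) q →L[ℝ] ℝ) {x : S} {z : ℂ}
    (hz : z ∈ (extChartAt 𝓘(ℝ, ℂ) x).target) :
    bilRep (pullbackForm 𝓘(ℝ, ℂ) (𝓡 n) ψ β) x z 1 Complex.I =
      β _ (curveVec ψ x z) (J _ (curveVec ψ x z)) := by
  have hq := (extChartAt 𝓘(ℝ, ℂ) x).map_target hz
  have h := hψ.complex_linear _ (chartDInv 𝓘(ℝ, ℂ) x ((extChartAt 𝓘(ℝ, ℂ) x).symm z) 1)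
  rw [surfaceJ_chartDInv hq, mul_one] at h
  rw [curveVec, h]
  rfl

variable (K : AlmostKahler n M)

/-- The energy density of a curve in a holomorphic chart. -/
def AlmostKahler.energyDensity (ψ : S → M) (x : S) (z : ℂ) : ℝ :=
  K.g.inner _ (curveVec ψ x z) (curveVec ψ x z)

/-- The quadratic form `nablaJForm` on the tangent vector of a curve in a holomorphic chart. -/
def AlmostKahler.nablaJDensity (ψ : S → M) (x : S) (z : ℂ) : ℝ :=
  let p := ψ ((extChartAt 𝓘(ℝ, ℂ) x).symm z)
  K.nablaJForm p (extChartAt (𝓡 n) p p) (chartD (𝓡 n) p p (curveVec ψ x z))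
    (chartD (𝓡 n) p p (curveVec ψ x z))

theorem AlmostKahler.inner_eq_bilRep {p q : M} (hq : q ∈ (extChartAt (𝓡 n) p).source)
    (u v : TangentSpace (𝓡 n) q) :
    K.g.inner q u v = bilRep K.g.inner p (extChartAt (𝓡 n) p q) (chartD (𝓡 n) p q u)
      (chartD (𝓡 n) p q v) := by
  rw [bilRep_apply, (extChartAt (𝓡 n) p).left_inv hq, chartField, chartField, chartDInv_chartD hq,
    chartDInv_chartD hq]

theorem AlmostKahler.energyDensity_nonneg (ψ : S → M) (x : S) (z : ℂ) :
    0 ≤ K.energyDensity ψ x z := by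
  rw [energyDensity]
  by_cases h : curveVec ψ x z = (0 : TangentSpace (𝓡 n) (ψ ((extChartAt 𝓘(ℝ, ℂ) x).symm z)))
  · rw [h, map_zero]
  · exact (K.g.pos _ _ h).le

theorem AlmostKahler.continuousOn_energyDensity (hψ : ContMDiff 𝓘(ℝ, ℂ) (𝓡 n) ∞ ψ) (x : S) :
    ContinuousOn (K.energyDensity ψ x) (extChartAt 𝓘(ℝ, ℂ) x).target := by
  refine continuousOn_of_mapDomain (n := n) hψ.continuous fun p => ?_
  have hm := (contDiffOn_mapRep hψ x p).continuousOn
  have hd := continuousOn_fderiv_mapRep hψ x p 1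
  refine ContinuousOn.congr ((((contDiffOn_metricRep (g := K.g) p).continuousOn.comp hm
    fun z hz => mapRep_mem hz).clm_apply hd).clm_apply hd) fun z hz => ?_
  rw [energyDensity, K.inner_eq_bilRep hz.2, chartD_curveVec hψ hz]
  rfl

theorem AlmostKahler.continuousOn_nablaJDensity (hψ : ContMDiff 𝓘(ℝ, ℂ) (𝓡 n) ∞ ψ) (x : S) :
    ContinuousOn (K.nablaJDensity ψ x) (extChartAt 𝓘(ℝ, ℂ) x).target := by
  refine continuousOn_of_mapDomain (n := n) hψ.continuous fun p => ?_
  have hm := (contDiffOn_mapRep hψ x p).continuousOn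
  have hd := continuousOn_fderiv_mapRep hψ x p 1
  refine ContinuousOn.congr (K.nablaJForm_continuousOn hm (fun z hz => mapRep_mem hz) hd hd)
    fun z hz => ?_
  rw [nablaJDensity, K.nablaJForm_extChartAt hz.2, chartD_curveVec hψ hz]
  rfl

theorem AlmostKahler.Om_curve (hψ : IsJHolomorphicCurve K.J ψ) {x : S} {z : ℂ}
    (hz : z ∈ (extChartAt 𝓘(ℝ, ℂ) x).target) :
    bilRep (pullbackForm 𝓘(ℝ, ℂ) (𝓡 n) ψ K.Om) x z 1 Complex.I = K.energyDensity ψ x z := by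
  rw [pullbackForm_curve hψ _ hz, ← K.compat]
  rfl

theorem AlmostKahler.smul_Om_curve (hψ : IsJHolomorphicCurve K.J ψ) (f : M → ℝ) {x : S} {z : ℂ}
    (hz : z ∈ (extChartAt 𝓘(ℝ, ℂ) x).target) :
    bilRep (pullbackForm 𝓘(ℝ, ℂ) (𝓡 n) ψ fun p => f p • K.Om p) x z 1 Complex.I =
      f (ψ ((extChartAt 𝓘(ℝ, ℂ) x).symm z)) * K.energyDensity ψ x z := by
  rw [pullbackForm_curve hψ _ hz, energyDensity, K.compat]
  rfl

end General

/-! ### Independence of the connection -/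

section Independence

variable {n : ℕ} {M : Type*} [TopologicalSpace M] [ChartedSpace (EuclideanSpace ℝ (Fin n)) M]
  [IsManifold (𝓡 n) ∞ M] {ψ : S → M}

theorem contDiffOn_covecRep_pullbackCovec {α : ∀ q : M, TangentSpace (𝓡 n) q →L[ℝ] ℝ}
    (hψ : ContMDiff 𝓘(ℝ, ℂ) (𝓡 n) ∞ ψ)
    (hα : ∀ p : M, ContDiffOn ℝ ∞ (covecRep (𝓡 n) α p) (extChartAt (𝓡 n) p).target) (x : S) :
    ContDiffOn ℝ ∞ (covecRep 𝓘(ℝ, ℂ) (pullbackCovec ψ α) x) (extChartAt 𝓘(ℝ, ℂ) x).target := by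
  intro z hz
  set p := ψ ((extChartAt 𝓘(ℝ, ℂ) x).symm z)
  have hW := isOpen_mapDomain (I := 𝓡 n) (I' := 𝓘(ℝ, ℂ)) hψ.continuous x p
  have hm := contDiffOn_mapRep hψ x p
  have h : ContDiffOn ℝ ∞ (covecRep 𝓘(ℝ, ℂ) (pullbackCovec ψ α) x)
      (mapDomain (𝓡 n) 𝓘(ℝ, ℂ) ψ x p) :=
    (((hα p).comp hm fun z hz => mapRep_mem hz).clm_comp (hm.fderiv_smooth hW)).congr
      fun z hz => covecRep_pullbackCovec hψ α hz
  exact (h.contDiffAt (hW.mem_nhds ⟨hz, mem_extChartAt_source p⟩)).contDiffWithinAt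

theorem planeCurl_pullbackCovec {α : ∀ q : M, TangentSpace (𝓡 n) q →L[ℝ] ℝ}
    (hψ : ContMDiff 𝓘(ℝ, ℂ) (𝓡 n) ∞ ψ)
    (hα : ∀ p : M, ContDiffOn ℝ ∞ (covecRep (𝓡 n) α p) (extChartAt (𝓡 n) p).target) {x : S}
    {p : M} {z : ℂ} (hz : z ∈ mapDomain (𝓡 n) 𝓘(ℝ, ℂ) ψ x p) :
    planeCurl (covecRep 𝓘(ℝ, ℂ) (pullbackCovec ψ α) x) z =
      fderiv ℝ (covecRep (𝓡 n) α p) (mapRep (𝓡 n) 𝓘(ℝ, ℂ) ψ x p z)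
          (fderiv ℝ (mapRep (𝓡 n) 𝓘(ℝ, ℂ) ψ x p) z 1)
          (fderiv ℝ (mapRep (𝓡 n) 𝓘(ℝ, ℂ) ψ x p) z Complex.I)
        - fderiv ℝ (covecRep (𝓡 n) α p) (mapRep (𝓡 n) 𝓘(ℝ, ℂ) ψ x p z)
          (fderiv ℝ (mapRep (𝓡 n) 𝓘(ℝ, ℂ) ψ x p) z Complex.I)
          (fderiv ℝ (mapRep (𝓡 n) 𝓘(ℝ, ℂ) ψ x p) z 1) := by
  have hW := isOpen_mapDomain (I := 𝓡 n) (I' := 𝓘(ℝ, ℂ)) hψ.continuous x p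
  rw [planeCurl_congr (Filter.eventually_of_mem (hW.mem_nhds hz) fun w hw =>
    covecRep_pullbackCovec hψ α hw)]
  exact fderiv_pullback_antisymm hW (contDiffOn_mapRep hψ x p) hz
    ((hα p).differentiableAt_of_isOpen (isOpen_extChartAt_target p) (mapRep_mem hz)) 1 Complex.I

variable [T2Space M] (K : AlmostKahler n M)

theorem AlmostKahler.chernForm_pullback_sub (hψ : ContMDiff 𝓘(ℝ, ℂ) (𝓡 n) ∞ ψ)
    {D : CovariantDerivative (𝓡 n) (EuclideanSpace ℝ (Fin n)) (fun p : M => TangentSpace (𝓡 n) p)}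
    (hD : IsComplexConnection K.J D) {x : S} {z : ℂ}
    (hz : z ∈ (extChartAt 𝓘(ℝ, ℂ) x).target) :
    bilRep (pullbackForm 𝓘(ℝ, ℂ) (𝓡 n) ψ (chernForm K.J D)) x z 1 Complex.I =
      bilRep (pullbackForm 𝓘(ℝ, ℂ) (𝓡 n) ψ (chernForm K.J K.hermitianConnection)) x z 1 Complex.I
      + 1 / (4 * Real.pi) * planeCurl (covecRep 𝓘(ℝ, ℂ)
        (pullbackCovec ψ (traceDiff D K.hermitianConnection K.J)) x) z := by
  set q := (extChartAt 𝓘(ℝ, ℂ) x).symm z with hqdef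
  have hzd : z ∈ mapDomain (𝓡 n) 𝓘(ℝ, ℂ) ψ x (ψ q) := ⟨hz, mem_extChartAt_source (ψ q)⟩
  rw [planeCurl_pullbackCovec hψ (contDiffOn_covecRep_traceDiff (contDiffOn_endRep K.J_smooth)
    hD.smooth K.isComplexConnection_hermitianConnection.smooth) hzd, fderiv_mapRep hψ hzd,
    fderiv_mapRep hψ hzd]
  exact K.chernForm_sub hD (ψ q) _ _

variable [T2Space S] [CompactSpace S]

/-- The pulled-back forms differ by an exact form, whose integral vanishes by Stokes. Continuity of
the reference density supplies the integrability needed to split the integral. -/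
theorem AlmostKahler.integralOver_chernForm (hψ : ContMDiff 𝓘(ℝ, ℂ) (𝓡 n) ∞ ψ)
    {D : CovariantDerivative (𝓡 n) (EuclideanSpace ℝ (Fin n)) (fun p : M => TangentSpace (𝓡 n) p)}
    (hD : IsComplexConnection K.J D)
    (hc : ∀ x : S, ContinuousOn (fun z => bilRep (pullbackForm 𝓘(ℝ, ℂ) (𝓡 n) ψ
      (chernForm K.J K.hermitianConnection)) x z 1 Complex.I) (extChartAt 𝓘(ℝ, ℂ) x).target) :
    integralOver ψ (chernForm K.J D) = integralOver ψ (chernForm K.J K.hermitianConnection) := by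
  have hα := contDiffOn_covecRep_pullbackCovec hψ
    (contDiffOn_covecRep_traceDiff (contDiffOn_endRep K.J_smooth)
    hD.smooth K.isComplexConnection_hermitianConnection.smooth)
  have hs := sum_integral_planeCurl_eq_zero hα
  set θ := pullbackCovec (I' := 𝓘(ℝ, ℂ)) ψ (traceDiff D K.hermitianConnection K.J)
  rw [integralOver, integralOver, surfaceIntegral_eq, surfaceIntegral_eq]
  have h : ∀ x : S, ∫ z in (extChartAt 𝓘(ℝ, ℂ) x).target, partRep x x z *
      bilRep (pullbackForm 𝓘(ℝ, ℂ) (𝓡 n) ψ (chernForm K.J D)) x z 1 Complex.I =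
      (∫ z in (extChartAt 𝓘(ℝ, ℂ) x).target, partRep x x z *
        bilRep (pullbackForm 𝓘(ℝ, ℂ) (𝓡 n) ψ (chernForm K.J K.hermitianConnection)) x z 1
          Complex.I) + 1 / (4 * Real.pi) * ∫ z in (extChartAt 𝓘(ℝ, ℂ) x).target,
        partRep x x z * planeCurl (covecRep 𝓘(ℝ, ℂ) θ x) z := fun x => by
    have hU := isOpen_extChartAt_target (I := 𝓘(ℝ, ℂ)) x
    rw [← integral_const_mul, ← integral_add (integrableOn_partRep_mul (hc x))
      ((integrableOn_partRep_mul (continuousOn_planeCurl hU (hα x))).const_mul _)]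
    refine setIntegral_congr_fun hU.measurableSet fun z hz => ?_
    simp only [K.chernForm_pullback_sub hψ hD hz]
    ring
  rw [Finset.sum_congr rfl fun x _ => h x, Finset.sum_add_distrib, ← Finset.mul_sum, hs, mul_zero,
    add_zero]

end Independence

/-! ### Comparison of the integrals -/

section Comparison

variable {M : Type*} [TopologicalSpace M] [ChartedSpace (EuclideanSpace ℝ (Fin 4)) M]
  [IsManifold (𝓡 4) ∞ M] {ψ : S → M} (K : AlmostKahler 4 M)

/-- The Einstein equation replaces s⋆ by 4λ + ½|∇J|², and the norm is then computed in one fixed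
chart. -/
theorem AlmostKahler.continuousOn_starScalar_curve {lam : ℝ}
    (h : ∀ (p : M) (j k : Fin 4), ricci K.g p j k = lam * metricAt K.g p j k)
    (hψ : ContMDiff 𝓘(ℝ, ℂ) (𝓡 4) ∞ ψ) (x : S) :
    ContinuousOn (fun z => K.starScalar (ψ ((extChartAt 𝓘(ℝ, ℂ) x).symm z)))
      (extChartAt 𝓘(ℝ, ℂ) x).target := by
  refine continuousOn_of_mapDomain (n := 4) hψ.continuous fun p => ?_
  have hm := (contDiffOn_mapRep hψ x p).continuousOn
  refine ContinuousOn.congr (f := fun z => 4 * lam + 1 / 2 * K.nablaJNormSq p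
    (mapRep (𝓡 4) 𝓘(ℝ, ℂ) ψ x p z)) ?_ fun z hz => ?_
  · exact continuousOn_const.add (continuousOn_const.mul
      ((K.nablaJNormSq_continuousOn p).comp hm fun z hz => mapRep_mem hz))
  · simp only [K.starScalar_eq_add (h _), K.nablaJNormSq_extChartAt hz.2]
    rfl

variable [T2Space S] [CompactSpace S]

/-- The inequality survives multiplication by the nonnegative functions ρ_x. The constants a and b
accommodate the factors s and 8π, and b = 0 gives a sign criterion. -/
theorem surfaceIntegral_mono_of_density
    {η η' : ∀ x : S, TangentSpace 𝓘(ℝ, ℂ) x →L[ℝ] TangentSpace 𝓘(ℝ, ℂ) x →L[ℝ] ℝ} {a b : ℝ}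
    (hη : ∀ x, ContinuousOn (fun z => bilRep η x z 1 Complex.I) (extChartAt 𝓘(ℝ, ℂ) x).target)
    (hη' : ∀ x, ContinuousOn (fun z => bilRep η' x z 1 Complex.I) (extChartAt 𝓘(ℝ, ℂ) x).target)
    (h : ∀ x, ∀ z ∈ (extChartAt 𝓘(ℝ, ℂ) x).target,
      a * bilRep η x z 1 Complex.I ≤ b * bilRep η' x z 1 Complex.I) :
    a * surfaceIntegral η ≤ b * surfaceIntegral η' := by
  rw [surfaceIntegral_eq, surfaceIntegral_eq, Finset.mul_sum, Finset.mul_sum]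
  refine Finset.sum_le_sum fun x _ => ?_
  rw [← integral_const_mul, ← integral_const_mul]
  refine setIntegral_mono_on ((integrableOn_partRep_mul (hη x)).const_mul _)
    ((integrableOn_partRep_mul (hη' x)).const_mul _)
    (isOpen_extChartAt_target (I := 𝓘(ℝ, ℂ)) x).measurableSet fun z hz => ?_
  rw [mul_left_comm, mul_left_comm b]
  exact mul_le_mul_of_nonneg_left (h x z hz) ((chartPartition S).nonneg x _)

/-- The density of the Chern form along a curve. -/
theorem AlmostKahler.chernForm_curve {lam : ℝ}
    (h : ∀ (p : M) (j k : Fin 4), ricci K.g p j k = lam * metricAt K.g p j k)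
    (hψ : IsJHolomorphicCurve K.J ψ) {x : S} {z : ℂ}
    (hz : z ∈ (extChartAt 𝓘(ℝ, ℂ) x).target) :
    8 * Real.pi * bilRep (pullbackForm 𝓘(ℝ, ℂ) (𝓡 4) ψ (chernForm K.J K.hermitianConnection))
      x z 1 Complex.I = K.starScalar (ψ ((extChartAt 𝓘(ℝ, ℂ) x).symm z)) * K.energyDensity ψ x z -
        K.nablaJDensity ψ x z := by
  rw [pullbackForm_curve hψ _ hz]
  exact K.chernForm_hermitianConnection (h _) _

theorem AlmostKahler.continuousOn_chernForm_curve {lam : ℝ}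
    (h : ∀ (p : M) (j k : Fin 4), ricci K.g p j k = lam * metricAt K.g p j k)
    (hψ : IsJHolomorphicCurve K.J ψ) (x : S) :
    ContinuousOn (fun z => bilRep (pullbackForm 𝓘(ℝ, ℂ) (𝓡 4) ψ
      (chernForm K.J K.hermitianConnection)) x z 1 Complex.I) (extChartAt 𝓘(ℝ, ℂ) x).target := by
  refine ContinuousOn.congr (f := fun z => (8 * Real.pi)⁻¹ *
    (K.starScalar (ψ ((extChartAt 𝓘(ℝ, ℂ) x).symm z)) * K.energyDensity ψ x z -
      K.nablaJDensity ψ x z)) ?_ fun z hz => ?_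
  · exact continuousOn_const.mul (((K.continuousOn_starScalar_curve h hψ.smooth x).mul
      (K.continuousOn_energyDensity hψ.smooth x)).sub (K.continuousOn_nablaJDensity hψ.smooth x))
  · have hpi := Real.pi_ne_zero
    simp only [← K.chernForm_curve h hψ hz]
    field_simp

theorem AlmostKahler.continuousOn_Om_curve (hψ : IsJHolomorphicCurve K.J ψ) (x : S) :
    ContinuousOn (fun z => bilRep (pullbackForm 𝓘(ℝ, ℂ) (𝓡 4) ψ K.Om) x z 1 Complex.I)
      (extChartAt 𝓘(ℝ, ℂ) x).target :=
  (K.continuousOn_energyDensity hψ.smooth x).congr fun _ hz => K.Om_curve hψ hz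

theorem AlmostKahler.continuousOn_starScalar_smul_Om_curve {lam : ℝ}
    (h : ∀ (p : M) (j k : Fin 4), ricci K.g p j k = lam * metricAt K.g p j k)
    (hψ : IsJHolomorphicCurve K.J ψ) (x : S) :
    ContinuousOn (fun z => bilRep (pullbackForm 𝓘(ℝ, ℂ) (𝓡 4) ψ
      fun p => K.starScalar p • K.Om p) x z 1 Complex.I) (extChartAt 𝓘(ℝ, ℂ) x).target :=
  ((K.continuousOn_starScalar_curve h hψ.smooth x).mul
    (K.continuousOn_energyDensity hψ.smooth x)).congr fun _ hz => K.smul_Om_curve hψ _ hz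

theorem AlmostKahler.integralOver_Om_le {lam : ℝ}
    (h : ∀ (p : M) (j k : Fin 4), ricci K.g p j k = lam * metricAt K.g p j k)
    (hψ : IsJHolomorphicCurve K.J ψ) :
    4 * lam * integralOver ψ K.Om ≤
      8 * Real.pi * integralOver ψ (chernForm K.J K.hermitianConnection) := by
  refine surfaceIntegral_mono_of_density (K.continuousOn_Om_curve hψ)
    (K.continuousOn_chernForm_curve h hψ) fun x z hz => ?_
  rw [K.Om_curve hψ hz, K.chernForm_curve h hψ hz, K.starScalar_eq_add (h _)]
  let p := ψ ((extChartAt 𝓘(ℝ, ℂ) x).symm z)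
  -- The loss |∇_XJ|² in the Chern density is at most ½|∇J|²|X|² = (s⋆ - s)|X|², which leaves s|X|².
  have hl := K.nablaJForm_le p (chartD (𝓡 4) p p (curveVec ψ x z))
  rw [← K.inner_eq_bilRep (mem_extChartAt_source _)] at hl
  change K.nablaJDensity ψ x z ≤ _ * K.energyDensity ψ x z at hl
  linarith

theorem AlmostKahler.le_integralOver_starScalar_smul_Om {lam : ℝ}
    (h : ∀ (p : M) (j k : Fin 4), ricci K.g p j k = lam * metricAt K.g p j k)
    (hψ : IsJHolomorphicCurve K.J ψ) :
    8 * Real.pi * integralOver ψ (chernForm K.J K.hermitianConnection) ≤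
      integralOver ψ (fun p => K.starScalar p • K.Om p) := by
  rw [← one_mul (integralOver ψ fun p => K.starScalar p • K.Om p)]
  refine surfaceIntegral_mono_of_density (K.continuousOn_chernForm_curve h hψ)
    (K.continuousOn_starScalar_smul_Om_curve h hψ) fun x z hz => ?_
  rw [K.smul_Om_curve hψ _ hz, K.chernForm_curve h hψ hz, one_mul]
  have hn : 0 ≤ K.nablaJDensity ψ x z := K.nablaJForm_nonneg _ _
  linarith

theorem AlmostKahler.integralOver_starScalar_smul_Om_nonpos {lam : ℝ}
    (h : ∀ (p : M) (j k : Fin 4), ricci K.g p j k = lam * metricAt K.g p j k)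
    (hψ : IsJHolomorphicCurve K.J ψ) (hs : ∀ p, K.starScalar p ≤ 0) :
    integralOver ψ (fun p => K.starScalar p • K.Om p) ≤ 0 := by
  -- Zero is written as 0 · ∫ψ^*ω in order to use the comparison of densities; the density of ψ^*ω
  -- is |X|² ≥ 0.
  rw [← one_mul (integralOver ψ fun p => K.starScalar p • K.Om p),
    ← zero_mul (integralOver ψ K.Om)]
  refine surfaceIntegral_mono_of_density (K.continuousOn_starScalar_smul_Om_curve h hψ)
    (K.continuousOn_Om_curve hψ) fun x z hz => ?_
  rw [K.smul_Om_curve hψ _ hz, one_mul, zero_mul]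
  exact mul_nonpos_of_nonpos_of_nonneg (hs _) (K.energyDensity_nonneg ψ x z)

end Comparison

end CurveDensities

end

theorem mainTheorem6 {M : Type*} [TopologicalSpace M] [T2Space M] [SecondCountableTopology M]
    [ChartedSpace (EuclideanSpace ℝ (Fin 4)) M] [IsManifold (𝓡 4) ∞ M]
    (K : AlmostKahler 4 M) (hK : IsEinstein K.g)
    {S : Type*} [TopologicalSpace S] [T2Space S] [CompactSpace S] [ChartedSpace ℂ S]
    [IsManifold 𝓘(ℂ, ℂ) ω S]
    (ψ : S → M) (hψ : IsJHolomorphicCurve K.J ψ) :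
    ∃ c : ℝ, IsFirstChernNumber K.J ψ c ∧
      (∀ p : M, scalarCurvature K.g p * integralOver ψ K.Om ≤ 8 * Real.pi * c) ∧
      8 * Real.pi * c ≤ integralOver ψ (fun p => K.starScalar p • K.Om p) ∧
      ((∀ p : M, K.starScalar p ≤ 0) → c ≤ 0) := by
  obtain ⟨lam, h⟩ := hK
  have h1 := K.integralOver_Om_le h hψ
  have h2 := K.le_integralOver_starScalar_smul_Om h hψ
  -- The Chern number is computed with the canonical Hermitian connection, which also witnesses that
  -- complex connections exist; independence of the choice is `integralOver_chernForm`.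
  refine ⟨integralOver ψ (chernForm K.J K.hermitianConnection),
    ⟨⟨_, K.isComplexConnection_hermitianConnection⟩, fun D hD =>
      K.integralOver_chernForm hψ.smooth hD (K.continuousOn_chernForm_curve h hψ)⟩,
    fun p => ?_, h2, fun hs => ?_⟩
  · rwa [K.scalarCurvature_eq (h p)]
  · have h3 := h2.trans (K.integralOver_starScalar_smul_Om_nonpos h hψ hs)
    by_contra hc
    exact absurd h3 (not_le.2 (mul_pos (by positivity) (not_le.1 hc)))
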